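/- **Conventions.** Graphs are finite simple directed graphs. A *schedule* of a DAG $G=(V,E)$ with $n$ nodes is a topological ordering $\sigma=(\sigma_1,\dots,\sigma_n)$ of $V$. $\delta^+(v)$ is the set of out-neighbours of $v$. *Node-sum model.* For weights $w:V\to\mathbb R$, the memory profile of $\sigma$ is $\big(\sum_{j\le i}w_{\sigma_j}\big)_{i=0}^{n}$. *Computation-graph model.* A computation graph is a DAG $G=(V,E)$ with functions $\mathit{size},\mathit{scratch}:V\to\mathbb R$ such that $\mathit{size}(v)\ge 0$, $\mathit{scratch}(v)\ge-\mathit{size}(v)$ and $\mathit{scratch}(v)\ge-\sum_{u:\delta^+(u)=\{v\}}\mathit{size}(u)$ for all $v$. Let $\mathrm{live}(i)$ be the sum of $\mathit{size}(v)$ over all $v\in\{\sigma_1,\dots,\sigma_i\}$ that have an out-neighbour in $\{\sigma_{i+1},\dots,\sigma_n\}$. The memory profile of $\sigma$ is $(0,D_1,A_1,\dots,D_n,A_n)$ with $D_i=\mathrm{live}(i-1)+\mathit{size}(\sigma_i)+\mathit{scratch}(\sigma_i)$ and $A_i=\mathrm{live}(i)$. *Dominance.* A finite nonempty sequence $A$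 dominates a finite nonempty sequence $B$ if two pointers, one into each sequence, can be moved from the first to the last entries, advancing exactly one of them by one position in each step, so that at all times the entry of $A$ pointed to is at most the entry of $B$ pointed to. A schedule is *dominant* if its memory profile dominates the memory profile of every schedule of the graph. *Starborescence.* Two-terminal series-parallel graphs are obtained from single edges $s\to t$ by series and parallel composition (merging parallel edges). A starborescence is a series-parallel graph with source $s$ and sink $t$ such that deleting $s$ yields an in-tree rooted at $t$ (the underlying undirected graph is a tree, every node has at most one out-neighbour, and $t$ has none). *Caduceus.* A graph is a caduceus if it consists of a directed path $(v_1,\dots,v_p)$, $p\ge1$ (the staff), and finitely many bends, each a directed path $(v_\ell,u_1,\dots,u_k,v_r)$ with $\ell<r$ and $k\ge1$, where the internal nodes $u_i$ are distinct within and over all bends and do not lie on the staff. *Algorithms* are programs for a real RAM: memory initially zero; unit-cost addition, truncated subtraction and comparison of natural numbers, which serve as array indices; unit-cost $+,-,\times,\div$ and comparison of reals; and calls of other programs as procedures with a memory of their own, which cost the running time of the called program plus the number of entries passed in and out. A graph on $\{0,\dots,n-1\}$ is given by $n$ and its list of edges in arbitrary order, together with its real weights; a schedule is output as the list of its nodes.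 **Theorem.** There are absolute constants $c,C$ such that the following holds for every function $f:\mathbb N\to\mathbb N$. Suppose that there is an algorithm which, given a caduceus graph with $N$ nodes and real node weights, finds a dominant schedule in the node-sum model in at most $f(N)$ time. Then there is an algorithm which, given a starborescence with $n$ nodes and maximum out-degree $d$ as a computation graph, finds a dominant schedule in the computation-graph model in time at most $$2^{c\,d\log_2 d}\cdot C\,\big(n^2+f(2n+1)\big).$$ If moreover $f(2n+1)\le K f(n)$ for all $n\ge1$, with some real constant $K\ge1$ (that is, $f(2n+1)=O(f(n))$, as for every polynomial running time), then the same algorithm runs in time at most $2^{c\,d\log_2 d}\cdot CK\,(n^2+f(n))$, that is, in $2^{O(d\log d)}\cdot O(n^2+f(n))$ time. -/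

import Mathlib

/-! ### Directed graphs, given by a finite edge set on a finite vertex type -/

section Graphs

variable {V : Type} [Fintype V] [DecidableEq V]

/-- The out-neighbours `δ⁺(v)`. -/
def outNbrs (E : Finset (V × V)) (v : V) : Finset V :=
  Finset.univ.filter (fun w => (v, w) ∈ E)

/-- The maximum out-degree of a vertex. -/
def maxOutDegree (E : Finset (V × V)) : ℕ :=
  Finset.univ.sup (fun v => (outNbrs E v).card)

/-- The graph has no directed cycle. -/
def IsDAG (E : Finset (V × V)) : Prop :=
  ∀ v, ¬ Relation.TransGen (fun a b => (a, b) ∈ E) v v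

/-- `IsSeriesParallel U E s t`: the graph with vertex set `U` and edge set `E` is a two-terminal
series-parallel graph with source `s` and sink `t`. Since the pieces are subgraphs of one graph,
"identifying" vertices of two pieces means that the pieces meet in exactly these vertices; since
edges form a set, parallel edges are merged. -/
inductive IsSeriesParallel : Finset V → Finset (V × V) → V → V → Prop
  | base (s t : V) (hst : s ≠ t) : IsSeriesParallel {s, t} {(s, t)} s t
  | series (U₁ U₂ : Finset V) (E₁ E₂ : Finset (V × V)) (s r t : V)
      (h₁ : IsSeriesParallel U₁ E₁ s r) (h₂ : IsSeriesParallel U₂ E₂ r t)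
      (hU : U₁ ∩ U₂ = {r}) : IsSeriesParallel (U₁ ∪ U₂) (E₁ ∪ E₂) s t
  | parallel (U₁ U₂ : Finset V) (E₁ E₂ : Finset (V × V)) (s t : V)
      (h₁ : IsSeriesParallel U₁ E₁ s t) (h₂ : IsSeriesParallel U₂ E₂ s t)
      (hU : U₁ ∩ U₂ = {s, t}) : IsSeriesParallel (U₁ ∪ U₂) (E₁ ∪ E₂) s t

/-- The relation `r` is the edge relation of an in-tree rooted at `t`: the underlying undirected
graph is a tree, every node has at most one out-neighbour, and `t` has none. -/
def IsInTree {U : Type} (r : U → U → Prop) (t : U) : Prop :=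
  (SimpleGraph.fromRel r).IsTree ∧ (∀ v a b, r v a → r v b → a = b) ∧ ∀ w, ¬ r t w

/-- A starborescence: a series-parallel graph with source `s` and sink `t` such that removing `s`
yields an in-tree rooted at `t`. -/
def IsStarborescence (E : Finset (V × V)) : Prop :=
  ∃ s t : V, IsSeriesParallel Finset.univ E s t ∧
    ∃ ht : t ≠ s,
      IsInTree (fun a b : {v : V // v ≠ s} => (a.1, b.1) ∈ E) ⟨t, ht⟩

/-- The edges of the directed path that visits the entries of a list in order. -/
def pathEdges (l : List V) : List (V × V) := l.zip l.tail

/-- A bend `(left, u₁, …, u_k, right)`. -/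
structure Bend (V : Type) where
  left : V
  inner : List V
  right : V

/-- The vertices of a bend, in order. -/
def Bend.path (b : Bend V) : List V := b.left :: (b.inner ++ [b.right])

/-- A caduceus graph: a directed path (the staff) together with bends. Each bend is a directed
path with at least one internal node, from a staff node to a later staff node, and the internal
nodes of the bends are distinct, within and over all bends, and not on the staff. -/
def IsCaduceus (E : Finset (V × V)) : Prop :=
  ∃ (staff : List V) (bends : List (Bend V)),
    staff ≠ [] ∧
    (staff ++ bends.flatMap Bend.inner).Nodup ∧
    (∀ v, v ∈ staff ++ bends.flatMap Bend.inner) ∧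
    (∀ b ∈ bends, b.inner ≠ [] ∧
      ∃ l r : ℕ, l < r ∧ staff[l]? = some b.left ∧ staff[r]? = some b.right) ∧
    ∀ u v, (u, v) ∈ E ↔ (u, v) ∈ pathEdges staff ∨ ∃ b ∈ bends, (u, v) ∈ pathEdges b.path

/-! ### Schedules, dominance and the two memory models -/

/-- `σ` is a topological ordering of the vertices. -/
def IsSchedule (E : Finset (V × V)) (σ : List V) : Prop :=
  σ.Nodup ∧ (∀ v, v ∈ σ) ∧ σ.Pairwise (fun u v => (v, u) ∉ E)

/-- Dominance of (nonempty) sequences by pointer advancement, with indices counted from `0`: two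
pointers move from the first to the last entries, one of them by one position in each step, and at
all times the pointer into `A` refers to a value at most that of the pointer into `B`. -/
def Dominates (A B : List ℝ) : Prop :=
  ∃ p : ℕ → ℕ × ℕ,
    p 0 = (0, 0) ∧
    p (A.length + B.length - 2) = (A.length - 1, B.length - 1) ∧
    (∀ i < A.length + B.length - 2,
      p (i + 1) = ((p i).1 + 1, (p i).2) ∨ p (i + 1) = ((p i).1, (p i).2 + 1)) ∧
    ∀ i ≤ A.length + B.length - 2, A.getD (p i).1 0 ≤ B.getD (p i).2 0

/-- `σ` is a schedule that dominates all schedules, for the given memory profiles. -/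
def IsDominant (E : Finset (V × V)) (profile : List V → List ℝ) (σ : List V) : Prop :=
  IsSchedule E σ ∧ ∀ τ, IsSchedule E τ → Dominates (profile σ) (profile τ)

/-- The memory profile of a schedule in the node-sum model: the total weights of the first `i`
nodes, for `i = 0, …, n`. -/
noncomputable def nodeSumProfile (w : V → ℝ) (σ : List V) : List ℝ :=
  (List.range (σ.length + 1)).map (fun i => ∑ v ∈ (σ.take i).toFinset, w v)

/-- A computation graph: a DAG with output sizes and scratch sizes of its vertices. -/
structure ComputationGraph (V : Type) [Fintype V] [DecidableEq V] where
  edges : Finset (V × V)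
  acyclic : IsDAG edges
  size : V → ℝ
  scratch : V → ℝ
  size_nonneg : ∀ v, 0 ≤ size v
  neg_size_le_scratch : ∀ v, -size v ≤ scratch v
  sum_neg_size_le_scratch : ∀ v,
    ∑ u ∈ Finset.univ.filter (fun u => outNbrs edges u = {v}), -size u ≤ scratch v

namespace ComputationGraph

/-- The total size of the outputs of the first `i` nodes of `σ` that are still used by one of the
later nodes. -/
noncomputable def live (G : ComputationGraph V) (σ : List V) (i : ℕ) : ℝ :=
  ∑ v ∈ (σ.take i).toFinset.filter
    (fun v => (outNbrs G.edges v ∩ (σ.drop i).toFinset).Nonempty), G.size v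

/-- The memory in use during the operation at position `i` (counted from `0`) of `σ`. -/
noncomputable def memDuring (G : ComputationGraph V) (σ : List V) (i : Fin σ.length) : ℝ :=
  G.live σ i + G.size (σ.get i) + G.scratch (σ.get i)

/-- The memory in use after the operation at position `i` (counted from `0`) of `σ`. -/
noncomputable def memAfter (G : ComputationGraph V) (σ : List V) (i : Fin σ.length) : ℝ :=
  G.live σ (i + 1)

/-- The memory profile of a schedule in the computation-graph model. -/
noncomputable def profile (G : ComputationGraph V) (σ : List V) : List ℝ :=
  0 :: (List.finRange σ.length).flatMap (fun i => [G.memDuring σ i, G.memAfter σ i])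

end ComputationGraph

end Graphs

/-! ### Machine model: a real RAM with structured programs and unit-cost operations

The memory has natural-number variables, arrays of natural numbers and arrays of real numbers, all
initially zero. Names of variables and arrays are constants of the program, positions in arrays
are computed. Natural numbers can be added, subtracted (truncated) and compared; reals can be
added, subtracted, multiplied, divided and compared; reals are never converted to naturals. Each
evaluation of an operation, a constant or an array access costs one step. -/

namespace RealRAM

structure Mem where
  var : ℕ → ℕ
  nat : ℕ → ℕ → ℕ
  real : ℕ → ℕ → ℝ

inductive NatExpr
  | const (k : ℕ)
  | var (x : ℕ)
  | get (a : ℕ) (i : NatExpr)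
  | add (e₁ e₂ : NatExpr)
  | sub (e₁ e₂ : NatExpr)

namespace NatExpr

def eval (m : Mem) : NatExpr → ℕ
  | const k => k
  | var x => m.var x
  | get a i => m.nat a (i.eval m)
  | add e₁ e₂ => e₁.eval m + e₂.eval m
  | sub e₁ e₂ => e₁.eval m - e₂.eval m

def cost : NatExpr → ℕ
  | const _ => 1
  | var _ => 1
  | get _ i => 1 + i.cost
  | add e₁ e₂ => 1 + e₁.cost + e₂.cost
  | sub e₁ e₂ => 1 + e₁.cost + e₂.cost

end NatExpr

inductive RealExpr
  | const (q : ℚ)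
  | get (a : ℕ) (i : NatExpr)
  | add (e₁ e₂ : RealExpr)
  | sub (e₁ e₂ : RealExpr)
  | mul (e₁ e₂ : RealExpr)
  | div (e₁ e₂ : RealExpr)

namespace RealExpr

noncomputable def eval (m : Mem) : RealExpr → ℝ
  | const q => (q : ℝ)
  | get a i => m.real a (i.eval m)
  | add e₁ e₂ => e₁.eval m + e₂.eval m
  | sub e₁ e₂ => e₁.eval m - e₂.eval m
  | mul e₁ e₂ => e₁.eval m * e₂.eval m
  | div e₁ e₂ => e₁.eval m / e₂.eval m

def cost : RealExpr → ℕ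
  | const _ => 1
  | get _ i => 1 + i.cost
  | add e₁ e₂ => 1 + e₁.cost + e₂.cost
  | sub e₁ e₂ => 1 + e₁.cost + e₂.cost
  | mul e₁ e₂ => 1 + e₁.cost + e₂.cost
  | div e₁ e₂ => 1 + e₁.cost + e₂.cost

end RealExpr

inductive Test
  | natLe (e₁ e₂ : NatExpr)
  | realLe (e₁ e₂ : RealExpr)
  | not (b : Test)
  | and (b₁ b₂ : Test)

namespace Test

def holds (m : Mem) : Test → Prop
  | natLe e₁ e₂ => e₁.eval m ≤ e₂.eval m
  | realLe e₁ e₂ => e₁.eval m ≤ e₂.eval m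
  | not b => ¬ b.holds m
  | and b₁ b₂ => b₁.holds m ∧ b₂.holds m

def cost : Test → ℕ
  | natLe e₁ e₂ => 1 + e₁.cost + e₂.cost
  | realLe e₁ e₂ => 1 + e₁.cost + e₂.cost
  | not b => 1 + b.cost
  | and b₁ b₂ => 1 + b₁.cost + b₂.cost

end Test

/-- Programs. `setVar x e` is `x := e`, `setNat a i e` and `setReal a i e` are `a[i] := e`.
`call body a la r lr o` runs the program `body` as a procedure in a memory of its own, on the first
`la` entries of the natural array `a` and the first `lr` entries of the real array `r`, and writes
its output to the beginning of the natural array `o`. -/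
inductive Prog
  | setVar (x : ℕ) (e : NatExpr)
  | setNat (a : ℕ) (i : NatExpr) (e : NatExpr)
  | setReal (a : ℕ) (i : NatExpr) (e : RealExpr)
  | seq (p q : Prog)
  | ite (b : Test) (p q : Prog)
  | loop (b : Test) (p : Prog)
  | call (body : Prog) (a : ℕ) (la : NatExpr) (r : ℕ) (lr : NatExpr) (o : ℕ)

/-- The initial memory on an input made of a list of naturals and a list of reals: the lists are in
array `0` of the respective kind, their lengths in variables `0` and `1`, all else is zero. -/
noncomputable def Mem.ofInput (ns : List ℕ) (rs : List ℝ) : Mem where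
  var x := if x = 0 then ns.length else if x = 1 then rs.length else 0
  nat a i := if a = 0 then ns.getD i 0 else 0
  real a i := if a = 0 then rs.getD i 0 else 0

/-- The output read off a final memory: the first entries of the natural array `0`, as many as
variable `0` says. -/
def Mem.output (m : Mem) : List ℕ := (List.range (m.var 0)).map (m.nat 0)

/-- `Exec p m m' t`: program `p`, started in memory `m`, halts in memory `m'` after `t` steps. A
call costs, beyond the steps of its body, the number of entries that are passed in and out. -/
inductive Exec : Prog → Mem → Mem → ℕ → Prop
  | setVar (m : Mem) (x : ℕ) (e : NatExpr) :
      Exec (.setVar x e) m { m with var := Function.update m.var x (e.eval m) } (1 + e.cost)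
  | setNat (m : Mem) (a : ℕ) (i e : NatExpr) :
      Exec (.setNat a i e) m
        { m with nat := Function.update m.nat a
                          (Function.update (m.nat a) (i.eval m) (e.eval m)) }
        (1 + i.cost + e.cost)
  | setReal (m : Mem) (a : ℕ) (i : NatExpr) (e : RealExpr) :
      Exec (.setReal a i e) m
        { m with real := Function.update m.real a
                           (Function.update (m.real a) (i.eval m) (e.eval m)) }
        (1 + i.cost + e.cost)
  | seq (p q : Prog) (m m₁ m₂ : Mem) (t₁ t₂ : ℕ) (hp : Exec p m m₁ t₁) (hq : Exec q m₁ m₂ t₂) :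
      Exec (.seq p q) m m₂ (t₁ + t₂)
  | ite_true (b : Test) (p q : Prog) (m m' : Mem) (t : ℕ) (hb : b.holds m)
      (hp : Exec p m m' t) : Exec (.ite b p q) m m' (1 + b.cost + t)
  | ite_false (b : Test) (p q : Prog) (m m' : Mem) (t : ℕ) (hb : ¬ b.holds m)
      (hq : Exec q m m' t) : Exec (.ite b p q) m m' (1 + b.cost + t)
  | loop_done (b : Test) (p : Prog) (m : Mem) (hb : ¬ b.holds m) :
      Exec (.loop b p) m m (1 + b.cost)
  | loop_step (b : Test) (p : Prog) (m m₁ m₂ : Mem) (t₁ t₂ : ℕ) (hb : b.holds m)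
      (hp : Exec p m m₁ t₁) (hl : Exec (.loop b p) m₁ m₂ t₂) :
      Exec (.loop b p) m m₂ (1 + b.cost + t₁ + t₂)
  | call (body : Prog) (a : ℕ) (la : NatExpr) (r : ℕ) (lr : NatExpr) (o : ℕ) (m m' : Mem) (t : ℕ)
      (hbody : Exec body
        (Mem.ofInput ((List.range (la.eval m)).map (m.nat a))
          ((List.range (lr.eval m)).map (m.real r))) m' t) :
      Exec (.call body a la r lr o) m
        { m with nat := Function.update m.nat o
                          (fun i => if i < m'.output.length then m'.output.getD i 0
                                    else m.nat o i) }
        (1 + la.cost + lr.cost + la.eval m + lr.eval m + t + m'.output.length)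

/-- On input `(ns, rs)`, the program halts after `t` steps with output `out`. -/
def Computes (p : Prog) (ns : List ℕ) (rs : List ℝ) (out : List ℕ) (t : ℕ) : Prop :=
  ∃ m, Exec p (Mem.ofInput ns rs) m t ∧ m.output = out

end RealRAM

/-! ### The two algorithmic problems

A graph on the vertices `0, …, n - 1` is given to a program by `n`, followed by the list of its
edges in some order; a schedule is output as the list of its vertices. -/

/-- The list `n, u₁, v₁, …, u_m, v_m`, for a list of edges `(u_j, v_j)`. -/
def encodeGraph {n : ℕ} (L : List (Fin n × Fin n)) : List ℕ :=
  n :: L.flatMap (fun e => [e.1.val, e.2.val])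

/-- Given a caduceus graph with `n` nodes and real node weights, the program finds a dominant
schedule in the node-sum model in at most `f n` steps. -/
def SolvesCaduceus (P : RealRAM.Prog) (f : ℕ → ℕ) : Prop :=
  ∀ (n : ℕ) (E : Finset (Fin n × Fin n)) (w : Fin n → ℝ), IsCaduceus E →
    ∀ L : List (Fin n × Fin n), L.Nodup → L.toFinset = E →
      ∃ (σ : List (Fin n)) (t : ℕ),
        RealRAM.Computes P (encodeGraph L) (List.ofFn w) (σ.map Fin.val) t ∧
        IsDominant E (nodeSumProfile w) σ ∧ t ≤ f n

/-- Given a computation graph with `n` nodes and maximum out-degree `d` that is a starborescence,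
the program finds a dominant schedule in the computation-graph model in at most `T n d` steps. -/
def SolvesStarborescence (Q : RealRAM.Prog) (T : ℕ → ℕ → ℝ) : Prop :=
  ∀ (n : ℕ) (G : ComputationGraph (Fin n)), IsStarborescence G.edges →
    ∀ L : List (Fin n × Fin n), L.Nodup → L.toFinset = G.edges →
      ∃ (σ : List (Fin n)) (t : ℕ),
        RealRAM.Computes Q (encodeGraph L) (List.ofFn G.size ++ List.ofFn G.scratch)
          (σ.map Fin.val) t ∧
        IsDominant G.edges G.profile σ ∧ (t : ℝ) ≤ T n (maxOutDegree G.edges)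

/-! In the computation-graph model every profile is nonnegative and starts and ends with `0`. Hence
a schedule is dominant as soon as its peak is smallest (`dominates_profile`), and only peaks have to
be minimised.

Call a node inner if it is not the sink, is not an out-neighbour of the source `s`, and has exactly
one in-neighbour; call the other nodes branch nodes. Counting edges by tails gives at most `deg s +
n - 1` of them; counting by heads gives at least `n - 1` plus the number of nodes where branches of
the tree join. So there are at most `2 * deg s + 2` branch nodes (`card_branch_le`).

Fix the order of the branch nodes in a schedule. The inner nodes form disjoint chains, each of which
leaves a branch node and climbs to another one. With the branch nodes lined up as a staff, the
chains become bends, and the graph becomes a caduceus (`isCaduceus_caduceusEdges`). The order also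
determines which out-neighbour of `s` comes last, and thus which operation releases each output: for
a node of the tree it is the only out-neighbour, for `s` the last one. So memory usage becomes a sum
of node weights (`live_eq_sum`), once each operation `v` is split into `inV v`, which allocates
output and scratch memory, and `outV v`, which frees the scratch memory and the released outputs.

Two comparisons link the peaks. Doubling every node of a schedule of the starborescence gives a
schedule of the caduceus all of whose profile entries occur in the original profile
(`nodeSumProfile_doubled_mem`). Conversely, in a schedule of the caduceus the nodes `inV v` have
nonnegative weight, so that starting each operation only right before its end does not raise the
peak (`profile_contract_le`). Therefore the peak of a dominant schedule of the caduceus lies above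
that of its contraction and below that of every schedule with the given branch order
(`dominant_caduceus`).

The algorithm runs through all `k ^ k` lists of `k` branch nodes, calls the caduceus program for the
valid orders, and keeps the best result. Decoding a list number by repeated subtraction costs about
`k ^ k * k`, whence a total of order `k ^ (2 * k + 1) * (n ^ 2 + f (2 * n + 1))`; since `k ≤ 4 * d`,
the first factor is `2 ^ (27 * d * log d)` up to a constant. The programs are verified by weakest
preconditions with time (`Wp`, `wp_for`) and a syntactic frame rule (`Exec.frame`). -/

set_option linter.unusedSectionVars false

/-! ### A program logic for the real RAM -/

namespace RealRAM

namespace Mem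

/-- Assignment to a variable. -/
def setV (m : Mem) (x k : ℕ) : Mem := { m with var := Function.update m.var x k }

/-- Assignment to an entry of an array of naturals. -/
def setN (m : Mem) (a i k : ℕ) : Mem :=
  { m with nat := Function.update m.nat a (Function.update (m.nat a) i k) }

/-- Assignment to an entry of an array of reals. -/
noncomputable def setR (m : Mem) (a i : ℕ) (q : ℝ) : Mem :=
  { m with real := Function.update m.real a (Function.update (m.real a) i q) }

variable (m : Mem) (x y a b i k : ℕ) (q : ℝ)

@[simp] theorem setV_var : (m.setV x k).var y = if y = x then k else m.var y :=
  Function.update_apply ..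

@[simp] theorem setV_nat : (m.setV x k).nat = m.nat := rfl

@[simp] theorem setV_real : (m.setV x k).real = m.real := rfl

@[simp] theorem setN_var : (m.setN a i k).var = m.var := rfl

@[simp] theorem setN_nat :
    (m.setN a i k).nat b = if b = a then Function.update (m.nat a) i k else m.nat b :=
  Function.update_apply ..

@[simp] theorem setN_real : (m.setN a i k).real = m.real := rfl

@[simp] theorem setR_var : (m.setR a i q).var = m.var := rfl

@[simp] theorem setR_nat : (m.setR a i q).nat = m.nat := rfl

@[simp] theorem setR_real :
    (m.setR a i q).real b = if b = a then Function.update (m.real a) i q else m.real b :=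
  Function.update_apply ..

end Mem

/-- The program `p`, started in memory `m`, halts in a memory `m'` after `t` steps such that
`Q m' t`. -/
def Wp (p : Prog) (m : Mem) (Q : Mem → ℕ → Prop) : Prop :=
  ∃ m' t, Exec p m m' t ∧ Q m' t

theorem Wp.mono {p : Prog} {m : Mem} {Q R : Mem → ℕ → Prop} (h : Wp p m Q)
    (hQR : ∀ m' t, Q m' t → R m' t) : Wp p m R := by
  obtain ⟨m', t, he, hq⟩ := h
  exact ⟨m', t, he, hQR _ _ hq⟩

@[simp] theorem wp_setVar {x : ℕ} {e : NatExpr} {m : Mem} {Q : Mem → ℕ → Prop} :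
    Wp (.setVar x e) m Q ↔ Q (m.setV x (e.eval m)) (1 + e.cost) := by
  constructor
  · rintro ⟨m', t, he, hq⟩
    cases he
    exact hq
  · exact fun h => ⟨_, _, Exec.setVar m x e, h⟩

@[simp] theorem wp_setNat {a : ℕ} {i e : NatExpr} {m : Mem} {Q : Mem → ℕ → Prop} :
    Wp (.setNat a i e) m Q ↔ Q (m.setN a (i.eval m) (e.eval m)) (1 + i.cost + e.cost) := by
  constructor
  · rintro ⟨m', t, he, hq⟩
    cases he
    exact hq
  · exact fun h => ⟨_, _, Exec.setNat m a i e, h⟩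

@[simp] theorem wp_setReal {a : ℕ} {i : NatExpr} {e : RealExpr} {m : Mem}
    {Q : Mem → ℕ → Prop} :
    Wp (.setReal a i e) m Q ↔ Q (m.setR a (i.eval m) (e.eval m)) (1 + i.cost + e.cost) := by
  constructor
  · rintro ⟨m', t, he, hq⟩
    cases he
    exact hq
  · exact fun h => ⟨_, _, Exec.setReal m a i e, h⟩

@[simp] theorem wp_seq {p q : Prog} {m : Mem} {Q : Mem → ℕ → Prop} :
    Wp (.seq p q) m Q ↔ Wp p m fun m₁ t₁ => Wp q m₁ fun m₂ t₂ => Q m₂ (t₁ + t₂) := by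
  constructor
  · rintro ⟨m', t, he, hq⟩
    cases he with
    | seq _ _ _ m₁ _ t₁ t₂ h₁ h₂ => exact ⟨m₁, t₁, h₁, m', t₂, h₂, hq⟩
  · rintro ⟨m₁, t₁, h₁, m₂, t₂, h₂, hq⟩
    exact ⟨m₂, _, Exec.seq _ _ _ _ _ _ _ h₁ h₂, hq⟩

open Classical in
@[simp] theorem wp_ite {b : Test} {p q : Prog} {m : Mem} {Q : Mem → ℕ → Prop} :
    Wp (.ite b p q) m Q ↔
      if b.holds m then Wp p m fun m' t => Q m' (1 + b.cost + t)
      else Wp q m fun m' t => Q m' (1 + b.cost + t) := by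
  constructor
  · rintro ⟨m', t, he, hq⟩
    cases he with
    | ite_true _ _ _ _ _ t hb hp => rw [if_pos hb]; exact ⟨_, t, hp, hq⟩
    | ite_false _ _ _ _ _ t hb hp => rw [if_neg hb]; exact ⟨_, t, hp, hq⟩
  · split_ifs with hb
    · rintro ⟨m', t, he, hq⟩
      exact ⟨m', _, Exec.ite_true _ _ _ _ _ _ hb he, hq⟩
    · rintro ⟨m', t, he, hq⟩
      exact ⟨m', _, Exec.ite_false _ _ _ _ _ _ hb he, hq⟩

/-- The memory after a call with output `out` written to array `o`. -/
def Mem.write (m : Mem) (o : ℕ) (out : List ℕ) : Mem :=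
  { m with nat := Function.update m.nat o
                    (fun i => if i < out.length then out.getD i 0 else m.nat o i) }

theorem Wp.call {body : Prog} {a : ℕ} {la : NatExpr} {r : ℕ} {lr : NatExpr} {o : ℕ} {m : Mem}
    {Q : Mem → ℕ → Prop} {out : List ℕ} {t : ℕ}
    (h : Computes body ((List.range (la.eval m)).map (m.nat a))
      ((List.range (lr.eval m)).map (m.real r)) out t)
    (hQ : Q (m.write o out) (1 + la.cost + lr.cost + la.eval m + lr.eval m + t + out.length)) :
    Wp (.call body a la r lr o) m Q := by
  obtain ⟨m', he, rfl⟩ := h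
  exact ⟨_, _, Exec.call _ _ _ _ _ _ _ _ _ he, hQ⟩

/-! #### What a program can modify -/

namespace Prog

/-- The variables that are assigned in a program. -/
def wv : Prog → List ℕ
  | setVar x _ => [x]
  | seq p q => p.wv ++ q.wv
  | ite _ p q => p.wv ++ q.wv
  | loop _ p => p.wv
  | _ => []

/-- The arrays of naturals that are written in a program. -/
def wn : Prog → List ℕ
  | setNat a _ _ => [a]
  | seq p q => p.wn ++ q.wn
  | ite _ p q => p.wn ++ q.wn
  | loop _ p => p.wn
  | call _ _ _ _ _ o => [o]
  | _ => []

/-- The arrays of reals that are written in a program. -/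
def wr : Prog → List ℕ
  | setReal a _ _ => [a]
  | seq p q => p.wr ++ q.wr
  | ite _ p q => p.wr ++ q.wr
  | loop _ p => p.wr
  | _ => []

/-- The program that does nothing. -/
def skip : Prog := loop (.natLe (.const 1) (.const 0)) (setVar 99 (.const 0))

/-- Sequential composition of a list of programs. -/
def block : List Prog → Prog
  | [] => skip
  | [p] => p
  | p :: q :: l => seq p (block (q :: l))

/-- `for x in 0, …, e - 1 do body` -/
def for_ (x : ℕ) (e : NatExpr) (body : Prog) : Prog :=
  seq (setVar x (.const 0)) (loop (.natLe (.add (.var x) (.const 1)) e)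
    (seq body (setVar x (.add (.var x) (.const 1)))))

end Prog

/-- The memories agree on everything that the program does not assign. -/
structure Frame (p : Prog) (m m' : Mem) : Prop where
  var : ∀ x, x ∉ p.wv → m'.var x = m.var x
  nat : ∀ a, a ∉ p.wn → m'.nat a = m.nat a
  real : ∀ a, a ∉ p.wr → m'.real a = m.real a

theorem Frame.refl (p : Prog) (m : Mem) : Frame p m m :=
  ⟨fun _ _ => rfl, fun _ _ => rfl, fun _ _ => rfl⟩

theorem Frame.trans {p : Prog} {m₁ m₂ m₃ : Mem} (h : Frame p m₁ m₂) (h' : Frame p m₂ m₃) :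
    Frame p m₁ m₃ :=
  ⟨fun x hx => (h'.var x hx).trans (h.var x hx), fun x hx => (h'.nat x hx).trans (h.nat x hx),
    fun x hx => (h'.real x hx).trans (h.real x hx)⟩

theorem Frame.weaken {p q : Prog} {m m' : Mem} (h : Frame p m m') (hv : p.wv ⊆ q.wv)
    (hn : p.wn ⊆ q.wn) (hr : p.wr ⊆ q.wr) : Frame q m m' :=
  ⟨fun x hx => h.var x fun h' => hx (hv h'), fun x hx => h.nat x fun h' => hx (hn h'),
    fun x hx => h.real x fun h' => hx (hr h')⟩

/-- Names of variables and arrays are constants of the program, so what can change is read off its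
syntax. A called procedure works in a memory of its own and affects only the output array of the
call. -/
theorem Exec.frame {p : Prog} {m m' : Mem} {t : ℕ} (h : Exec p m m' t) : Frame p m m' := by
  induction h with
  | setVar m x e =>
    refine ⟨fun y hy => ?_, fun _ _ => rfl, fun _ _ => rfl⟩
    exact Function.update_of_ne (by simpa [Prog.wv] using hy) _ _
  | setNat m a i e =>
    refine ⟨fun _ _ => rfl, fun y hy => ?_, fun _ _ => rfl⟩
    exact Function.update_of_ne (by simpa [Prog.wn] using hy) _ _
  | setReal m a i e =>
    refine ⟨fun _ _ => rfl, fun _ _ => rfl, fun y hy => ?_⟩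
    exact Function.update_of_ne (by simpa [Prog.wr] using hy) _ _
  | seq p q m m₁ m₂ t₁ t₂ hp hq ihp ihq =>
    exact (ihp.weaken (by simp [Prog.wv]) (by simp [Prog.wn]) (by simp [Prog.wr])).trans
      (ihq.weaken (by simp [Prog.wv]) (by simp [Prog.wn]) (by simp [Prog.wr]))
  | ite_true b p q m m' t hb hp ih =>
    exact ih.weaken (by simp [Prog.wv]) (by simp [Prog.wn]) (by simp [Prog.wr])
  | ite_false b p q m m' t hb hp ih =>
    exact ih.weaken (by simp [Prog.wv]) (by simp [Prog.wn]) (by simp [Prog.wr])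
  | loop_done b p m hb => exact Frame.refl _ _
  | loop_step b p m m₁ m₂ t₁ t₂ hb hp hl ihp ihl =>
    exact (ihp.weaken (by simp [Prog.wv]) (by simp [Prog.wn]) (by simp [Prog.wr])).trans ihl
  | call body a la r lr o m m' t hb ih =>
    refine ⟨fun _ _ => rfl, fun y hy => ?_, fun _ _ => rfl⟩
    exact Function.update_of_ne (by simpa [Prog.wn] using hy) _ _

theorem Wp.frame {p : Prog} {m : Mem} {Q : Mem → ℕ → Prop} (h : Wp p m Q) :
    Wp p m fun m' t => Frame p m m' ∧ Q m' t := by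
  obtain ⟨m', t, he, hq⟩ := h
  exact ⟨m', t, he, he.frame, hq⟩

/-- The postcondition may use the frame of the program. -/
theorem Wp.mono_frame {p : Prog} {m : Mem} {Q R : Mem → ℕ → Prop} (h : Wp p m Q)
    (hQR : ∀ m' t, Frame p m m' → Q m' t → R m' t) : Wp p m R :=
  h.frame.mono fun m' t hq => hQR m' t hq.1 hq.2

-- The `4` is the cost of the single failing test `1 ≤ 0`.
@[simp] theorem wp_skip {m : Mem} {Q : Mem → ℕ → Prop} : Wp .skip m Q ↔ Q m 4 := by
  constructor
  · rintro ⟨m', t, he, hq⟩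
    cases he with
    | loop_done => exact hq
    | loop_step _ _ _ _ _ _ _ hb => simp [Test.holds, NatExpr.eval] at hb
  · exact fun h => ⟨_, _, Exec.loop_done _ _ _ (by simp [Test.holds, NatExpr.eval]), h⟩

@[simp] theorem wp_block_singleton {p : Prog} {m : Mem} {Q : Mem → ℕ → Prop} :
    Wp (.block [p]) m Q ↔ Wp p m Q := Iff.rfl

@[simp] theorem wp_block_cons {p q : Prog} {l : List Prog} {m : Mem} {Q : Mem → ℕ → Prop} :
    Wp (.block (p :: q :: l)) m Q ↔
      Wp p m fun m₁ t₁ => Wp (.block (q :: l)) m₁ fun m₂ t₂ => Q m₂ (t₁ + t₂) := wp_seq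

/-- A loop with a known number `N` of rounds, each of cost at most `c`. -/
theorem wp_loop {b : Test} {body : Prog} (N c : ℕ) (I : ℕ → Mem → Prop) {m₀ : Mem}
    (h₀ : I 0 m₀)
    (hb : ∀ i m, i ≤ N → Frame body m₀ m → I i m → (b.holds m ↔ i < N))
    (hbody : ∀ i m, i < N → Frame body m₀ m → I i m →
      Wp body m fun m' t => t ≤ c ∧ I (i + 1) m') :
    Wp (.loop b body) m₀ fun m t => t ≤ N * (1 + b.cost + c) + (1 + b.cost) ∧ I N m := by
  have key : ∀ j i m, i + j = N → Frame body m₀ m → I i m →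
      Wp (.loop b body) m fun m t => t ≤ j * (1 + b.cost + c) + (1 + b.cost) ∧ I N m := by
    intro j
    induction j with
    | zero =>
      intro i m hi hF hI
      have hn : ¬ b.holds m := by rw [hb i m (by omega) hF hI]; omega
      obtain rfl : i = N := by omega
      exact ⟨m, _, Exec.loop_done _ _ _ hn, by omega, hI⟩
    | succ j ih =>
      intro i m hi hF hI
      have hp : b.holds m := by rw [hb i m (by omega) hF hI]; omega
      obtain ⟨m₁, t₁, h₁, ht₁, hI₁⟩ := hbody i m (by omega) hF hI
      obtain ⟨m₂, t₂, h₂, ht₂, hI₂⟩ := ih (i + 1) m₁ (by omega) (hF.trans h₁.frame) hI₁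
      refine ⟨m₂, _, Exec.loop_step _ _ _ _ _ _ _ hp h₁ h₂, ?_, hI₂⟩
      rw [Nat.succ_mul]
      omega
  exact key N 0 m₀ (by omega) (Frame.refl _ _) h₀

/-- The rule for `for` loops, with `N` rounds of cost at most `c`. -/
theorem wp_for {x : ℕ} {e : NatExpr} {body : Prog} (N c : ℕ) (I : ℕ → Mem → Prop) {m₀ : Mem}
    (hx : x ∉ body.wv)
    (hN : ∀ m, Frame (.for_ x e body) m₀ m → e.eval m = N)
    (h₀ : I 0 (m₀.setV x 0))
    (hbody : ∀ i m, i < N → Frame (.for_ x e body) m₀ m → m.var x = i → I i m →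
      Wp body m fun m' t => t ≤ c ∧ I (i + 1) (m'.setV x (i + 1))) :
    Wp (.for_ x e body) m₀ fun m t =>
      t ≤ N * (9 + e.cost + c) + (7 + e.cost) ∧ I N m := by
  have hF₀ : Frame (.for_ x e body) m₀ (m₀.setV x 0) := by
    refine ⟨fun y hy => ?_, fun _ _ => rfl, fun _ _ => rfl⟩
    have : y ≠ x := by rintro rfl; simp [Prog.for_, Prog.wv] at hy
    simp [this]
  have hF : ∀ m, Frame (.seq body (.setVar x (.add (.var x) (.const 1)))) (m₀.setV x 0) m →
      Frame (.for_ x e body) m₀ m := fun m h =>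
    hF₀.trans (h.weaken (by simp [Prog.for_, Prog.wv]) (by simp [Prog.for_, Prog.wn])
      (by simp [Prog.for_, Prog.wr]))
  rw [Prog.for_, wp_seq, wp_setVar]
  -- Incrementing the counter costs `4`: one for the assignment and three for the sum.
  refine (wp_loop N (5 - 1 + c) (fun i m => m.var x = i ∧ I i m) ?_ ?_ ?_).mono ?_
  · exact ⟨by simp [NatExpr.eval], h₀⟩
  · intro i m hi hf hI
    simp [Test.holds, NatExpr.eval, hI.1, hN m (hF m hf)]
  · intro i m hi hf hI
    rw [wp_seq]
    refine (hbody i m hi (hF m hf) hI.1 hI.2).mono_frame ?_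
    intro m' t hf' h
    have : m'.var x = i := by rw [hf'.var x hx, hI.1]
    simp only [wp_setVar, NatExpr.eval, this, NatExpr.cost, Mem.setV_var, if_true, true_and]
    exact ⟨by omega, h.2⟩
  · rintro m t ⟨ht, -, hI⟩
    refine ⟨?_, hI⟩
    simp only [Test.cost, NatExpr.cost] at ht ⊢
    have : N * (1 + (1 + (1 + 1 + 1) + e.cost) + (5 - 1 + c)) = N * (9 + e.cost + c) := by
      congr 1; omega
    omega

/-- The array `g` begins with the list `l`. -/
def Pre {α : Type} (g : ℕ → α) (l : List α) : Prop := ∀ i (h : i < l.length), g i = l[i]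

theorem Pre.nil {α : Type} (g : ℕ → α) : Pre g [] := fun i h => by simp at h

theorem Pre.push {α : Type} {g : ℕ → α} {l : List α} (h : Pre g l) (x : α) {p : ℕ}
    (hp : p = l.length) : Pre (Function.update g p x) (l ++ [x]) := by
  subst hp
  intro i hi
  rcases Nat.lt_or_ge i l.length with h' | h'
  · rw [Function.update_of_ne (by omega), h i h', List.getElem_append_left h']
  · obtain rfl : i = l.length := by simp at hi; omega
    simp

theorem Pre.map_range {α : Type} {g : ℕ → α} {l : List α} (h : Pre g l) {p : ℕ}
    (hp : p = l.length) : (List.range p).map g = l := by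
  subst hp
  exact List.ext_getElem (by simp) fun i h₁ h₂ => by simpa using h i h₂

end RealRAM

/-! ### Positions in lists -/

section Positions

variable {α : Type} [DecidableEq α]

theorem idxOf_getElem_of_nodup {l : List α} (h : l.Nodup) (i : ℕ) (hi : i < l.length) :
    l.idxOf l[i] = i := by
  simpa using List.get_idxOf h ⟨i, hi⟩

theorem idxOf_eq_of_getElem? {l : List α} (h : l.Nodup) {i : ℕ} {a : α} (ha : l[i]? = some a) :
    l.idxOf a = i := by
  obtain ⟨hi, rfl⟩ := List.getElem?_eq_some_iff.1 ha
  exact idxOf_getElem_of_nodup h i hi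

/-- Meant for lists extracted from a schedule, with `f` the position in that schedule: extraction
keeps the relative order. -/
theorem idxOf_lt_idxOf_iff {l : List α} {f : α → ℕ} (hl : l.Pairwise fun a b => f a < f b)
    {a b : α} (ha : a ∈ l) (hb : b ∈ l) : l.idxOf a < l.idxOf b ↔ f a < f b := by
  rw [List.pairwise_iff_getElem] at hl
  have key : ∀ a b, a ∈ l → b ∈ l → l.idxOf a < l.idxOf b → f a < f b := by
    intro a b ha hb h
    have := hl _ _ (List.idxOf_lt_length_iff.2 ha) (List.idxOf_lt_length_iff.2 hb) h
    simpa using this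
  refine ⟨key a b ha hb, fun h => ?_⟩
  rcases lt_trichotomy (l.idxOf a) (l.idxOf b) with h' | h' | h'
  · exact h'
  · rw [(List.idxOf_inj ha).1 h'] at h
    exact absurd h (lt_irrefl _)
  · exact absurd (key b a hb ha h') (by omega)

theorem pairwise_idxOf_lt {l : List α} (h : l.Nodup) :
    l.Pairwise fun a b => l.idxOf a < l.idxOf b := by
  rw [List.pairwise_iff_getElem]
  intro i j hi hj hij
  rwa [idxOf_getElem_of_nodup h, idxOf_getElem_of_nodup h]

end Positions

/-! ### Dominance and peaks -/

section Dominance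

/-- The pointer into `A` passes through every entry of `A`, and at that time some entry of `B` is at
least as large. This is all that is used of dominance in the caduceus. -/
theorem Dominates.exists_le {A B : List ℝ} (h : Dominates A B) (hB : B ≠ []) {x : ℝ}
    (hx : x ∈ A) : ∃ y ∈ B, x ≤ y := by
  obtain ⟨p, h0, h1, hstep, hle⟩ := h
  obtain ⟨i, hi, rfl⟩ := List.getElem_of_mem hx
  have hB' : 0 < B.length := List.length_pos_iff.2 hB
  set N := A.length + B.length - 2 with hN
  -- The first pointer moves by at most one per step. If it never visited `j + 1`, it would stay at
  -- or below `j` and miss the last entry.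
  have hvis : ∀ j ≤ A.length - 1, ∃ q ≤ N, (p q).1 = j := by
    intro j
    induction j with
    | zero => exact fun _ => ⟨0, by omega, by simp [h0]⟩
    | succ j ih =>
      intro hj
      by_contra! hne
      have hall : ∀ q ≤ N, (p q).1 ≤ j := by
        intro q
        induction q with
        | zero => intro _; simp [h0]
        | succ q ihq =>
          intro hq
          have h₁ := ihq (by omega)
          have h₂ := hne (q + 1) hq
          rcases hstep q (by omega) with h' | h' <;> rw [h'] at h₂ ⊢ <;> simp at h₂ ⊢ <;> omega
      have := hall N le_rfl
      rw [h1] at this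
      simp at this
      omega
  -- The second pointer never exceeds its final position, so `getD` reads a true entry of `B` rather
  -- than the default value.
  have hmono : ∀ q ≤ N, (p q).2 ≤ B.length - 1 := by
    have hm : ∀ d q, q + d = N → (p q).2 ≤ (p N).2 := by
      intro d
      induction d with
      | zero => intro q hq; rw [show q = N by omega]
      | succ d ih =>
        intro q hq
        refine le_trans ?_ (ih (q + 1) (by omega))
        rcases hstep q (by omega) with h' | h' <;> rw [h'] <;> simp
    intro q hq
    have := hm (N - q) q (by omega)
    rw [h1] at this
    exact this
  obtain ⟨q, hq, hqi⟩ := hvis i (by omega)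
  have hb := hmono q hq
  have hlt : (p q).2 < B.length := by omega
  refine ⟨B[(p q).2], List.getElem_mem _, ?_⟩
  have := hle q hq
  rwa [hqi, List.getD_eq_getElem _ _ hi, List.getD_eq_getElem _ _ hlt] at this

/-- A sequence whose first and last entries are lower bounds of another sequence dominates it if
all of its entries are below one entry of the other. -/
theorem dominates_of_peak {A B : List ℝ} (hA : A ≠ []) (h0 : ∀ y ∈ B, A.getD 0 0 ≤ y)
    (h1 : ∀ y ∈ B, A.getD (A.length - 1) 0 ≤ y) {b : ℝ} (hb : b ∈ B) (hp : ∀ x ∈ A, x ≤ b) :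
    Dominates A B := by
  obtain ⟨j, hj, rfl⟩ := List.getElem_of_mem hb
  have hA' : 0 < A.length := List.length_pos_iff.2 hA
  -- While the first pointer rests at the start of `A`, the second moves to the peak `B[j]`; there
  -- it waits while the first traverses `A`; then it moves on to the end of `B`.
  refine ⟨fun q => if q ≤ j then (0, q) else
    if q ≤ j + (A.length - 1) then (q - j, j) else (A.length - 1, q - (A.length - 1)), ?_, ?_, ?_, ?_⟩
  · simp
  · dsimp only
    split_ifs <;> ext <;> simp <;> omega
  · intro i hi
    dsimp only
    split_ifs <;> first
      | (left; ext <;> simp <;> omega)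
      | (right; ext <;> simp <;> omega)
  · intro i hi
    dsimp only
    split_ifs with h h'
    · rw [List.getD_eq_getElem B _ (by omega)]
      exact h0 _ (List.getElem_mem _)
    · rw [List.getD_eq_getElem A _ (by omega), List.getD_eq_getElem B _ hj]
      exact hp _ (List.getElem_mem _)
    · rw [List.getD_eq_getElem B _ (by omega)]
      exact h1 _ (List.getElem_mem _)

end Dominance

/-! ### Schedules -/

section Schedules

variable {V : Type} [Fintype V] [DecidableEq V]

theorem IsSchedule.idxOf_lt {E : Finset (V × V)} {σ : List V} (h : IsSchedule E σ) {u v : V}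
    (huv : (u, v) ∈ E) (hne : u ≠ v) : σ.idxOf u < σ.idxOf v := by
  obtain ⟨hn, hm, hp⟩ := h
  rcases lt_trichotomy (σ.idxOf u) (σ.idxOf v) with h' | h' | h'
  · exact h'
  · exact absurd ((List.idxOf_inj (hm u)).1 h') hne
  · rw [List.pairwise_iff_getElem] at hp
    have := hp _ _ (List.idxOf_lt_length_iff.2 (hm v)) (List.idxOf_lt_length_iff.2 (hm u)) h'
    simp [huv] at this

theorem isSchedule_of_idxOf_lt {E : Finset (V × V)} {σ : List V} (hn : σ.Nodup)
    (hm : ∀ v, v ∈ σ) (h : ∀ u v, (u, v) ∈ E → σ.idxOf u < σ.idxOf v) : IsSchedule E σ := by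
  refine ⟨hn, hm, (pairwise_idxOf_lt hn).imp fun {a b} hab hE => ?_⟩
  have := h _ _ hE
  omega

theorem IsDAG.ne {E : Finset (V × V)} (h : IsDAG E) {u v : V} (huv : (u, v) ∈ E) : u ≠ v := by
  rintro rfl
  exact h u (.single huv)

/-- Reachability in a DAG is a partial order; sorting the vertices by a linear extension of it gives
a schedule. -/
theorem IsDAG.exists_isSchedule {E : Finset (V × V)} (h : IsDAG E) : ∃ σ, IsSchedule E σ := by
  classical
  let r : V → V → Prop := Relation.ReflTransGen fun a b => (a, b) ∈ E
  have hr : IsPartialOrder V r :=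
    { refl := fun _ => .refl
      trans := fun _ _ _ => .trans
      antisymm := fun a b hab hba => by
        by_contra hne
        rcases Relation.reflTransGen_iff_eq_or_transGen.1 hab with h' | h'
        · exact hne h'.symm
        · exact h a (h'.trans_left hba) }
  obtain ⟨s, hs, hrs⟩ := extend_partialOrder r
  refine ⟨Finset.univ.sort s, Finset.sort_nodup _ _, fun v => by simp, ?_⟩
  refine ((Finset.pairwise_sort Finset.univ s).and (Finset.sort_nodup Finset.univ s)).imp ?_
  rintro a b ⟨hab, hne⟩ hE
  exact hne (antisymm_of s hab (hrs _ _ (.single hE)))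

theorem mem_nodeSumProfile {w : V → ℝ} {σ : List V} {y : ℝ} :
    y ∈ nodeSumProfile w σ ↔
      ∃ q ≤ σ.length, y = ∑ v ∈ (σ.take q).toFinset, w v := by
  simp only [nodeSumProfile, List.mem_map, List.mem_range, Nat.lt_succ_iff]
  constructor <;> rintro ⟨q, hq, h⟩ <;> exact ⟨q, hq, h.symm⟩

theorem nodeSumProfile_ne_nil (w : V → ℝ) (σ : List V) : nodeSumProfile w σ ≠ [] := by
  simp [nodeSumProfile]

/-- Prefix sums become sums over all vertices with a condition on positions, so that profiles of
different schedules can be compared term by term. -/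
theorem sum_take_toFinset {σ : List V} (hm : ∀ v, v ∈ σ) (w : V → ℝ) (q : ℕ) :
    ∑ v ∈ (σ.take q).toFinset, w v = ∑ v, if σ.idxOf v < q then w v else 0 := by
  rw [← Finset.sum_filter]
  refine Finset.sum_congr ?_ fun _ _ => rfl
  ext v
  simp [List.mem_take_iff_idxOf_lt (hm v)]

/-! ### Profiles in the computation-graph model -/

namespace ComputationGraph

variable (G : ComputationGraph V)

theorem live_nonneg (σ : List V) (i : ℕ) : 0 ≤ G.live σ i :=
  Finset.sum_nonneg fun v _ => G.size_nonneg v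

theorem mem_profile {σ : List V} {y : ℝ} :
    y ∈ G.profile σ ↔ y = 0 ∨ ∃ i : Fin σ.length, y = G.memDuring σ i ∨ y = G.memAfter σ i := by
  simp [profile]

theorem profile_nonneg {σ : List V} {y : ℝ} (hy : y ∈ G.profile σ) : 0 ≤ y := by
  rw [mem_profile] at hy
  rcases hy with rfl | ⟨i, rfl | rfl⟩
  · exact le_rfl
  · have h₁ := G.live_nonneg σ i
    have h₂ := G.neg_size_le_scratch (σ.get i)
    unfold memDuring
    linarith
  · exact G.live_nonneg _ _

theorem live_length (σ : List V) {i : ℕ} (hi : σ.length ≤ i) : G.live σ i = 0 := by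
  unfold live
  rw [List.drop_eq_nil_of_le hi]
  simp

theorem live_zero (σ : List V) : G.live σ 0 = 0 := by
  simp [live]

/-- After the last operation no output has a later user; for the empty schedule the only entry is
the initial `0`. -/
theorem profile_getLast (σ : List V) :
    (G.profile σ).getD ((G.profile σ).length - 1) 0 = 0 := by
  have key : (G.profile σ).getLast? = some 0 := by
    unfold profile
    rcases Nat.eq_zero_or_pos σ.length with h | h
    · rw [List.length_eq_zero_iff.1 h]
      simp
    · have : List.finRange σ.length ≠ [] := by
        rw [← List.length_pos_iff, List.length_finRange]
        exact h
      obtain ⟨l, a, hla⟩ := List.eq_nil_or_concat' (List.finRange σ.length) |>.resolve_left this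
      have ha : (a : ℕ) = σ.length - 1 := by
        have h₁ : (List.finRange σ.length).length = l.length + 1 := by rw [hla]; simp
        have h₂ : (List.finRange σ.length)[l.length]? = some a := by rw [hla]; simp
        rw [List.getElem?_eq_some_iff] at h₂
        obtain ⟨h₃, h₄⟩ := h₂
        simp at h₁ h₄
        rw [← h₄]
        simp
        omega
      rw [hla]
      simp [memAfter]
      rw [G.live_length σ (i := a + 1) (by omega), ← List.cons_append, List.getLast?_append]
      simp
  rw [List.getLast?_eq_getElem?] at key
  rw [List.getD_eq_getElem?_getD, key]
  rfl

/-- In the computation-graph model, all profiles start and end with `0` and are nonnegative, so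
that dominance is a comparison of peaks. -/
theorem dominates_profile {σ τ : List V} {y : ℝ} (hy : y ∈ G.profile τ)
    (h : ∀ x ∈ G.profile σ, x ≤ y) : Dominates (G.profile σ) (G.profile τ) := by
  refine dominates_of_peak (by simp [profile]) (fun z hz => ?_) (fun z hz => ?_) hy h
  · simpa [profile] using G.profile_nonneg hz
  · rw [G.profile_getLast]
    exact G.profile_nonneg hz

end ComputationGraph

end Schedules

/-! ### Starborescences: inner and branch nodes -/

/-- The properties of a starborescence, with source `s` and sink `t`, that the algorithm uses. -/
structure InTreeWithSource {n : ℕ} (E : Finset (Fin n × Fin n)) (s t : Fin n) : Prop where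
  ne : s ≠ t
  no_in : ∀ u, (u, s) ∉ E
  no_out : ∀ v, (t, v) ∉ E
  ex_in : ∀ v, v ≠ s → ∃ u, (u, v) ∈ E
  ex_out : ∀ v, v ≠ t → ∃ w, (v, w) ∈ E
  uniq_out : ∀ v a b, v ≠ s → (v, a) ∈ E → (v, b) ∈ E → a = b
  acyclic : IsDAG E

section Star

variable {n : ℕ}

/-- A node of the tree, other than the sink, whose only in-neighbour is in the tree. -/
def IsInner (E : Finset (Fin n × Fin n)) (s t v : Fin n) : Prop :=
  v ≠ t ∧ (s, v) ∉ E ∧ (Finset.univ.filter fun u => (u, v) ∈ E).card = 1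

instance (E : Finset (Fin n × Fin n)) (s t v : Fin n) : Decidable (IsInner E s t v) :=
  inferInstanceAs (Decidable (_ ∧ _ ∧ _))

/-- An out-neighbour of `v`, if there is one. -/
noncomputable def nxt (E : Finset (Fin n × Fin n)) (v : Fin n) : Fin n :=
  open Classical in if h : ∃ w, (v, w) ∈ E then h.choose else v

/-- From inner nodes, go to the out-neighbour; stop at other nodes. -/
noncomputable def climbStep (E : Finset (Fin n × Fin n)) (s t v : Fin n) : Fin n :=
  if IsInner E s t v then nxt E v else v

/-- The first node that is not inner, on the way to the sink. -/
noncomputable def climb (E : Finset (Fin n × Fin n)) (s t v : Fin n) : Fin n :=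
  (climbStep E s t)^[n] v

/-- The inner nodes on the way to the sink, up to the first node that is not inner; at most `j` of
them. -/
noncomputable def chain (E : Finset (Fin n × Fin n)) (s t : Fin n) : ℕ → Fin n → List (Fin n)
  | 0, _ => []
  | j + 1, v => if IsInner E s t v then v :: chain E s t j (nxt E v) else []

variable {E : Finset (Fin n × Fin n)} {s t : Fin n}

theorem nxt_mem {v w : Fin n} (h : (v, w) ∈ E) : (v, nxt E v) ∈ E := by
  have h' : ∃ w, (v, w) ∈ E := ⟨w, h⟩
  rw [nxt, dif_pos h']
  exact h'.choose_spec

theorem IsInner.unique {v a b : Fin n} (h : IsInner E s t v) (ha : (a, v) ∈ E)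
    (hb : (b, v) ∈ E) : a = b := by
  obtain ⟨c, hc⟩ := Finset.card_eq_one.1 h.2.2
  have ha' : a ∈ Finset.univ.filter fun u => (u, v) ∈ E := by simp [ha]
  have hb' : b ∈ Finset.univ.filter fun u => (u, v) ∈ E := by simp [hb]
  rw [hc, Finset.mem_singleton] at ha' hb'
  rw [ha', hb']

theorem IsInner.exists_in {v : Fin n} (h : IsInner E s t v) : ∃ u, u ≠ s ∧ (u, v) ∈ E := by
  obtain ⟨c, hc⟩ := Finset.card_eq_one.1 h.2.2
  have : c ∈ Finset.univ.filter fun u => (u, v) ∈ E := by rw [hc]; simp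
  refine ⟨c, ?_, by simpa using this⟩
  rintro rfl
  exact h.2.1 (by simpa using this)

/-! ### Climbing along inner nodes -/

namespace InTreeWithSource

variable (hS : InTreeWithSource E s t)
include hS

theorem nxt_mem {v : Fin n} (h : v ≠ t) : (v, nxt E v) ∈ E :=
  _root_.nxt_mem (hS.ex_out v h).choose_spec

theorem eq_nxt {v w : Fin n} (hv : v ≠ s) (h : (v, w) ∈ E) : w = nxt E v :=
  hS.uniq_out v _ _ hv h (_root_.nxt_mem h)

theorem nxt_sink : nxt E t = t := by
  rw [nxt, dif_neg]
  rintro ⟨w, hw⟩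
  exact hS.no_out w hw

theorem not_inner_source : ¬ IsInner E s t s := fun h => by
  obtain ⟨u, -, hu⟩ := h.exists_in
  exact hS.no_in u hu

theorem ne_of_inner_nxt {v : Fin n} (h : IsInner E s t (nxt E v)) : v ≠ s ∧ v ≠ t := by
  constructor
  · rintro rfl
    exact h.2.1 (hS.nxt_mem hS.ne)
  · rintro rfl
    rw [hS.nxt_sink] at h
    exact h.1 rfl

/-- An increasing numbering of the nodes. -/
theorem exists_rank : ∃ r : Fin n → ℕ, (∀ v, r v < n) ∧ ∀ u v, (u, v) ∈ E → r u < r v := by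
  obtain ⟨σ, hσ⟩ := hS.acyclic.exists_isSchedule
  have hl : σ.length ≤ n := by simpa using hσ.1.length_le_card
  refine ⟨σ.idxOf, fun v => ?_, fun u v h => hσ.idxOf_lt h (hS.acyclic.ne h)⟩
  exact (List.idxOf_lt_length_iff.2 (hσ.2.1 v)).trans_le hl

theorem climbStep_iterate_of_not_inner {v : Fin n} (h : ¬ IsInner E s t v) (j : ℕ) :
    (climbStep E s t)^[j] v = v :=
  Function.iterate_fixed (by simp [climbStep, h]) j

theorem climb_of_not_inner {v : Fin n} (h : ¬ IsInner E s t v) : climb E s t v = v :=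
  hS.climbStep_iterate_of_not_inner h n

/-- Either the climb has stopped or each of its `j` steps has raised the rank. Since ranks can be
chosen below `n`, the `n` steps in `climb` suffice. -/
theorem rank_climbStep {r : Fin n → ℕ} (hr : ∀ u v, (u, v) ∈ E → r u < r v) (j : ℕ) (v : Fin n) :
    ¬ IsInner E s t ((climbStep E s t)^[j] v) ∨ r v + j ≤ r ((climbStep E s t)^[j] v) := by
  induction j generalizing v with
  | zero => right; simp
  | succ j ih =>
    rw [Function.iterate_succ_apply]
    by_cases hv : IsInner E s t v
    · rw [climbStep, if_pos hv]
      have := hr _ _ (hS.nxt_mem hv.1)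
      rcases ih (nxt E v) with h | h
      · exact Or.inl h
      · right; omega
    · left
      rw [← Function.iterate_succ_apply, hS.climbStep_iterate_of_not_inner hv]
      exact hv

theorem not_inner_climb (v : Fin n) : ¬ IsInner E s t (climb E s t v) := by
  obtain ⟨r, hr, hr'⟩ := hS.exists_rank
  rcases hS.rank_climbStep hr' n v with h | h
  · exact h
  · have := hr ((climbStep E s t)^[n] v)
    omega

theorem le_climb {r : Fin n → ℕ} (hr : ∀ u v, (u, v) ∈ E → r u < r v) (v : Fin n) :
    r v ≤ r (climb E s t v) := by
  suffices ∀ j, r v ≤ r ((climbStep E s t)^[j] v) from this n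
  intro j
  induction j generalizing v with
  | zero => simp
  | succ j ih =>
    rw [Function.iterate_succ_apply]
    refine le_trans ?_ (ih _)
    rw [climbStep]
    split_ifs with h
    · exact (hr _ _ (hS.nxt_mem h.1)).le
    · exact le_rfl

/-! #### Chains of inner nodes -/

theorem mem_chain {j : ℕ} {v x : Fin n} (h : x ∈ chain E s t j v) :
    IsInner E s t x ∧ (x = v ∨ ∃ y ∈ chain E s t j v, x = nxt E y) := by
  induction j generalizing v with
  | zero => simp [chain] at h
  | succ j ih =>
    rw [chain] at h ⊢
    split_ifs at h ⊢ with hv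
    · rcases List.mem_cons.1 h with rfl | h
      · exact ⟨hv, Or.inl rfl⟩
      · obtain ⟨h₁, rfl | ⟨y, hy, rfl⟩⟩ := ih h
        · exact ⟨h₁, Or.inr ⟨v, by simp, rfl⟩⟩
        · exact ⟨h₁, Or.inr ⟨y, by simp [hy], rfl⟩⟩
    · simp at h

/-- The bound `n ≤ j + r v` says that the fuel `j` cannot run out: the rank rises along the chain
and stays below `n`. -/
theorem nxt_mem_chain {r : Fin n → ℕ} (hr : ∀ u v, (u, v) ∈ E → r u < r v) (hrn : ∀ v, r v < n)
    {j : ℕ} {v y : Fin n} (hj : n ≤ j + r v) (hy : y ∈ chain E s t j v)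
    (h : IsInner E s t (nxt E y)) : nxt E y ∈ chain E s t j v := by
  induction j generalizing v with
  | zero => simp [chain] at hy
  | succ j ih =>
    rw [chain] at hy ⊢
    split_ifs at hy ⊢ with hv
    · have h₁ := hr _ _ (hS.nxt_mem hv.1)
      have h₂ := hrn (nxt E v)
      rcases List.mem_cons.1 hy with rfl | hy
      · obtain ⟨j, rfl⟩ : ∃ i, j = i + 1 := ⟨j - 1, by omega⟩
        simp [chain, h]
      · exact List.mem_cons_of_mem _ (ih (by omega) hy)
    · simp at hy

theorem chain_nodup (j : ℕ) (v : Fin n) : (chain E s t j v).Nodup := by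
  obtain ⟨r, -, hr⟩ := hS.exists_rank
  have hle : ∀ (j : ℕ) (v x : Fin n), x ∈ chain E s t j v → r v ≤ r x := by
    intro j
    induction j with
    | zero => intro v x hx; simp [chain] at hx
    | succ j ih =>
      intro v x hx
      rw [chain] at hx
      split_ifs at hx with hv
      · rcases List.mem_cons.1 hx with rfl | hx
        · exact le_rfl
        · exact (hr _ _ (hS.nxt_mem hv.1)).le.trans (ih _ _ hx)
      · simp at hx
  induction j generalizing v with
  | zero => simp [chain]
  | succ j ih =>
    rw [chain]
    split_ifs with hv
    · refine List.nodup_cons.2 ⟨fun h => ?_, ih _⟩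
      have h₁ := hr _ _ (hS.nxt_mem hv.1)
      have h₂ := hle _ _ _ h
      omega
    · simp

/-- A common node is traced back through the unique in-neighbours of inner nodes. Both chains
retrace the same nodes, and neither can reach its start before the other, because `u` and `u'` are
not inner. -/
theorem chain_disjoint {j : ℕ} {u u' x : Fin n} (hu : ¬ IsInner E s t u)
    (hu' : ¬ IsInner E s t u') (hx : x ∈ chain E s t j (nxt E u))
    (hx' : x ∈ chain E s t j (nxt E u')) : u = u' := by
  obtain ⟨r, -, hr⟩ := hS.exists_rank
  induction h : r x using Nat.strong_induction_on generalizing x with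
  | _ k ih =>
    obtain ⟨hi, h₁⟩ := hS.mem_chain hx
    obtain ⟨-, h₂⟩ := hS.mem_chain hx'
    -- The inner node `x` has only one in-neighbour, so its predecessors in the two chains coincide;
    -- the rank drops.
    have key : ∀ {a b : Fin n}, x = nxt E a → x = nxt E b → a = b ∧ r a < r x := by
      rintro a b rfl hb
      have ha := hS.ne_of_inner_nxt hi
      have hb' := hS.ne_of_inner_nxt (v := b) (hb ▸ hi)
      have h₃ := hS.nxt_mem ha.2
      refine ⟨hi.unique h₃ ?_, hr _ _ h₃⟩
      rw [hb]
      exact hS.nxt_mem hb'.2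
    rcases h₁ with h₁ | ⟨y, hy, h₁⟩ <;> rcases h₂ with h₂ | ⟨y', hy', h₂⟩
    · exact (key h₁ h₂).1
    · exact absurd (hS.mem_chain hy').1 ((key h₁ h₂).1 ▸ hu)
    · exact absurd (hS.mem_chain hy).1 ((key h₁ h₂).1 ▸ hu')
    · obtain ⟨rfl, hlt⟩ := key h₁ h₂
      exact ih _ (h ▸ hlt) hy hy' rfl

/-- Walk back from `x` through in-neighbours in the tree until a branch node is met; by induction on
the rank, that node starts a chain which contains `x`. -/
theorem exists_chain {x : Fin n} (hx : IsInner E s t x) :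
    ∃ u, ¬ IsInner E s t u ∧ x ∈ chain E s t n (nxt E u) := by
  obtain ⟨r, hrn, hr⟩ := hS.exists_rank
  induction h : r x using Nat.strong_induction_on generalizing x with
  | _ k ih =>
    obtain ⟨u, hus, hu⟩ := hx.exists_in
    obtain rfl := hS.eq_nxt hus hu
    by_cases hui : IsInner E s t u
    · obtain ⟨w, hw, hw'⟩ := ih (r u) (h ▸ hr _ _ hu) hui rfl
      exact ⟨w, hw, hS.nxt_mem_chain hr hrn (by omega) hw' hx⟩
    · refine ⟨u, hui, ?_⟩
      obtain ⟨m, rfl⟩ : ∃ m, n = m + 1 := ⟨n - 1, by have := u.isLt; omega⟩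
      simp [chain, hx]

omit hS in
theorem inner_of_chain_ne_nil {j : ℕ} {v : Fin n} (h : chain E s t j v ≠ []) :
    IsInner E s t v := by
  cases j with
  | zero => simp [chain] at h
  | succ j =>
    by_contra hv
    simp [chain, hv] at h

end InTreeWithSource

end Star

/-! ### The caduceus of an order of the branch nodes -/

section Caduceus

variable {n : ℕ}

/-- The node of the caduceus at which the operation of `v` ends. -/
def outV (v : Fin n) : Fin (2 * n + 1) := ⟨v, by omega⟩

/-- The node of the caduceus at which the operation of `v` starts. -/
def inV (v : Fin n) : Fin (2 * n + 1) := ⟨n + v, by omega⟩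

/-- The additional last node of the staff. -/
def pad : Fin (2 * n + 1) := ⟨2 * n, by omega⟩

@[simp] theorem outV_inj {u v : Fin n} : outV u = outV v ↔ u = v := by
  simp [outV, Fin.ext_iff]

@[simp] theorem inV_inj {u v : Fin n} : inV u = inV v ↔ u = v := by
  simp [inV, Fin.ext_iff]

@[simp] theorem outV_ne_inV {u v : Fin n} : outV u ≠ inV v := by
  simp [outV, inV, Fin.ext_iff]; omega

@[simp] theorem inV_ne_outV {u v : Fin n} : inV u ≠ outV v := outV_ne_inV.symm

@[simp] theorem outV_ne_pad {u : Fin n} : outV u ≠ pad := by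
  simp [outV, pad, Fin.ext_iff]; omega

@[simp] theorem inV_ne_pad {u : Fin n} : inV u ≠ pad := by
  simp [inV, pad, Fin.ext_iff]; omega

@[simp] theorem pad_ne_outV {u : Fin n} : pad ≠ outV u := outV_ne_pad.symm

@[simp] theorem pad_ne_inV {u : Fin n} : pad ≠ inV u := inV_ne_pad.symm

theorem caduceus_cases (x : Fin (2 * n + 1)) : (∃ v, x = outV v) ∨ (∃ v, x = inV v) ∨ x = pad := by
  obtain ⟨x, hx⟩ := x
  rcases Nat.lt_or_ge x n with h | h
  · exact Or.inl ⟨⟨x, h⟩, rfl⟩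
  rcases Nat.lt_or_ge x (2 * n) with h' | h'
  · exact Or.inr (Or.inl ⟨⟨x - n, by omega⟩, by simp [inV]; omega⟩)
  · exact Or.inr (Or.inr (by simp [pad]; omega))

theorem sum_caduceus (g : Fin (2 * n + 1) → ℝ) :
    ∑ x, g x = ∑ v, g (outV v) + ∑ v, g (inV v) + g pad := by
  rw [Fin.sum_univ_castSucc]
  congr 1
  have h : n + n = 2 * n := (two_mul n).symm
  rw [← (finCongr h).sum_comp, Fin.sum_univ_add]
  rfl

/-- The two nodes of the caduceus for the operation of a node. -/
def dbl (v : Fin n) : List (Fin (2 * n + 1)) := [inV v, outV v]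

/-- Every node is replaced by the two nodes for its operation, and the last node is appended. -/
def doubled (l : List (Fin n)) : List (Fin (2 * n + 1)) := l.flatMap dbl ++ [pad]

theorem flatMap_dbl_nodup {l : List (Fin n)} (h : l.Nodup) : (l.flatMap dbl).Nodup := by
  rw [List.nodup_flatMap]
  refine ⟨fun v _ => by simp [dbl], h.imp fun {a b} hab => ?_⟩
  simp [Function.onFun, dbl, hab.symm]

theorem pad_not_mem_flatMap_dbl (l : List (Fin n)) : pad ∉ l.flatMap dbl := by
  simp [dbl]

theorem doubled_nodup {l : List (Fin n)} (h : l.Nodup) : (doubled l).Nodup := by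
  rw [doubled, List.nodup_append]
  refine ⟨flatMap_dbl_nodup h, by simp, ?_⟩
  rintro a ha b hb rfl
  rw [List.mem_singleton] at hb
  exact pad_not_mem_flatMap_dbl l (hb ▸ ha)

theorem length_doubled (l : List (Fin n)) : (doubled l).length = 2 * l.length + 1 := by
  induction l with
  | nil => simp [doubled]
  | cons a l ih => simp [doubled, dbl] at ih ⊢; omega

theorem mem_doubled {l : List (Fin n)} (h : ∀ v, v ∈ l) (x : Fin (2 * n + 1)) : x ∈ doubled l := by
  rcases caduceus_cases x with ⟨v, rfl⟩ | ⟨v, rfl⟩ | rfl <;> simp [doubled, dbl, h]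

theorem doubled_getElem? {l : List (Fin n)} {i : ℕ} {v : Fin n} (h : l[i]? = some v) :
    (doubled l)[2 * i]? = some (inV v) ∧ (doubled l)[2 * i + 1]? = some (outV v) := by
  induction l generalizing i with
  | nil => simp at h
  | cons a l ih =>
    cases i with
    | zero => simp at h; subst h; simp [doubled, dbl]
    | succ i =>
      have := ih (i := i) (by simpa using h)
      have e : ∀ k, (doubled (a :: l))[k + 2]? = (doubled l)[k]? := by
        intro k; simp [doubled, dbl]
      rw [show 2 * (i + 1) = 2 * i + 2 by ring, show 2 * i + 2 + 1 = (2 * i + 1) + 2 by ring, e, e]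
      exact this

theorem idxOf_doubled {l : List (Fin n)} (h : l.Nodup) {v : Fin n} (hv : v ∈ l) :
    (doubled l).idxOf (inV v) = 2 * l.idxOf v ∧ (doubled l).idxOf (outV v) = 2 * l.idxOf v + 1 := by
  have := doubled_getElem? (List.getElem?_idxOf hv)
  exact ⟨idxOf_eq_of_getElem? (doubled_nodup h) this.1, idxOf_eq_of_getElem? (doubled_nodup h) this.2⟩

theorem idxOf_doubled_pad (l : List (Fin n)) : (doubled l).idxOf pad = 2 * l.length := by
  rw [doubled, List.idxOf_append_of_notMem (pad_not_mem_flatMap_dbl l)]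
  have := length_doubled l
  simp [doubled] at this ⊢
  omega

/-- The edges from the operations in `l` to the following ones. -/
def staffEdges (l : List (Fin n)) : List (Fin (2 * n + 1) × Fin (2 * n + 1)) :=
  (l.map outV).zip ((l.map inV).tail ++ [pad])

/-- The edges between the two nodes of an operation. -/
def nodeEdges (n : ℕ) : List (Fin (2 * n + 1) × Fin (2 * n + 1)) :=
  (List.finRange n).map fun v => (inV v, outV v)

/-- The edges at inner nodes. -/
def bendEdges (s t : Fin n) (L : List (Fin n × Fin n)) :
    List (Fin (2 * n + 1) × Fin (2 * n + 1)) :=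
  (L.filter fun e => IsInner L.toFinset s t e.1 ∨ IsInner L.toFinset s t e.2).map
    fun e => (outV e.1, inV e.2)

/-- The edges of the caduceus for an order of the branch nodes. -/
def caduceusEdges (s t : Fin n) (L : List (Fin n × Fin n)) (ord : List (Fin n)) :
    List (Fin (2 * n + 1) × Fin (2 * n + 1)) :=
  bendEdges s t L ++ nodeEdges n ++ staffEdges ord

theorem mem_pathEdges_doubled {l : List (Fin n)} {e : Fin (2 * n + 1) × Fin (2 * n + 1)} :
    e ∈ pathEdges (doubled l) ↔ (∃ v ∈ l, e = (inV v, outV v)) ∨ e ∈ staffEdges l := by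
  induction l with
  | nil => simp [doubled, pathEdges, staffEdges]
  | cons a l ih =>
    cases l with
    | nil => simp [doubled, pathEdges, staffEdges, dbl]
    | cons b l =>
      have h₁ : pathEdges (doubled (a :: b :: l)) =
          (inV a, outV a) :: (outV a, inV b) :: pathEdges (doubled (b :: l)) := by
        simp [doubled, pathEdges, dbl]
      have h₂ : staffEdges (a :: b :: l) = (outV a, inV b) :: staffEdges (b :: l) := by
        simp [staffEdges]
      rw [h₁, h₂, List.mem_cons, List.mem_cons, ih]
      simp only [List.mem_cons, exists_eq_or_imp]
      exact Iff.of_eq (by ac_rfl)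

theorem mem_staffEdges {l : List (Fin n)} {e : Fin (2 * n + 1) × Fin (2 * n + 1)}
    (h : e ∈ staffEdges l) :
    (∃ i u v, l[i]? = some u ∧ l[i + 1]? = some v ∧ e = (outV u, inV v)) ∨
      ∃ u ∈ l, e = (outV u, pad) := by
  induction l with
  | nil => simp [staffEdges] at h
  | cons a l ih =>
    cases l with
    | nil => simp [staffEdges] at h; right; exact ⟨a, by simp, h⟩
    | cons b l =>
      have h₂ : staffEdges (a :: b :: l) = (outV a, inV b) :: staffEdges (b :: l) := by
        simp [staffEdges]
      rw [h₂, List.mem_cons] at h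
      rcases h with rfl | h
      · exact Or.inl ⟨0, a, b, by simp⟩
      · rcases ih h with ⟨i, u, v, h₁, h₃, h₄⟩ | ⟨u, hu, h'⟩
        · exact Or.inl ⟨i + 1, u, v, by simpa using h₁, by simpa using h₃, h₄⟩
        · exact Or.inr ⟨u, List.mem_cons_of_mem _ hu, h'⟩

theorem staffEdges_mem {l : List (Fin n)} {i : ℕ} {u v : Fin n}
    (hu : l[i]? = some u) (hv : l[i + 1]? = some v) : (outV u, inV v) ∈ staffEdges l := by
  refine List.mem_iff_getElem?.2 ⟨i, ?_⟩
  obtain ⟨h₁, rfl⟩ := List.getElem?_eq_some_iff.1 hu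
  obtain ⟨h₂, rfl⟩ := List.getElem?_eq_some_iff.1 hv
  rw [staffEdges, List.getElem?_zip_eq_some]
  refine ⟨by simp [h₁], ?_⟩
  rw [List.getElem?_append_left (by simp; omega)]
  simp [h₂]

/-- Induction on the fuel: an inner successor contributes its two nodes to the path and the bend
goes on from there; otherwise `chain` and `climbStep` both stop and a single edge remains. -/
theorem mem_pathEdges_bend {E : Finset (Fin n × Fin n)} {s t : Fin n} (j : ℕ) (u : Fin n)
    {e : Fin (2 * n + 1) × Fin (2 * n + 1)} :
    e ∈ pathEdges (outV u :: ((chain E s t j (nxt E u)).flatMap dbl ++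
        [inV ((climbStep E s t)^[j] (nxt E u))])) ↔
      (∃ a, (a = u ∨ a ∈ chain E s t j (nxt E u)) ∧ e = (outV a, inV (nxt E a))) ∨
        ∃ a ∈ chain E s t j (nxt E u), e = (inV a, outV a) := by
  induction j generalizing u with
  | zero => simp [chain, pathEdges]
  | succ j ih =>
    by_cases hu : IsInner E s t (nxt E u)
    · have hc : chain E s t (j + 1) (nxt E u) = nxt E u :: chain E s t j (nxt E (nxt E u)) := by
        rw [chain, if_pos hu]
      rw [Function.iterate_succ_apply]
      have hs : climbStep E s t (nxt E u) = nxt E (nxt E u) := by rw [climbStep, if_pos hu]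
      rw [hs, hc]
      have : ∀ (l : List (Fin n)) (z : List (Fin (2 * n + 1))),
          pathEdges (outV u :: ((nxt E u :: l).flatMap dbl ++ z)) =
            (outV u, inV (nxt E u)) :: (inV (nxt E u), outV (nxt E u)) ::
              pathEdges (outV (nxt E u) :: (l.flatMap dbl ++ z)) := by
        intro l z; simp [pathEdges, dbl]
      rw [this, List.mem_cons, List.mem_cons, ih (nxt E u)]
      simp only [List.mem_cons, or_and_right, exists_or, exists_eq_left]
      exact Iff.of_eq (by ac_rfl)
    · have hc : chain E s t (j + 1) (nxt E u) = [] := by rw [chain, if_neg hu]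
      have hs : (climbStep E s t)^[j + 1] (nxt E u) = nxt E u :=
        Function.iterate_fixed (by simp [climbStep, hu]) _
      rw [hc, hs]
      simp [pathEdges]

/-- An order of the branch nodes that some schedule respects. -/
structure ValidOrder (E : Finset (Fin n × Fin n)) (s t : Fin n) (ord : List (Fin n)) : Prop where
  nodup : ord.Nodup
  mem_iff : ∀ v, v ∈ ord ↔ ¬ IsInner E s t v
  lt : ∀ u v, (u, v) ∈ E → ¬ IsInner E s t u → ord.idxOf u < ord.idxOf (climb E s t v)

/-- The staff is the doubled order with `pad`; there is one bend for each branch node whose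
successor is inner. The chains partition the inner nodes, and `ValidOrder.lt`, stated with `climb`,
makes every bend go forward on the staff. -/
theorem isCaduceus_caduceusEdges {L : List (Fin n × Fin n)} {s t : Fin n}
    (hS : InTreeWithSource L.toFinset s t) {ord : List (Fin n)} (ho : ValidOrder L.toFinset s t ord) :
    IsCaduceus (caduceusEdges s t L ord).toFinset := by
  set E := L.toFinset with hE
  let starts := (List.finRange n).filter fun u => ¬ IsInner E s t u ∧ IsInner E s t (nxt E u)
  have hstarts : ∀ u, u ∈ starts ↔ ¬ IsInner E s t u ∧ IsInner E s t (nxt E u) := by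
    intro u; simp [starts]
  let bend : Fin n → Bend (Fin (2 * n + 1)) := fun u =>
    ⟨outV u, (chain E s t n (nxt E u)).flatMap dbl, inV (climb E s t (nxt E u))⟩
  have hex : ∀ x, IsInner E s t x → ∃ u ∈ starts, x ∈ chain E s t n (nxt E u) := by
    intro x hx
    obtain ⟨u, hu, hxu⟩ := hS.exists_chain hx
    exact ⟨u, (hstarts u).2 ⟨hu, InTreeWithSource.inner_of_chain_ne_nil (List.ne_nil_of_mem hxu)⟩, hxu⟩
  have hflat : (starts.map bend).flatMap Bend.inner =
      (starts.flatMap fun u => chain E s t n (nxt E u)).flatMap dbl := by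
    simp [List.flatMap_map, List.flatMap_assoc, bend]
  set Z := starts.flatMap fun u => chain E s t n (nxt E u) with hZ
  have hZi : ∀ x ∈ Z, IsInner E s t x := by
    intro x hx
    obtain ⟨u, -, hu⟩ := List.mem_flatMap.1 hx
    exact (hS.mem_chain hu).1
  -- Up to the place of `pad`, staff and bends together are the doubled list of all nodes.
  have hperm : (doubled ord ++ Z.flatMap dbl).Perm (doubled (ord ++ Z)) := by
    rw [doubled, doubled, List.append_assoc, List.flatMap_append, List.append_assoc]
    exact List.Perm.append_left _ List.perm_append_comm
  have hnd : (ord ++ Z).Nodup := by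
    rw [List.nodup_append]
    refine ⟨ho.nodup, ?_, ?_⟩
    · rw [hZ, List.nodup_flatMap]
      refine ⟨fun u _ => hS.chain_nodup _ _, ?_⟩
      have : starts.Nodup := (List.nodup_finRange n).filter _
      refine (this.and ((List.pairwise_iff_forall_sublist (R := fun a b => a ∈ starts ∧ b ∈ starts)).2
        fun {a b} h => ⟨h.subset (by simp), h.subset (by simp)⟩)).imp ?_
      rintro a b ⟨hab, ha, hb⟩ x hxa hxb
      exact hab (hS.chain_disjoint ((hstarts a).1 ha).1 ((hstarts b).1 hb).1 hxa hxb)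
    · rintro a ha b hb rfl
      exact (ho.mem_iff a).1 ha (hZi a hb)
  refine ⟨doubled ord, starts.map bend, by simp [doubled], ?_, ?_, ?_, ?_⟩
  · rw [hflat, hperm.nodup_iff]
    exact doubled_nodup hnd
  · intro x
    rw [hflat, hperm.mem_iff]
    refine mem_doubled (fun v => ?_) x
    by_cases hv : IsInner E s t v
    · obtain ⟨u, hu, hvu⟩ := hex v hv
      exact List.mem_append_right _ (List.mem_flatMap.2 ⟨u, hu, hvu⟩)
    · exact List.mem_append_left _ ((ho.mem_iff v).2 hv)
  · intro b hb
    obtain ⟨u, hu, rfl⟩ := List.mem_map.1 hb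
    obtain ⟨hu₁, hu₂⟩ := (hstarts u).1 hu
    constructor
    · obtain ⟨m, hm⟩ : ∃ m, n = m + 1 := ⟨n - 1, by have := u.isLt; omega⟩
      have : nxt E u ∈ chain E s t n (nxt E u) := by
        have : ∀ k, k = m + 1 → nxt E u ∈ chain E s t k (nxt E u) := by
          rintro k rfl; simp [chain, hu₂]
        exact this n hm
      exact List.ne_nil_of_mem (List.mem_flatMap.2 ⟨_, this, by simp [dbl]⟩ : inV (nxt E u) ∈ _)
    · refine ⟨2 * ord.idxOf u + 1, 2 * ord.idxOf (climb E s t (nxt E u)), ?_, ?_, ?_⟩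
      · have := ho.lt u _ (hS.nxt_mem (hS.ne_of_inner_nxt hu₂).2) hu₁
        omega
      · exact (doubled_getElem? (List.getElem?_idxOf ((ho.mem_iff u).2 hu₁))).2
      · exact (doubled_getElem? (List.getElem?_idxOf
          ((ho.mem_iff _).2 (hS.not_inner_climb _)))).1
  · intro a b
    have hbend : ∀ u, (a, b) ∈ pathEdges (bend u).path ↔ _ :=
      fun u => mem_pathEdges_bend (E := E) (s := s) (t := t) n u
    have hmemE : ∀ e : Fin n × Fin n, e ∈ L ↔ e ∈ E := fun e => by simp [hE]
    simp only [List.mem_map, exists_exists_and_eq_and, hbend, mem_pathEdges_doubled,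
      List.mem_toFinset, caduceusEdges, bendEdges, nodeEdges, List.mem_append, List.mem_filter,
      decide_eq_true_eq, List.mem_finRange, true_and, ← hE, hmemE]
    constructor
    · rintro ((⟨⟨u, v⟩, ⟨huv, hi⟩, he⟩ | ⟨v, he⟩) | h)
      · right
        simp only at hi he
        -- No edge at the source is a bend edge, as neither the source nor its out-neighbours are
        -- inner. So the edge is a tree edge and leads to `nxt E u`.
        have hus : u ≠ s := by
          rintro rfl
          rcases hi with hi | hi
          · exact hS.not_inner_source hi
          · exact hi.2.1 huv
        obtain rfl := hS.eq_nxt hus huv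
        by_cases hu : IsInner E s t u
        · obtain ⟨w, hw, hw'⟩ := hex u hu
          exact ⟨w, hw, Or.inl ⟨u, Or.inr hw', he.symm⟩⟩
        · exact ⟨u, (hstarts u).2 ⟨hu, hi.resolve_left hu⟩, Or.inl ⟨u, Or.inl rfl, he.symm⟩⟩
      · by_cases hv : IsInner E s t v
        · obtain ⟨w, hw, hw'⟩ := hex v hv
          exact Or.inr ⟨w, hw, Or.inr ⟨v, hw', he.symm⟩⟩
        · exact Or.inl (Or.inl ⟨v, (ho.mem_iff v).2 hv, he.symm⟩)
      · exact Or.inl (Or.inr h)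
    · rintro ((⟨v, -, he⟩ | h) | ⟨u, hu, ⟨v, hv, he⟩ | ⟨v, hv, he⟩⟩)
      · exact Or.inl (Or.inr ⟨v, he.symm⟩)
      · exact Or.inr h
      · refine Or.inl (Or.inl ⟨(v, nxt E v), ⟨?_, ?_⟩, he.symm⟩)
        · rcases hv with rfl | hv
          · exact hS.nxt_mem (hS.ne_of_inner_nxt ((hstarts _).1 hu).2).2
          · exact hS.nxt_mem (hS.mem_chain hv).1.1
        · rcases hv with rfl | hv
          · exact Or.inr ((hstarts _).1 hu).2
          · exact Or.inl (hS.mem_chain hv).1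
      · exact Or.inl (Or.inr ⟨v, he.symm⟩)

end Caduceus

/-! ### Schedules of the starborescence and of the caduceus -/

section Contract

variable {n : ℕ}

theorem nodup_staffEdges {l : List (Fin n)} (h : l.Nodup) : (staffEdges l).Nodup := by
  refine List.Nodup.of_map Prod.fst ?_
  rw [staffEdges, List.map_fst_zip (by simp; omega)]
  exact h.map fun a b hab => by simpa using hab

/-- The caduceus program expects an edge list without repetitions. Node edges run from `inV` to
`outV` and the others start at `outV`; a bend edge has an inner end, whereas a staff edge joins
branch nodes or ends in `pad`. -/
theorem nodup_caduceusEdges {L : List (Fin n × Fin n)} (hL : L.Nodup) {s t : Fin n}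
    {ord : List (Fin n)} (ho : ValidOrder L.toFinset s t ord) :
    (caduceusEdges s t L ord).Nodup := by
  rw [caduceusEdges, List.nodup_append, List.nodup_append]
  refine ⟨⟨?_, ?_, ?_⟩, nodup_staffEdges ho.nodup, ?_⟩
  · refine (hL.filter _).map ?_
    rintro ⟨a, b⟩ ⟨c, d⟩ h
    simpa using h
  · exact (List.nodup_finRange n).map fun a b h => by simpa using h
  · rintro a ha b hb rfl
    obtain ⟨e, -, rfl⟩ := List.mem_map.1 ha
    obtain ⟨v, -, hv⟩ := List.mem_map.1 hb
    simp at hv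
  · rintro a ha b hb rfl
    rcases List.mem_append.1 ha with ha | ha
    · obtain ⟨e, he, rfl⟩ := List.mem_map.1 ha
      rw [List.mem_filter, decide_eq_true_eq] at he
      rcases mem_staffEdges hb with ⟨i, u, v, hu, hv, h⟩ | ⟨u, hu, h⟩
      · simp only [Prod.mk.injEq, outV_inj, inV_inj] at h
        rcases he.2 with h' | h'
        · exact (ho.mem_iff u).1 (List.mem_of_getElem? hu) (h.1 ▸ h')
        · exact (ho.mem_iff v).1 (List.mem_of_getElem? hv) (h.2 ▸ h')
      · simp at h
    · obtain ⟨v, -, rfl⟩ := List.mem_map.1 ha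
      rcases mem_staffEdges hb with ⟨i, u, w, hu, hv, h⟩ | ⟨u, hu, h⟩ <;> simp at h

/-- The order in which the operations end. -/
def contract (τ : List (Fin (2 * n + 1))) : List (Fin n) :=
  τ.filterMap fun x : Fin (2 * n + 1) => if h : x.val < n then some ⟨x.val, h⟩ else none

theorem contract_fun_eq {x : Fin (2 * n + 1)} {v : Fin n} :
    (if h : x.val < n then some (⟨x.val, h⟩ : Fin n) else none) = some v ↔ x = outV v := by
  split_ifs with h
  · simp [Fin.ext_iff, outV]
  · simp only [false_iff]
    rintro rfl
    exact h v.isLt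

theorem map_val_contract (τ : List (Fin (2 * n + 1))) :
    (contract τ).map Fin.val = (τ.map Fin.val).filter (· < n) := by
  induction τ with
  | nil => rfl
  | cons a τ ih =>
    rw [contract] at ih ⊢
    by_cases h : a.val < n <;> simp [h, ih]

theorem mem_contract {τ : List (Fin (2 * n + 1))} {v : Fin n} :
    v ∈ contract τ ↔ outV v ∈ τ := by
  simp only [contract, List.mem_filterMap, contract_fun_eq, exists_eq_right]

theorem pairwise_contract {τ : List (Fin (2 * n + 1))} (h : τ.Nodup) :
    (contract τ).Pairwise fun u v => τ.idxOf (outV u) < τ.idxOf (outV v) := by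
  rw [contract, List.pairwise_filterMap]
  refine (pairwise_idxOf_lt h).imp ?_
  intro a b hab u hu v hv
  rw [contract_fun_eq] at hu hv
  rwa [← hu, ← hv]

/-! ### Translating schedules between the two graphs -/

section Edges

variable {L : List (Fin n × Fin n)} {s t : Fin n} {ord : List (Fin n)}
  {τ : List (Fin (2 * n + 1))}

theorem node_mem_caduceusEdges (v : Fin n) :
    (inV v, outV v) ∈ (caduceusEdges s t L ord).toFinset := by
  simp [caduceusEdges, nodeEdges]

theorem IsSchedule.inV_lt_outV (hτ : IsSchedule (caduceusEdges s t L ord).toFinset τ)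
    (v : Fin n) : τ.idxOf (inV v) < τ.idxOf (outV v) :=
  hτ.idxOf_lt (node_mem_caduceusEdges v) (by simp)

theorem IsSchedule.staff_lt (hτ : IsSchedule (caduceusEdges s t L ord).toFinset τ)
    {u v : Fin n} (hu : u ∈ ord) (hv : v ∈ ord) (h : ord.idxOf u < ord.idxOf v) :
    τ.idxOf (outV u) < τ.idxOf (inV v) := by
  have hstep : ∀ i u v, ord[i]? = some u → ord[i + 1]? = some v →
      τ.idxOf (outV u) < τ.idxOf (inV v) := fun i u v hu hv =>
    hτ.idxOf_lt (by simp [caduceusEdges, staffEdges_mem hu hv]) (by simp)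
  have key : ∀ d i u v, ord[i]? = some u → ord[i + 1 + d]? = some v →
      τ.idxOf (outV u) < τ.idxOf (inV v) := by
    intro d
    induction d with
    | zero => exact hstep
    | succ d ih =>
      intro i u v hu hv
      obtain ⟨hlt, -⟩ := List.getElem?_eq_some_iff.1 hv
      have hw : ord[i + 1 + d]? = some ord[i + 1 + d] := List.getElem?_eq_getElem (by omega)
      have h₁ := ih i u _ hu hw
      have h₂ := hstep (i + 1 + d) _ v hw hv
      have h₃ := hτ.inV_lt_outV ord[i + 1 + d]
      omega
  refine key (ord.idxOf v - (ord.idxOf u + 1)) (ord.idxOf u) u v (List.getElem?_idxOf hu) ?_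
  rw [Nat.add_sub_cancel' h]
  exact List.getElem?_idxOf hv

/-- An edge with an inner end is present in the caduceus. An edge between two branch nodes need not
be, but a valid order respects it and the staff enforces the order. -/
theorem IsSchedule.edge_lt (hS : InTreeWithSource L.toFinset s t)
    (ho : ValidOrder L.toFinset s t ord)
    (hτ : IsSchedule (caduceusEdges s t L ord).toFinset τ) {u v : Fin n}
    (h : (u, v) ∈ L.toFinset) : τ.idxOf (outV u) < τ.idxOf (inV v) := by
  by_cases hi : IsInner L.toFinset s t u ∨ IsInner L.toFinset s t v
  · refine hτ.idxOf_lt ?_ (by simp)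
    simp only [caduceusEdges, bendEdges, List.mem_toFinset, List.mem_append, List.mem_map,
      List.mem_filter, decide_eq_true_eq]
    exact Or.inl (Or.inl ⟨(u, v), ⟨by simpa using h, hi⟩, rfl⟩)
  · push Not at hi
    have := ho.lt u v h hi.1
    rw [hS.climb_of_not_inner hi.2] at this
    exact hτ.staff_lt ((ho.mem_iff u).2 hi.1) ((ho.mem_iff v).2 hi.2) this

theorem IsSchedule.idxOf_contract_lt_iff
    (hτ : IsSchedule (caduceusEdges s t L ord).toFinset τ) {u v : Fin n} :
    (contract τ).idxOf u < (contract τ).idxOf v ↔ τ.idxOf (outV u) < τ.idxOf (outV v) :=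
  idxOf_lt_idxOf_iff (f := fun u => τ.idxOf (outV u)) (pairwise_contract hτ.1)
    (mem_contract.2 (hτ.2.1 _)) (mem_contract.2 (hτ.2.1 _))

/-- A schedule of the caduceus yields a schedule of the starborescence. -/
theorem IsSchedule.contract (hS : InTreeWithSource L.toFinset s t)
    (ho : ValidOrder L.toFinset s t ord)
    (hτ : IsSchedule (caduceusEdges s t L ord).toFinset τ) :
    IsSchedule L.toFinset (contract τ) := by
  refine isSchedule_of_idxOf_lt ?_ (fun v => mem_contract.2 (hτ.2.1 _)) fun u v h => ?_
  · refine (pairwise_contract hτ.1).imp ?_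
    rintro u v h rfl
    exact lt_irrefl _ h
  · rw [hτ.idxOf_contract_lt_iff]
    exact (hτ.edge_lt hS ho h).trans (hτ.inV_lt_outV v)

theorem pairwise_filter_idxOf {σ : List (Fin n)} (hσ : σ.Nodup) (p : Fin n → Prop)
    [DecidablePred p] : (σ.filter fun v => p v).Pairwise fun u v => σ.idxOf u < σ.idxOf v :=
  (pairwise_idxOf_lt hσ).filter _

/-- The order of the branch nodes in a schedule. -/
def branchOrder (E : Finset (Fin n × Fin n)) (s t : Fin n) (σ : List (Fin n)) : List (Fin n) :=
  σ.filter fun v => ¬ IsInner E s t v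

theorem IsSchedule.mem_branchOrder {E : Finset (Fin n × Fin n)} {σ : List (Fin n)}
    (hσ : IsSchedule E σ) {v : Fin n} : v ∈ branchOrder E s t σ ↔ ¬ IsInner E s t v := by
  simp [branchOrder, hσ.2.1 v]

theorem IsSchedule.idxOf_branchOrder_lt_iff {E : Finset (Fin n × Fin n)} {σ : List (Fin n)}
    (hσ : IsSchedule E σ) {u v : Fin n} (hu : ¬ IsInner E s t u) (hv : ¬ IsInner E s t v) :
    (branchOrder E s t σ).idxOf u < (branchOrder E s t σ).idxOf v ↔ σ.idxOf u < σ.idxOf v :=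
  idxOf_lt_idxOf_iff (f := fun u => σ.idxOf u) (pairwise_filter_idxOf hσ.1 _)
    (hσ.mem_branchOrder.2 hu) (hσ.mem_branchOrder.2 hv)

/-- Climbing from `v` only leads to later positions of `σ`. -/
theorem IsSchedule.validOrder {E : Finset (Fin n × Fin n)} (hS : InTreeWithSource E s t)
    {σ : List (Fin n)} (hσ : IsSchedule E σ) : ValidOrder E s t (branchOrder E s t σ) := by
  refine ⟨hσ.1.filter _, fun v => hσ.mem_branchOrder, fun u v huv hu => ?_⟩
  rw [hσ.idxOf_branchOrder_lt_iff hu (hS.not_inner_climb v)]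
  refine (hσ.idxOf_lt huv (hS.acyclic.ne huv)).trans_le ?_
  exact hS.le_climb (r := σ.idxOf) (fun a b h => hσ.idxOf_lt h (hS.acyclic.ne h)) v

/-- A schedule of the starborescence yields a schedule of the caduceus for its order of the branch
nodes. -/
theorem IsSchedule.doubled (hS : InTreeWithSource L.toFinset s t) {σ : List (Fin n)}
    (hσ : IsSchedule L.toFinset σ) :
    IsSchedule (caduceusEdges s t L (branchOrder L.toFinset s t σ)).toFinset (doubled σ) := by
  refine isSchedule_of_idxOf_lt (doubled_nodup hσ.1) (mem_doubled hσ.2.1) fun a b h => ?_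
  have hd := fun v => idxOf_doubled hσ.1 (hσ.2.1 v)
  have hlt : ∀ {u v : Fin n}, σ.idxOf u < σ.idxOf v →
      (_root_.doubled σ).idxOf (outV u) < (_root_.doubled σ).idxOf (inV v) := by
    intro u v h
    rw [(hd u).2, (hd v).1]
    omega
  simp only [caduceusEdges, List.mem_toFinset, List.mem_append] at h
  rcases h with (h | h) | h
  · obtain ⟨⟨u, v⟩, he, h⟩ := List.mem_map.1 h
    obtain ⟨rfl, rfl⟩ := Prod.mk.inj h
    have he' : (u, v) ∈ L.toFinset := by simpa using (List.mem_filter.1 he).1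
    exact hlt (hσ.idxOf_lt he' (hS.acyclic.ne he'))
  · obtain ⟨v, -, h⟩ := List.mem_map.1 h
    obtain ⟨rfl, rfl⟩ := Prod.mk.inj h
    rw [(hd v).1, (hd v).2]
    omega
  · rcases mem_staffEdges h with ⟨i, u, v, hu, hv, h⟩ | ⟨u, -, h⟩
    · obtain ⟨rfl, rfl⟩ := Prod.mk.inj h
      refine hlt ?_
      rw [← hσ.idxOf_branchOrder_lt_iff (hσ.mem_branchOrder.1 (List.mem_of_getElem? hu))
        (hσ.mem_branchOrder.1 (List.mem_of_getElem? hv))]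
      have hn : (branchOrder L.toFinset s t σ).Nodup := hσ.1.filter _
      rw [idxOf_eq_of_getElem? hn hu, idxOf_eq_of_getElem? hn hv]
      omega
    · obtain ⟨rfl, rfl⟩ := Prod.mk.inj h
      rw [(hd u).2, idxOf_doubled_pad]
      have := List.idxOf_lt_length_iff.2 (hσ.2.1 u)
      omega

end Edges

/-! ### Weights of the caduceus -/

/-- The node whose operation ends the use of the output of `u`, if `x` is the last out-neighbour
of the source `s`. -/
noncomputable def releaser (E : Finset (Fin n × Fin n)) (s x u : Fin n) : Fin n :=
  if u = s then x else nxt E u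

/-- The node weights of the caduceus: each operation first allocates its output and its scratch
memory, then releases the scratch memory and the outputs that are not used any more. -/
structure IsWeight (G : ComputationGraph (Fin n)) (s x : Fin n) (w : Fin (2 * n + 1) → ℝ) :
    Prop where
  inV : ∀ v, w (inV v) = G.size v + G.scratch v
  outV : ∀ v, w (outV v) =
    -G.scratch v - ∑ u, if releaser G.edges s x u = v then G.size u else 0
  pad : w pad = 0

variable {G : ComputationGraph (Fin n)} {s t x : Fin n}

/-- Every operation adds its own output and subtracts those it releases. In the double sum, `u` is
counted from its own position up to that of its releaser, which is precisely the time during which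
its output is live. -/
theorem live_eq_sum (hS : InTreeWithSource G.edges s t) {σ : List (Fin n)}
    (hσ : IsSchedule G.edges σ) (hx : (s, x) ∈ G.edges)
    (hlast : ∀ y, (s, y) ∈ G.edges → σ.idxOf y ≤ σ.idxOf x) (i : ℕ) :
    G.live σ i = ∑ v, if σ.idxOf v < i then
      G.size v - ∑ u, (if releaser G.edges s x u = v then G.size u else 0) else 0 := by
  have hlt : ∀ {u v}, (u, v) ∈ G.edges → σ.idxOf u < σ.idxOf v := fun h =>
    hσ.idxOf_lt h (hS.acyclic.ne h)
  have hle : ∀ u, σ.idxOf u ≤ σ.idxOf (releaser G.edges s x u) := by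
    intro u
    unfold releaser
    split_ifs with h
    · subst h; exact (hlt hx).le
    · by_cases hu : u = t
      · rw [hu, hS.nxt_sink]
      · exact (hlt (hS.nxt_mem hu)).le
  have hdrop : ∀ v, v ∈ σ.drop i ↔ i ≤ σ.idxOf v := by
    intro v
    have hm := hσ.2.1 v
    rw [← List.take_append_drop i σ, List.mem_append,
      List.mem_take_iff_idxOf_lt (hσ.2.1 v)] at hm
    have hd := List.nodup_append.1 ((List.take_append_drop i σ).symm ▸ hσ.1 :
      (σ.take i ++ σ.drop i).Nodup)
    constructor
    · intro h
      by_contra! h'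
      exact hd.2.2 v ((List.mem_take_iff_idxOf_lt (hσ.2.1 v)).2 h') v h rfl
    · intro h
      exact hm.resolve_left (by omega)
  -- The releaser is the last user of the output. The sink has no user; there `nxt` defaults to the
  -- sink itself, so its output is released at once.
  have hfree : ∀ v, (outNbrs G.edges v ∩ (σ.drop i).toFinset).Nonempty ↔
      i ≤ σ.idxOf (releaser G.edges s x v) ∧ v ≠ t := by
    intro v
    constructor
    · rintro ⟨w, hw⟩
      simp only [outNbrs, Finset.mem_inter, Finset.mem_filter, Finset.mem_univ, true_and,
        List.mem_toFinset, hdrop] at hw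
      refine ⟨hw.2.trans ?_, ?_⟩
      · unfold releaser
        split_ifs with h
        · subst h; exact hlast w hw.1
        · rw [hS.eq_nxt h hw.1]
      · rintro rfl
        exact hS.no_out w hw.1
    · rintro ⟨h, hv⟩
      refine ⟨releaser G.edges s x v, ?_⟩
      simp only [outNbrs, Finset.mem_inter, Finset.mem_filter, Finset.mem_univ, true_and,
        List.mem_toFinset, hdrop]
      refine ⟨?_, h⟩
      unfold releaser
      split_ifs with h
      · subst h; exact hx
      · exact hS.nxt_mem hv
  have hrt : releaser G.edges s x t = t := by
    rw [releaser, if_neg hS.ne.symm, hS.nxt_sink]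
  -- Exchange the sums: every `u` has exactly one releaser.
  have hsum : (∑ v, if σ.idxOf v < i then
      ∑ u, (if releaser G.edges s x u = v then G.size u else 0) else 0) =
      ∑ u, if σ.idxOf (releaser G.edges s x u) < i then G.size u else 0 := by
    have : ∀ v, (if σ.idxOf v < i then
        ∑ u, (if releaser G.edges s x u = v then G.size u else 0) else 0) =
        ∑ u, if releaser G.edges s x u = v then (if σ.idxOf v < i then G.size u else 0) else 0 := by
      intro v
      split_ifs <;> simp
    rw [Finset.sum_congr rfl fun v _ => this v, Finset.sum_comm]
    refine Finset.sum_congr rfl fun u _ => ?_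
    rw [Finset.sum_ite_eq]
    simp
  have hsub : ∀ v, (if σ.idxOf v < i then
      G.size v - ∑ u, (if releaser G.edges s x u = v then G.size u else 0) else 0) =
      (if σ.idxOf v < i then G.size v else 0) - if σ.idxOf v < i then
        ∑ u, (if releaser G.edges s x u = v then G.size u else 0) else 0 := by
    intro v
    split_ifs <;> simp
  rw [Finset.sum_congr rfl fun v _ => hsub v, Finset.sum_sub_distrib, hsum,
    ← Finset.sum_sub_distrib, ComputationGraph.live, Finset.sum_filter,
    sum_take_toFinset hσ.2.1]
  refine Finset.sum_congr rfl fun v _ => ?_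
  have := hle v
  by_cases h₁ : σ.idxOf v < i
  · by_cases hv : v = t
    · subst hv
      rw [if_pos h₁, if_pos h₁, hrt, if_pos h₁, if_neg]
      · simp
      · rw [hfree]; simp
    · by_cases h₂ : σ.idxOf (releaser G.edges s x v) < i
      · rw [if_pos h₁, if_pos h₁, if_pos h₂, if_neg]
        · simp
        · rw [hfree]; omega
      · rw [if_pos h₁, if_pos h₁, if_neg h₂, if_pos]
        · simp
        · rw [hfree]; exact ⟨by omega, hv⟩
  · rw [if_neg h₁, if_neg h₁, if_neg (by omega)]
    simp

theorem sum_take_caduceus {w : Fin (2 * n + 1) → ℝ} (hw : IsWeight G s x w)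
    {τ : List (Fin (2 * n + 1))} (hm : ∀ y, y ∈ τ) (q : ℕ) :
    ∑ y ∈ (τ.take q).toFinset, w y =
      (∑ v, if τ.idxOf (outV v) < q then
        -G.scratch v - ∑ u, (if releaser G.edges s x u = v then G.size u else 0) else 0) +
      ∑ v, if τ.idxOf (inV v) < q then G.size v + G.scratch v else 0 := by
  rw [sum_take_toFinset hm, sum_caduceus, hw.pad, ite_self, add_zero]
  simp only [hw.inV, hw.outV]

theorem memDuring_eq (σ : List (Fin n)) (v : Fin n) (hv : σ.idxOf v < σ.length) :
    G.memDuring σ ⟨σ.idxOf v, hv⟩ = G.live σ (σ.idxOf v) + (G.size v + G.scratch v) := by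
  simp [ComputationGraph.memDuring, add_assoc]

/-- The peak of a schedule of the caduceus is at least that of the schedule of the
starborescence. -/
theorem profile_contract_le (hS : InTreeWithSource G.edges s t) {σ : List (Fin n)}
    {w : Fin (2 * n + 1) → ℝ} (hw : IsWeight G s x w) {τ : List (Fin (2 * n + 1))}
    (hm : ∀ y, y ∈ τ) (hσ : IsSchedule G.edges σ)
    (hiff : ∀ u v, σ.idxOf u < σ.idxOf v ↔ τ.idxOf (outV u) < τ.idxOf (outV v))
    (hin : ∀ v, τ.idxOf (inV v) < τ.idxOf (outV v))
    (hx : (s, x) ∈ G.edges)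
    (hlast : ∀ y, (s, y) ∈ G.edges → σ.idxOf y ≤ σ.idxOf x) :
    ∀ z ∈ G.profile σ, ∃ y ∈ nodeSumProfile w τ, z ≤ y := by
  have hscr : ∀ v, 0 ≤ G.size v + G.scratch v := fun v => by
    have := G.neg_size_le_scratch v
    linarith
  have hlen : ∀ v, τ.idxOf (outV v) < τ.length := fun v => List.idxOf_lt_length_iff.2 (hm _)
  intro z hz
  rw [G.mem_profile] at hz
  rcases hz with rfl | ⟨i, hi⟩
  · exact ⟨0, mem_nodeSumProfile.2 ⟨0, by simp, by simp⟩, le_rfl⟩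
  obtain ⟨v, hv⟩ : ∃ v, v = σ.get i := ⟨_, rfl⟩
  have hiv : (i : ℕ) = σ.idxOf v := by rw [hv]; exact (List.get_idxOf hσ.1 i).symm
  have hi' : i = ⟨σ.idxOf v, hiv ▸ i.isLt⟩ := Fin.ext hiv
  rcases hi with hi | hi
  -- Compare with the prefix that stops right before `outV v`: the operations that have ended are
  -- those before `v`, and `v` has started. Other operations that have already started contribute
  -- nonnegative amounts.
  · refine ⟨_, mem_nodeSumProfile.2 ⟨τ.idxOf (outV v), (hlen v).le, rfl⟩, ?_⟩
    rw [hi, hi', memDuring_eq σ, live_eq_sum hS hσ hx hlast, sum_take_caduceus hw hm]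
    have : G.size v + G.scratch v = ∑ u, if u = v then G.size v + G.scratch v else 0 := by simp
    rw [this, ← Finset.sum_add_distrib, ← Finset.sum_add_distrib]
    refine Finset.sum_le_sum fun u _ => ?_
    simp only [hiff u v]
    have h₁ := hin u
    have h₂ := hin v
    have h₃ := hscr u
    by_cases huv : u = v
    · subst huv
      simp [h₁]
    · rw [if_neg huv]
      by_cases h₄ : τ.idxOf (outV u) < τ.idxOf (outV v)
      · rw [if_pos h₄, if_pos h₄, if_pos (h₁.trans h₄)]
        linarith
      · rw [if_neg h₄, if_neg h₄]
        split_ifs <;> linarith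
  -- The same comparison with the prefix that includes `outV v`.
  · refine ⟨_, mem_nodeSumProfile.2 ⟨τ.idxOf (outV v) + 1, hlen v, rfl⟩, ?_⟩
    have hiff' : ∀ u, σ.idxOf u < σ.idxOf v + 1 ↔ τ.idxOf (outV u) < τ.idxOf (outV v) + 1 := by
      intro u
      have := hiff v u
      omega
    rw [hi, hi', ComputationGraph.memAfter, live_eq_sum hS hσ hx hlast, sum_take_caduceus hw hm,
      ← Finset.sum_add_distrib]
    refine Finset.sum_le_sum fun u _ => ?_
    simp only [hiff' u]
    have h₁ := hin u
    have h₃ := hscr u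
    by_cases h₄ : τ.idxOf (outV u) < τ.idxOf (outV v) + 1
    · rw [if_pos h₄, if_pos h₄, if_pos (h₁.trans h₄)]
      linarith
    · rw [if_neg h₄, if_neg h₄]
      split_ifs <;> linarith

/-- The profile of a schedule of the starborescence contains that of the schedule of the
caduceus. -/
theorem nodeSumProfile_doubled_mem (hS : InTreeWithSource G.edges s t) {σ : List (Fin n)}
    {w : Fin (2 * n + 1) → ℝ} (hw : IsWeight G s x w) (hσ : IsSchedule G.edges σ)
    (hx : (s, x) ∈ G.edges)
    (hlast : ∀ y, (s, y) ∈ G.edges → σ.idxOf y ≤ σ.idxOf x) :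
    ∀ y ∈ nodeSumProfile w (doubled σ), y ∈ G.profile σ := by
  intro y hy
  obtain ⟨q, hq, rfl⟩ := mem_nodeSumProfile.1 hy
  rw [length_doubled] at hq
  have hd := fun v => idxOf_doubled hσ.1 (hσ.2.1 v)
  have hlen : ∀ v, σ.idxOf v < σ.length := fun v => List.idxOf_lt_length_iff.2 (hσ.2.1 _)
  rw [sum_take_caduceus hw (mem_doubled hσ.2.1), ← Finset.sum_add_distrib]
  have hlive : ∀ i ≤ σ.length, G.live σ i ∈ G.profile σ := by
    intro i hi
    rw [G.mem_profile]
    cases i with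
    | zero => exact Or.inl (G.live_zero σ)
    | succ i => exact Or.inr ⟨⟨i, hi⟩, Or.inr rfl⟩
  -- Prefixes that split no operation give `live`. Besides those of even length, this covers the
  -- whole list of odd length, as `pad` has weight zero.
  have heven : ∀ i, (∀ v, σ.idxOf v < i ↔ 2 * σ.idxOf v + 1 < q) →
      (∀ v, σ.idxOf v < i ↔ 2 * σ.idxOf v < q) → i ≤ σ.length →
      (∑ v, ((if (doubled σ).idxOf (outV v) < q then
        -G.scratch v - ∑ u, (if releaser G.edges s x u = v then G.size u else 0) else 0) +
      if (doubled σ).idxOf (inV v) < q then G.size v + G.scratch v else 0)) ∈ G.profile σ := by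
    intro i h₁ h₂ hi
    convert hlive i hi using 1
    rw [live_eq_sum hS hσ hx hlast]
    refine Finset.sum_congr rfl fun v _ => ?_
    rw [(hd v).1, (hd v).2]
    simp only [← h₁, ← h₂]
    split_ifs <;> ring
  rcases Nat.even_or_odd' q with ⟨i, rfl | rfl⟩
  · exact heven i (fun v => by omega) (fun v => by omega) (by omega)
  -- In a prefix of length `2 * i + 1`, the operation at position `i` has started and not ended, so
  -- the sum is the memory during it.
  · rcases Nat.lt_or_ge i σ.length with hi | hi
    · have hget : σ.idxOf σ[i] = i := idxOf_getElem_of_nodup hσ.1 i hi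
      rw [G.mem_profile]
      refine Or.inr ⟨⟨i, hi⟩, Or.inl ?_⟩
      have : (⟨i, hi⟩ : Fin σ.length) = ⟨σ.idxOf σ[i], hlen _⟩ := Fin.ext hget.symm
      rw [this, memDuring_eq σ, live_eq_sum hS hσ hx hlast, hget]
      have : G.size σ[i] + G.scratch σ[i] =
          ∑ u, if u = σ[i] then G.size u + G.scratch u else 0 := by simp
      rw [this, ← Finset.sum_add_distrib]
      refine Finset.sum_congr rfl fun v _ => ?_
      rw [(hd v).1, (hd v).2]
      by_cases hv : v = σ[i]
      · have : σ.idxOf v = i := by rw [hv, hget]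
        rw [if_neg (by omega), if_pos (by omega), if_neg (by omega), if_pos hv]
      · have : σ.idxOf v ≠ i := fun h => hv (by
          rw [← hget] at h
          exact (List.idxOf_inj (hσ.2.1 v)).1 h)
        rw [if_neg hv]
        by_cases h : σ.idxOf v < i
        · rw [if_pos (by omega), if_pos (by omega), if_pos h]; ring
        · rw [if_neg (by omega), if_neg (by omega), if_neg h]
    · refine heven σ.length (fun v => ?_) (fun v => ?_) le_rfl <;> have := hlen v <;> omega

end Contract

/-! ### Structure of starborescences and the number of branch nodes -/

section Starborescence

/-- Induction on the construction, with all clauses together: in a series composition, the middle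
vertex is the only common one, so it gains an in-edge from one part and an out-edge from the other,
and no further terminals arise. -/
theorem IsSeriesParallel.basic {V : Type} [Fintype V] [DecidableEq V] {U : Finset V}
    {E : Finset (V × V)} {s t : V} (h : IsSeriesParallel U E s t) :
    s ≠ t ∧ s ∈ U ∧ t ∈ U ∧ (∀ u v, (u, v) ∈ E → u ∈ U ∧ v ∈ U ∧ v ≠ s ∧ u ≠ t) ∧
      (∀ v ∈ U, v ≠ s → ∃ u, (u, v) ∈ E) ∧ ∀ v ∈ U, v ≠ t → ∃ w, (v, w) ∈ E := by
  induction h with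
  | base s t hst =>
    refine ⟨hst, by simp, by simp, ?_, ?_, ?_⟩
    · intro u v huv
      obtain ⟨rfl, rfl⟩ : u = s ∧ v = t := by simpa using huv
      exact ⟨by simp, by simp, hst.symm, hst⟩
    · intro v hv hvs
      simp only [Finset.mem_insert, Finset.mem_singleton] at hv
      exact ⟨s, by simp [hv.resolve_left hvs]⟩
    · intro v hv hvt
      simp only [Finset.mem_insert, Finset.mem_singleton] at hv
      exact ⟨t, by simp [hv.resolve_right hvt]⟩
  | series U₁ U₂ E₁ E₂ s r t h₁ h₂ hU ih₁ ih₂ =>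
    obtain ⟨hne₁, hs₁, ht₁, he₁, hi₁, ho₁⟩ := ih₁
    obtain ⟨hne₂, hs₂, ht₂, he₂, hi₂, ho₂⟩ := ih₂
    have hr : ∀ v, v ∈ U₁ → v ∈ U₂ → v = r := fun v h h' => by
      have : v ∈ U₁ ∩ U₂ := Finset.mem_inter.2 ⟨h, h'⟩
      rwa [hU, Finset.mem_singleton] at this
    refine ⟨?_, Finset.mem_union_left _ hs₁, Finset.mem_union_right _ ht₂, ?_, ?_, ?_⟩
    · rintro rfl
      exact hne₁ (hr _ hs₁ ht₂)
    · intro u v huv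
      rcases Finset.mem_union.1 huv with huv | huv
      · obtain ⟨h₁, h₂, h₃, h₄⟩ := he₁ u v huv
        refine ⟨Finset.mem_union_left _ h₁, Finset.mem_union_left _ h₂, h₃, ?_⟩
        rintro rfl
        exact hne₂ (hr _ h₁ ht₂).symm
      · obtain ⟨h₁, h₂, h₃, h₄⟩ := he₂ u v huv
        refine ⟨Finset.mem_union_right _ h₁, Finset.mem_union_right _ h₂, ?_, h₄⟩
        rintro rfl
        exact hne₁ (hr _ hs₁ h₂)
    · intro v hv hvs
      by_cases hv₁ : v ∈ U₁
      · obtain ⟨u, hu⟩ := hi₁ v hv₁ hvs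
        exact ⟨u, Finset.mem_union_left _ hu⟩
      · have hv₂ := (Finset.mem_union.1 hv).resolve_left hv₁
        obtain ⟨u, hu⟩ := hi₂ v hv₂ (by rintro rfl; exact hv₁ ht₁)
        exact ⟨u, Finset.mem_union_right _ hu⟩
    · intro v hv hvt
      by_cases hv₂ : v ∈ U₂
      · obtain ⟨u, hu⟩ := ho₂ v hv₂ hvt
        exact ⟨u, Finset.mem_union_right _ hu⟩
      · have hv₁ := (Finset.mem_union.1 hv).resolve_right hv₂
        obtain ⟨u, hu⟩ := ho₁ v hv₁ (by rintro rfl; exact hv₂ hs₂)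
        exact ⟨u, Finset.mem_union_left _ hu⟩
  | parallel U₁ U₂ E₁ E₂ s t h₁ h₂ hU ih₁ ih₂ =>
    obtain ⟨hne₁, hs₁, ht₁, he₁, hi₁, ho₁⟩ := ih₁
    obtain ⟨hne₂, hs₂, ht₂, he₂, hi₂, ho₂⟩ := ih₂
    refine ⟨hne₁, Finset.mem_union_left _ hs₁, Finset.mem_union_left _ ht₁, ?_, ?_, ?_⟩
    · intro u v huv
      rcases Finset.mem_union.1 huv with huv | huv
      · obtain ⟨h₁, h₂, h₃, h₄⟩ := he₁ u v huv
        exact ⟨Finset.mem_union_left _ h₁, Finset.mem_union_left _ h₂, h₃, h₄⟩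
      · obtain ⟨h₁, h₂, h₃, h₄⟩ := he₂ u v huv
        exact ⟨Finset.mem_union_right _ h₁, Finset.mem_union_right _ h₂, h₃, h₄⟩
    · intro v hv hvs
      rcases Finset.mem_union.1 hv with hv | hv
      · obtain ⟨u, hu⟩ := hi₁ v hv hvs
        exact ⟨u, Finset.mem_union_left _ hu⟩
      · obtain ⟨u, hu⟩ := hi₂ v hv hvs
        exact ⟨u, Finset.mem_union_right _ hu⟩
    · intro v hv hvt
      rcases Finset.mem_union.1 hv with hv | hv
      · obtain ⟨u, hu⟩ := ho₁ v hv hvt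
        exact ⟨u, Finset.mem_union_left _ hu⟩
      · obtain ⟨u, hu⟩ := ho₂ v hv hvt
        exact ⟨u, Finset.mem_union_right _ hu⟩

variable {n : ℕ} {E : Finset (Fin n × Fin n)} {s t : Fin n}

theorem IsStarborescence.exists_inTreeWithSource (h : IsStarborescence E) (hE : IsDAG E) :
    ∃ s t, InTreeWithSource E s t := by
  obtain ⟨s, t, hsp, hts, -, huniq, -⟩ := h
  obtain ⟨hne, -, -, he, hi, ho⟩ := hsp.basic
  refine ⟨s, t, hne, fun u hu => (he _ _ hu).2.2.1 rfl, fun v hv => (he _ _ hv).2.2.2 rfl,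
    fun v => hi v (Finset.mem_univ v), fun v => ho v (Finset.mem_univ v), ?_, hE⟩
  intro v a b hv ha hb
  have := huniq ⟨v, hv⟩ ⟨a, (he _ _ ha).2.2.1⟩ ⟨b, (he _ _ hb).2.2.1⟩ ha hb
  exact congrArg Subtype.val this

namespace InTreeWithSource

variable (hS : InTreeWithSource E s t)
include hS

/-- Count edges by their tails: each of the `n - 1` nodes other than `s` has at most one out-edge.
-/
theorem card_edges_le : E.card + 1 ≤ (outNbrs E s).card + n := by
  have h₁ : E.card = ∑ v, (outNbrs E v).card := by
    rw [Finset.card_eq_sum_card_fiberwise (f := Prod.fst) (t := Finset.univ) (by simp)]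
    refine Finset.sum_congr rfl fun v _ => ?_
    refine Finset.card_bij (fun e _ => e.2) ?_ ?_ ?_
    · rintro ⟨a, b⟩ h
      obtain ⟨h', rfl⟩ := Finset.mem_filter.1 h
      simpa [outNbrs] using h'
    · rintro ⟨a, b⟩ h ⟨c, d⟩ h' h''
      simp only [Finset.mem_filter] at h h'
      simp_all
    · intro b hb
      exact ⟨(v, b), by simpa [outNbrs] using hb, rfl⟩
  have h₂ : ∑ v ∈ Finset.univ.erase s, (outNbrs E v).card ≤ (Finset.univ.erase s).card := by
    rw [Finset.card_eq_sum_ones]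
    refine Finset.sum_le_sum fun v hv => ?_
    rw [Finset.card_le_one]
    intro a ha b hb
    simp only [outNbrs, Finset.mem_filter] at ha hb
    exact hS.uniq_out v a b (Finset.ne_of_mem_erase hv) ha.2 hb.2
  rw [h₁, ← Finset.add_sum_erase _ _ (Finset.mem_univ s)]
  rw [Finset.card_erase_of_mem (Finset.mem_univ s), Finset.card_univ, Fintype.card_fin] at h₂
  have := s.isLt
  omega

theorem card_outNbrs_pos : 0 < (outNbrs E s).card :=
  Finset.card_pos.2 ⟨nxt E s, by simpa [outNbrs] using hS.nxt_mem hS.ne⟩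

theorem card_edges_le_two_mul : E.card ≤ 2 * n := by
  have h₁ := hS.card_edges_le
  have h₂ : (outNbrs E s).card ≤ n := by simpa using Finset.card_le_univ (outNbrs E s)
  omega

/-- The number of branch nodes is at most linear in the degree of the source. -/
theorem card_branch_le :
    (Finset.univ.filter fun v => ¬ IsInner E s t v).card ≤ 2 * (outNbrs E s).card + 2 := by
  -- The nodes where branches join: every node other than `s` has an in-neighbour, so in-degree
  -- different from `1` means at least `2`.
  set J := Finset.univ.filter fun v =>
    v ≠ s ∧ (Finset.univ.filter fun u => (u, v) ∈ E).card ≠ 1 with hJ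
  have h₁ : E.card = ∑ v, (Finset.univ.filter fun u => (u, v) ∈ E).card := by
    rw [Finset.card_eq_sum_card_fiberwise (f := Prod.snd) (t := Finset.univ) (by simp)]
    refine Finset.sum_congr rfl fun v _ => ?_
    refine Finset.card_bij (fun e _ => e.1) ?_ ?_ ?_
    · rintro ⟨a, b⟩ h
      obtain ⟨h', rfl⟩ := Finset.mem_filter.1 h
      simpa using h'
    · rintro ⟨a, b⟩ h ⟨c, d⟩ h' h''
      simp only [Finset.mem_filter] at h h'
      simp_all
    · intro b hb
      exact ⟨(b, v), by simpa using hb, rfl⟩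
  -- Count edges by their heads: every node but `s` accounts for one edge, every join for one more.
  -- With `card_edges_le`, the joins are at most as many as the out-neighbours of `s`.
  have h₂ : n - 1 + J.card ≤ E.card := by
    have hn : n - 1 = ∑ v : Fin n, if v ≠ s then 1 else 0 := by
      rw [← Finset.card_filter, Finset.filter_ne', Finset.card_erase_of_mem (Finset.mem_univ s)]
      simp
    rw [hn, hJ, Finset.card_filter, ← Finset.sum_add_distrib, h₁]
    refine Finset.sum_le_sum fun v _ => ?_
    by_cases hv : v = s
    · simp [hv]
    · have : 0 < (Finset.univ.filter fun u => (u, v) ∈ E).card := by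
        obtain ⟨u, hu⟩ := hS.ex_in v hv
        exact Finset.card_pos.2 ⟨u, by simpa using hu⟩
      simp only [ne_eq, hv, not_false_eq_true, if_true, true_and]
      split_ifs <;> omega
  have h₃ : (Finset.univ.filter fun v => ¬ IsInner E s t v) ⊆ ({s, t} ∪ outNbrs E s) ∪ J := by
    intro v hv
    simp only [Finset.mem_filter, IsInner, not_and_or] at hv
    simp only [Finset.mem_union, Finset.mem_insert, Finset.mem_singleton, outNbrs,
      Finset.mem_filter, Finset.mem_univ, true_and, hJ]
    by_cases h₄ : v = s
    · exact Or.inl (Or.inl (Or.inl h₄))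
    rcases hv.2 with h | h | h
    · exact Or.inl (Or.inl (Or.inr (not_not.1 h)))
    · exact Or.inl (Or.inr (not_not.1 h))
    · exact Or.inr ⟨h₄, h⟩
  have h₄ := Finset.card_le_card h₃
  have h₅ := Finset.card_union_le ({s, t} ∪ outNbrs E s) J
  have h₆ := Finset.card_union_le {s, t} (outNbrs E s)
  have h₇ : ({s, t} : Finset (Fin n)).card ≤ 2 := Finset.card_le_two
  have h₈ := hS.card_edges_le
  have := s.isLt
  omega

end InTreeWithSource

/-- `x` is the last out-neighbour of `s` in `ord`. -/
def IsLastOut (E : Finset (Fin n × Fin n)) (s : Fin n) (ord : List (Fin n)) (x : Fin n) : Prop :=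
  (s, x) ∈ E ∧ ∀ y, (s, y) ∈ E → ord.idxOf y ≤ ord.idxOf x

/-- A dominant schedule of the caduceus for an order of the branch nodes gives a schedule of the
starborescence whose peak is at most that of all schedules with this order of the branch nodes.
The peak of the former separates them. -/
theorem dominant_caduceus {G : ComputationGraph (Fin n)} {L : List (Fin n × Fin n)}
    (hL : L.toFinset = G.edges) (hS : InTreeWithSource G.edges s t) {ord : List (Fin n)}
    (ho : ValidOrder G.edges s t ord) {x : Fin n} (hx : IsLastOut G.edges s ord x)
    {w : Fin (2 * n + 1) → ℝ} (hw : IsWeight G s x w) {τ : List (Fin (2 * n + 1))}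
    (hτ : IsDominant (caduceusEdges s t L ord).toFinset (nodeSumProfile w) τ) :
    (IsSchedule G.edges (contract τ) ∧
      ∀ z ∈ G.profile (contract τ), ∃ y ∈ nodeSumProfile w τ, z ≤ y) ∧
    ∀ σ, IsSchedule G.edges σ → branchOrder G.edges s t σ = ord →
      ∀ y ∈ nodeSumProfile w τ, ∃ z ∈ G.profile σ, y ≤ z := by
  obtain ⟨hsch, hdom⟩ := hτ
  -- Out-neighbours of the source are branch nodes, so the order of the branch nodes decides which
  -- of them is last, and hence the weights.
  have hni : ∀ y, (s, y) ∈ G.edges → ¬ IsInner G.edges s t y := fun y hy h => h.2.1 hy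
  have hc : IsSchedule G.edges (contract τ) := by
    rw [← hL] at hS ho ⊢
    exact hsch.contract hS ho
  refine ⟨⟨hc, ?_⟩, ?_⟩
  · refine profile_contract_le hS hw hsch.2.1 hc (fun u v => hsch.idxOf_contract_lt_iff)
      hsch.inV_lt_outV hx.1 fun y hy => ?_
    rcases (hx.2 y hy).lt_or_eq with h | h
    · have h₁ := hsch.staff_lt ((ho.mem_iff y).2 (hni y hy)) ((ho.mem_iff x).2 (hni x hx.1)) h
      exact (hsch.idxOf_contract_lt_iff.2 (h₁.trans (hsch.inV_lt_outV x))).le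
    · rw [(List.idxOf_inj ((ho.mem_iff y).2 (hni y hy))).1 h]
  · intro σ hσ hord y hy
    have hlast : ∀ y, (s, y) ∈ G.edges → σ.idxOf y ≤ σ.idxOf x := by
      intro y hy
      have := hx.2 y hy
      rw [← hord] at this
      by_contra! h
      rw [← hσ.idxOf_branchOrder_lt_iff (hni x hx.1) (hni y hy)] at h
      omega
    have hd : IsSchedule (caduceusEdges s t L ord).toFinset (doubled σ) := by
      rw [← hL] at hS hσ hord
      rw [← hord]
      exact hσ.doubled hS
    obtain ⟨z, hz, hyz⟩ := (hdom _ hd).exists_le (nodeSumProfile_ne_nil _ _) hy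
    exact ⟨z, nodeSumProfile_doubled_mem hS hw hσ hx.1 hlast z hz, hyz⟩

end Starborescence

/-! ### Reading the graph -/

namespace RealRAM

open Prog

/-- Equality test of natural numbers. -/
def Test.natEq (e₁ e₂ : NatExpr) : Test := .and (.natLe e₁ e₂) (.natLe e₂ e₁)

@[simp] theorem Test.holds_natEq {e₁ e₂ : NatExpr} {m : Mem} :
    (Test.natEq e₁ e₂).holds m ↔ e₁.eval m = e₂.eval m := by
  simp only [natEq, holds]
  omega

@[simp] theorem Test.cost_natEq {e₁ e₂ : NatExpr} :
    (Test.natEq e₁ e₂).cost = 3 + 2 * e₁.cost + 2 * e₂.cost := by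
  simp only [natEq, cost]
  omega

/-- The tail of the edge with the number in variable `x`. -/
def edgeTail (x : ℕ) : NatExpr := .get 0 (.add (.add (.var x) (.var x)) (.const 1))

/-- The head of the edge with the number in variable `x`. -/
def edgeHead (x : ℕ) : NatExpr := .get 0 (.add (.add (.var x) (.var x)) (.const 2))

@[simp] theorem cost_edgeTail (x : ℕ) : (edgeTail x).cost = 6 := rfl

@[simp] theorem cost_edgeHead (x : ℕ) : (edgeHead x).cost = 6 := rfl

theorem eval_edgeTail (x : ℕ) (m : Mem) :
    (edgeTail x).eval m = m.nat 0 (m.var x + m.var x + 1) := rfl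

theorem eval_edgeHead (x : ℕ) (m : Mem) :
    (edgeHead x).eval m = m.nat 0 (m.var x + m.var x + 2) := rfl

attribute [simp] NatExpr.eval NatExpr.cost RealExpr.eval RealExpr.cost Test.holds Test.cost

variable {n : ℕ}

/-- The graph with edge list `L` is in the memory: the number of nodes in variable `2`, the number
of edges in variable `18`, and the edges in array `0`. -/
structure HasGraph (L : List (Fin n × Fin n)) (m : Mem) : Prop where
  nodes : m.var 2 = n
  edges : m.var 18 = L.length
  tail : ∀ j (h : j < L.length), m.nat 0 (j + j + 1) = (L[j].1 : ℕ)
  head : ∀ j (h : j < L.length), m.nat 0 (j + j + 2) = (L[j].2 : ℕ)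

theorem HasGraph.of_eq {L : List (Fin n × Fin n)} {m m' : Mem} (h : HasGraph L m)
    (h₂ : m'.var 2 = m.var 2) (h₁₈ : m'.var 18 = m.var 18) (h₀ : m'.nat 0 = m.nat 0) :
    HasGraph L m' :=
  ⟨h₂ ▸ h.nodes, h₁₈ ▸ h.edges, h₀ ▸ h.tail, h₀ ▸ h.head⟩

/-- Read the number of nodes and find the number of edges. -/
def readGraph : Prog := block [.setVar 2 (.get 0 (.const 0)), .setVar 18 (.const 0),
  .loop (.natLe (.add (.add (.var 18) (.var 18)) (.const 3)) (.var 0))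
    (.setVar 18 (.add (.var 18) (.const 1)))]

theorem encodeGraph_length (L : List (Fin n × Fin n)) :
    (encodeGraph L).length = 2 * L.length + 1 := by
  induction L with
  | nil => simp [encodeGraph]
  | cons e L ih => simp [encodeGraph] at ih ⊢; omega

theorem encodeGraph_append (L : List (Fin n × Fin n)) (e : Fin n × Fin n) :
    encodeGraph (L ++ [e]) = encodeGraph L ++ [(e.1 : ℕ), (e.2 : ℕ)] := by
  simp [encodeGraph]

theorem encodeGraph_getElem (L : List (Fin n × Fin n)) (j : ℕ) (h : j < L.length) :
    (encodeGraph L)[j + j + 1]? = some (L[j].1 : ℕ) ∧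
      (encodeGraph L)[j + j + 2]? = some (L[j].2 : ℕ) := by
  simp only [encodeGraph, List.getElem?_cons_succ]
  induction L generalizing j with
  | nil => simp at h
  | cons e L ih =>
    cases j with
    | zero => simp
    | succ j =>
      have := ih j (by simpa using h)
      rw [show j + 1 + (j + 1) = j + j + 2 by ring, show j + j + 2 + 1 = j + j + 1 + 2 by ring]
      simpa using this

theorem wp_readGraph (L : List (Fin n × Fin n)) (rs : List ℝ) :
    Wp readGraph (Mem.ofInput (encodeGraph L) rs) fun m' t =>
      t ≤ L.length * 12 + 20 ∧ HasGraph L m' := by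
  have h0 : (Mem.ofInput (encodeGraph L) rs).nat 0 = fun i => (encodeGraph L).getD i 0 := rfl
  -- The number of edges is not part of the input; it is recovered from the input length `2 *
  -- L.length + 1`.
  have hv : (Mem.ofInput (encodeGraph L) rs).var 0 = 2 * L.length + 1 := encodeGraph_length L
  simp only [readGraph, wp_block_cons, wp_block_singleton, wp_setVar]
  refine (wp_loop L.length 4 (fun i m => m.var 18 = i ∧ m.var 2 = n) ?_ ?_ ?_).mono_frame ?_
  · simp only [NatExpr.eval, Mem.setV_var, h0]
    simp [encodeGraph]
  · intro i m hi hF hI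
    have : m.var 0 = 2 * L.length + 1 := by
      rw [hF.var 0 (by decide)]
      simp [hv]
    simp [this, hI.1]
    omega
  · intro i m hi hF hI
    simp [hI.1, hI.2]
  · intro m t hF ht
    have h0' : m.nat 0 = fun i => (encodeGraph L).getD i 0 := by
      rw [hF.nat 0 (by decide)]
      simp [h0]
    refine ⟨?_, ht.2.2, ht.2.1, fun j hj => ?_, fun j hj => ?_⟩
    · simp at ht ⊢
      omega
    · rw [h0']
      simp [List.getD_eq_getElem?_getD, (encodeGraph_getElem L j hj).1]
    · rw [h0']
      simp [List.getD_eq_getElem?_getD, (encodeGraph_getElem L j hj).2]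

/-- Compute in-degrees in array `1`, out-degrees in array `2` and out-neighbours in array `3`. -/
def degrees : Prog := for_ 8 (.var 18) (block [
  .setNat 1 (edgeHead 8) (.add (.get 1 (edgeHead 8)) (.const 1)),
  .setNat 2 (edgeTail 8) (.add (.get 2 (edgeTail 8)) (.const 1)),
  .setNat 3 (edgeTail 8) (edgeHead 8)])

/-- Array `3` keeps the head of the last edge read from each tail. For nodes of the tree this is the
only out-neighbour; the entry of the source is never relied upon. -/
theorem wp_degrees {L : List (Fin n × Fin n)} {m : Mem} (hG : HasGraph L m)
    (h₁ : ∀ i, m.nat 1 i = 0) (h₂ : ∀ i, m.nat 2 i = 0) :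
    Wp degrees m fun m' t => t ≤ L.length * 100 + 10 ∧
      (∀ v : Fin n, m'.nat 1 v = L.countP fun e => e.2 = v) ∧
      (∀ v : Fin n, m'.nat 2 v = L.countP fun e => e.1 = v) ∧
      ∀ v : Fin n, (∃ e ∈ L, e.1 = v) → ∃ e ∈ L, e.1 = v ∧ m'.nat 3 v = (e.2 : ℕ) := by
  refine (wp_for L.length 60 (fun i m' =>
      (∀ v : Fin n, m'.nat 1 v = (L.take i).countP fun e => e.2 = v) ∧
      (∀ v : Fin n, m'.nat 2 v = (L.take i).countP fun e => e.1 = v) ∧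
      ∀ v : Fin n, (∃ e ∈ L.take i, e.1 = v) → ∃ e ∈ L, e.1 = v ∧ m'.nat 3 v = (e.2 : ℕ))
    (by decide) ?_ ?_ ?_).mono ?_
  · intro m' hF
    simp [hF.var 18 (by decide), hG.edges]
  · simp [h₁, h₂]
  · rintro i m' hi hF hx ⟨hI₁, hI₂, hI₃⟩
    have hG' := hG.of_eq (hF.var 2 (by decide)) (hF.var 18 (by decide)) (hF.nat 0 (by decide))
    have ht := hG'.tail i hi
    have hh := hG'.head i hi
    rw [List.take_succ_eq_append_getElem hi]
    simp only [wp_block_cons, wp_block_singleton, wp_setNat, eval_edgeHead, eval_edgeTail,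
      Mem.setN_var, Mem.setN_nat, hx, NatExpr.eval, hh, Mem.setV_nat, NatExpr.cost,
      cost_edgeHead, cost_edgeTail]
    simp only [OfNat.zero_ne_ofNat, reduceIte, ht, hh,
      OfNat.ofNat_ne_one, OfNat.one_ne_ofNat, Nat.reduceEqDiff, zero_ne_one]
    refine ⟨by norm_num, fun v => ?_, fun v => ?_, fun v hv => ?_⟩
    · rw [List.countP_append, ← hI₁ v]
      by_cases h : L[i].2 = v
      · subst h; simp
      · rw [Function.update_of_ne (by simpa [Fin.ext_iff, eq_comm] using h)]
        simp [h]
    · rw [List.countP_append, ← hI₂ v]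
      by_cases h : L[i].1 = v
      · subst h; simp
      · rw [Function.update_of_ne (by simpa [Fin.ext_iff, eq_comm] using h)]
        simp [h]
    · by_cases h : L[i].1 = v
      · subst h
        exact ⟨L[i], List.getElem_mem _, rfl, by simp⟩
      · rw [Function.update_of_ne (by simpa [Fin.ext_iff, eq_comm] using h)]
        refine hI₃ v ?_
        obtain ⟨e, he, hev⟩ := hv
        rcases List.mem_append.1 he with he | he
        · exact ⟨e, he, hev⟩
        · rw [List.mem_singleton] at he
          exact absurd (he ▸ hev) h
  · rintro m' t ⟨ht, hI₁, hI₂, hI₃⟩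
    rw [List.take_length] at hI₁ hI₂ hI₃
    simp only [NatExpr.cost] at ht
    exact ⟨by omega, hI₁, hI₂, hI₃⟩

/-- Find the source (variable `3`) and the sink (variable `4`). -/
def findEnds : Prog := block [
  for_ 8 (.var 2) (block [
    .ite (.natLe (.get 1 (.var 8)) (.const 0)) (.setVar 3 (.var 8)) skip,
    .ite (.natLe (.get 2 (.var 8)) (.const 0)) (.setVar 4 (.var 8)) skip]),
  .setNat 3 (.var 4) (.var 4)]

/-- The entry of the sink in array `3` is set to the sink, in accordance with `nxt_sink`. -/
theorem wp_findEnds {m : Mem} {s t : Fin n} (h₂ : m.var 2 = n)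
    (hs : ∀ v : Fin n, m.nat 1 v = 0 ↔ v = s) (ht : ∀ v : Fin n, m.nat 2 v = 0 ↔ v = t) :
    Wp findEnds m fun m' τ => τ ≤ n * 50 + 20 ∧ m'.var 3 = s ∧ m'.var 4 = t ∧
      m'.nat 3 t = t ∧ ∀ i, i ≠ (t : ℕ) → m'.nat 3 i = m.nat 3 i := by
  rw [findEnds, wp_block_cons]
  refine (wp_for n 30 (fun i m' => ((s : ℕ) < i → m'.var 3 = s) ∧ ((t : ℕ) < i → m'.var 4 = t))
    (by decide) ?_ ?_ ?_).mono_frame ?_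
  · intro m' hF
    simp [hF.var 2 (by decide), h₂]
  · simp
  · rintro i m' hi hF hx ⟨hI₁, hI₂⟩
    have hs' : m.nat 1 i = 0 ↔ i = s := by simpa [Fin.ext_iff] using hs ⟨i, hi⟩
    have ht' : m.nat 2 i = 0 ↔ i = t := by simpa [Fin.ext_iff] using ht ⟨i, hi⟩
    have hn₁ := hF.nat 1 (by decide)
    have hn₂ := hF.nat 2 (by decide)
    by_cases h₁ : m.nat 1 i = 0 <;> by_cases h₂ : m.nat 2 i = 0 <;>
      simp [hx, hn₁, hn₂, h₁, h₂] <;> simp only [h₁, h₂, true_iff, false_iff] at hs' ht' <;>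
      refine ⟨?_, ?_⟩ <;> intro h <;>
      first | (apply hI₁; omega) | (apply hI₂; omega) | omega
  · rintro m' τ hF ⟨hτ, hI₁, hI₂⟩
    simp only [wp_block_singleton, wp_setNat, NatExpr.eval, hI₁ s.isLt, hI₂ t.isLt, Mem.setN_var,
      Mem.setN_nat, reduceIte, Function.update_self, NatExpr.cost]
    refine ⟨?_, trivial, trivial, trivial, fun i hi => ?_⟩
    · simp only [NatExpr.cost] at hτ; omega
    · rw [Function.update_of_ne hi, hF.nat 3 (by decide)]

/-- Mark the out-neighbours of the source in array `4`. -/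
def markOut : Prog := for_ 8 (.var 18)
  (.ite (.natEq (edgeTail 8) (.var 3)) (.setNat 4 (edgeHead 8) (.const 1)) skip)

theorem wp_markOut {L : List (Fin n × Fin n)} {m : Mem} (hG : HasGraph L m) {s : Fin n}
    (hs : m.var 3 = s) (h₄ : ∀ i, m.nat 4 i = 0) :
    Wp markOut m fun m' t => t ≤ L.length * 80 + 10 ∧
      ∀ v : Fin n, m'.nat 4 v = if (s, v) ∈ L then 1 else 0 := by
  refine (wp_for L.length 50 (fun i m' =>
    ∀ v : Fin n, m'.nat 4 v = if (s, v) ∈ L.take i then 1 else 0)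
    (by decide) ?_ ?_ ?_).mono ?_
  · intro m' hF
    simp [hF.var 18 (by decide), hG.edges]
  · simp [h₄]
  · rintro i m' hi hF hx hI
    have hG' := hG.of_eq (hF.var 2 (by decide)) (hF.var 18 (by decide)) (hF.nat 0 (by decide))
    have ht := hG'.tail i hi
    have hh := hG'.head i hi
    have h₃ := hF.var 3 (by decide)
    by_cases h : L[i].1 = s
    · simp [eval_edgeHead, eval_edgeTail, hx, ht, hh, h₃, hs, h]
      intro v
      rw [List.take_succ_eq_append_getElem hi]
      by_cases h' : v = L[i].2
      · subst h'
        have h'' : (s, L[i].2) = L[i] := by rw [← h]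
        simp only [Function.update_self, List.mem_append, List.mem_singleton, h'', or_true, if_true]
      · rw [Function.update_of_ne (by simpa [Fin.ext_iff] using h'), hI v]
        have h'' : (s, v) ≠ L[i] := fun hv => h' (by rw [← hv])
        simp only [List.mem_append, List.mem_singleton, h'', or_false]
    · have h' : (L[i].1 : ℕ) ≠ s := by simpa [Fin.ext_iff] using h
      have h'' : ∀ v, (s, v) ≠ L[i] := fun v hv => h (by rw [← hv])
      simp [eval_edgeTail, hx, ht, h₃, hs, h', hI]
      intro v
      rw [List.take_succ_eq_append_getElem hi]
      simp only [List.mem_append, List.mem_singleton, h'', or_false]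
  · rintro m' t ⟨ht, hI⟩
    rw [List.take_length] at hI
    simp only [NatExpr.cost] at ht
    exact ⟨by omega, hI⟩

end RealRAM

/-! ### Branch nodes, the climbing table and the number of orders -/

namespace RealRAM

open Prog

variable {n : ℕ}

/-- The list of the nodes that are not inner. -/
def branchList (E : Finset (Fin n × Fin n)) (s t : Fin n) : List (Fin n) :=
  (List.finRange n).filter fun v => ¬ IsInner E s t v

theorem mem_branchList {E : Finset (Fin n × Fin n)} {s t v : Fin n} :
    v ∈ branchList E s t ↔ ¬ IsInner E s t v := by
  simp [branchList]

theorem nodup_branchList (E : Finset (Fin n × Fin n)) (s t : Fin n) :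
    (branchList E s t).Nodup :=
  (List.nodup_finRange n).filter _

/-- List the branch nodes in array `6`, count them in variable `5`, and mark them in array `5`. -/
def listBranch : Prog := block [
  .setVar 5 (.const 0),
  for_ 8 (.var 2)
    (.ite (.and (.and (.natEq (.get 1 (.var 8)) (.const 1)) (.natLe (.get 4 (.var 8)) (.const 0)))
        (.not (.natEq (.var 8) (.var 4))))
      skip
      (block [
        .setNat 5 (.var 8) (.const 1),
        .setNat 6 (.var 5) (.var 8),
        .setVar 5 (.add (.var 5) (.const 1))]))]

theorem take_finRange_succ {i : ℕ} (hi : i < n) :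
    (List.finRange n).take (i + 1) = (List.finRange n).take i ++ [⟨i, hi⟩] := by
  rw [List.take_succ_eq_append_getElem (by simpa using hi)]
  simp

theorem wp_listBranch {m : Mem} {E : Finset (Fin n × Fin n)} {s t : Fin n} (h₂ : m.var 2 = n)
    (ht : m.var 4 = t)
    (h₁ : ∀ v : Fin n, m.nat 1 v = (Finset.univ.filter fun u => (u, v) ∈ E).card)
    (h₄ : ∀ v : Fin n, m.nat 4 v = if (s, v) ∈ E then 1 else 0) (h₅ : ∀ i, m.nat 5 i = 0) :
    Wp listBranch m fun m' τ => τ ≤ n * 60 + 20 ∧ m'.var 5 = (branchList E s t).length ∧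
      (∀ v : Fin n, m'.nat 5 v = if IsInner E s t v then 0 else 1) ∧
      Pre (m'.nat 6) ((branchList E s t).map Fin.val) := by
  simp only [listBranch, wp_block_cons, wp_block_singleton, wp_setVar]
  refine (wp_for n 50 (fun i m' =>
      m'.var 5 = (((List.finRange n).take i).filter fun v => ¬ IsInner E s t v).length ∧
      (∀ v : Fin n, m'.nat 5 v = if (v : ℕ) < i ∧ ¬ IsInner E s t v then 1 else 0) ∧
      Pre (m'.nat 6)
        ((((List.finRange n).take i).filter fun v => ¬ IsInner E s t v).map Fin.val))
    (by decide) ?_ ?_ ?_).mono ?_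
  · intro m' hF
    simp [hF.var 2 (by decide), h₂]
  · simp [h₅, Pre.nil]
  · rintro i m' hi hF hx ⟨hI₁, hI₂, hI₃⟩
    have hn₁ := hF.nat 1 (by decide)
    have hn₄ := hF.nat 4 (by decide)
    have hv₄ := hF.var 4 (by decide)
    have h₁' := h₁ ⟨i, hi⟩
    have h₄' := h₄ ⟨i, hi⟩
    simp only at h₁' h₄'
    rw [take_finRange_succ hi, List.filter_append]
    by_cases h : IsInner E s t ⟨i, hi⟩
    · obtain ⟨ha, hb, hc⟩ := h
      have ha' : i ≠ t := by simpa [Fin.ext_iff] using ha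
      have h' : IsInner E s t ⟨i, hi⟩ := ⟨ha, hb, hc⟩
      simp [hx, hn₁, hn₄, hv₄, h₁', h₄', hb, hc, ht, ha', h', hI₁]
      refine ⟨fun v => ?_, by simpa using hI₃⟩
      rw [hI₂ v]
      by_cases hv : v = ⟨i, hi⟩
      · subst hv; simp [h']
      · have : (v : ℕ) ≠ i := by simpa [Fin.ext_iff] using hv
        have h'' : (v : ℕ) < i ↔ (v : ℕ) ≤ i := by omega
        simp only [h'']
    · have hne : ¬ (((Finset.univ.filter fun u => (u, ⟨i, hi⟩) ∈ E).card = 1 ∧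
          ((if (s, ⟨i, hi⟩) ∈ E then 1 else 0) = 0)) ∧ ¬ i = t) := by
        rintro ⟨⟨ha, hb⟩, hc⟩
        refine h ⟨by simpa [Fin.ext_iff] using hc, ?_, ha⟩
        intro h'
        simp [h'] at hb
      simp only [wp_ite, Test.holds, Test.holds_natEq, NatExpr.eval, Mem.setV_var, hx, hn₁, hn₄,
        hv₄, Mem.setV_nat, h₁', h₄', ht, Nat.le_zero, Nat.reduceEqDiff,
        reduceIte, hne]
      simp [hx, hI₁, h]
      refine ⟨fun v => ?_, ?_⟩
      · by_cases hv : v = ⟨i, hi⟩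
        · subst hv; simp [h]
        · have : (v : ℕ) ≠ i := by simpa [Fin.ext_iff] using hv
          have h'' : (v : ℕ) < i ↔ (v : ℕ) ≤ i := by omega
          rw [Function.update_of_ne this, hI₂]
          simp only [h'']
      · exact (by simpa using hI₃ : Pre _ _).push i (by simp)
  · rintro m' τ ⟨hτ, hI₁, hI₂, hI₃⟩
    rw [List.take_of_length_le (by simp)] at hI₁ hI₃
    simp only [NatExpr.cost] at hτ ⊢
    refine ⟨by omega, hI₁, fun v => ?_, hI₃⟩
    rw [hI₂]
    simp

/-- Compute the first branch nodes on the way to the sink in array `7`. -/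
def climbTable : Prog := for_ 8 (.var 2) (block [
  .setVar 10 (.var 8),
  for_ 9 (.var 2)
    (.ite (.natLe (.get 5 (.var 10)) (.const 0)) (.setVar 10 (.get 3 (.var 10))) skip),
  .setNat 7 (.var 8) (.var 10)])

/-- Each of the `n` nodes climbs for `n` rounds, idle ones included; this fits into the quadratic
term of the running time. -/
theorem wp_climbTable {m : Mem} {E : Finset (Fin n × Fin n)} {s t : Fin n} (h₂ : m.var 2 = n)
    (h₃ : ∀ v : Fin n, IsInner E s t v → m.nat 3 v = nxt E v)
    (h₅ : ∀ v : Fin n, m.nat 5 v = if IsInner E s t v then 0 else 1) :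
    Wp climbTable m fun m' τ => τ ≤ n * (n * 30 + 50) + 20 ∧
      ∀ v : Fin n, m'.nat 7 v = climb E s t v := by
  refine (wp_for n (n * 30 + 30) (fun i m' =>
    ∀ v : Fin n, (v : ℕ) < i → m'.nat 7 v = climb E s t v) (by decide) ?_ ?_ ?_).mono ?_
  · intro m' hF
    simp [hF.var 2 (by decide), h₂]
  · simp
  · rintro i m' hi hF hx hI
    have hn₃ := hF.nat 3 (by decide)
    have hn₅ := hF.nat 5 (by decide)
    have hv₂ := hF.var 2 (by decide)
    simp only [wp_block_cons, wp_block_singleton, wp_setVar]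
    refine (wp_for n 20 (fun j m'' =>
      m''.var 10 = ((climbStep E s t)^[j] ⟨i, hi⟩ : Fin n)) (by decide) ?_ ?_ ?_).mono_frame ?_
    · intro m'' hF'
      simp [hF'.var 2 (by decide), hv₂, h₂]
    · simp [hx]
    · intro j m'' hj hF' hx' hJ
      have hn₃' := hF'.nat 3 (by decide)
      have hn₅' := hF'.nat 5 (by decide)
      rw [Function.iterate_succ_apply', climbStep]
      set v := (climbStep E s t)^[j] ⟨i, hi⟩ with hv
      simp only [wp_ite, Test.holds, NatExpr.eval, hJ, hn₅', Mem.setV_nat, hn₅, h₅ v]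
      by_cases h : IsInner E s t v
      · simp [h, hn₃', hn₃, h₃ v h, hJ]
      · simp [h, hJ]
    · rintro m'' τ hF' ⟨hτ, hJ⟩
      have hx' := hF'.var 8 (by decide)
      have hn₇ := hF'.nat 7 (by decide)
      simp only [NatExpr.cost] at hτ
      simp [hx', hx, hJ, hn₇]
      refine ⟨by omega, fun v hv => ?_⟩
      by_cases h : (v : ℕ) = i
      · subst h; simp [climb]
      · rw [Function.update_of_ne h]
        exact hI v (by omega)
  · rintro m' τ ⟨hτ, hI⟩
    simp only [NatExpr.cost] at hτ
    refine ⟨hτ.trans ?_, fun v => hI v v.isLt⟩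
    have : n * (9 + 1 + (n * 30 + 30)) ≤ n * (n * 30 + 50) := Nat.mul_le_mul_left _ (by omega)
    omega

/-- Compute `k ^ k` in variable `6`, for the number `k` of branch nodes in variable `5`. -/
def power : Prog := block [
  .setVar 6 (.const 1),
  for_ 8 (.var 5) (block [
    .setVar 10 (.const 0),
    for_ 9 (.var 5) (.setVar 10 (.add (.var 10) (.var 6))),
    .setVar 6 (.var 10)])]

/-- Natural numbers can only be added, so each multiplication by `k` is made of `k` additions. -/
theorem wp_power {m : Mem} {k : ℕ} (h₅ : m.var 5 = k) :
    Wp power m fun m' τ => τ ≤ k * (k * 20 + 40) + 20 ∧ m'.var 6 = k ^ k := by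
  simp only [power, wp_block_cons, wp_block_singleton, wp_setVar]
  refine (wp_for k (k * 20 + 20) (fun i m' => m'.var 6 = k ^ i) (by decide) ?_ ?_ ?_).mono ?_
  · intro m' hF
    simp [hF.var 5 (by decide), h₅]
  · simp
  · rintro i m' hi hF hx hI
    have hv₅ := hF.var 5 (by decide)
    simp only [wp_block_cons, wp_block_singleton, wp_setVar]
    refine (wp_for k 6 (fun j m'' => m''.var 10 = j * k ^ i) (by decide) ?_ ?_ ?_).mono ?_
    · intro m'' hF'
      simp [hF'.var 5 (by decide), hv₅, h₅]
    · simp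
    · intro j m'' hj hF' hx' hJ
      have hv₆ := hF'.var 6 (by decide)
      simp [hJ, hv₆, hI]
      ring
    · rintro m'' τ ⟨hτ, hJ⟩
      simp only [NatExpr.cost] at hτ
      simp [hJ]
      exact ⟨by omega, by ring⟩
  · rintro m' τ ⟨hτ, hI⟩
    simp only [NatExpr.cost] at hτ ⊢
    refine ⟨?_, hI⟩
    have : k * (9 + 1 + (k * 20 + 20)) ≤ k * (k * 20 + 40) := Nat.mul_le_mul_left _ (by omega)
    omega

/-- The memory after the analysis of the graph. -/
structure Prepared (L : List (Fin n × Fin n)) (s t : Fin n) (m : Mem) : Prop extends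
    HasGraph L m where
  source : m.var 3 = s
  sink : m.var 4 = t
  count : m.var 5 = (branchList L.toFinset s t).length
  total : m.var 6 = (branchList L.toFinset s t).length ^ (branchList L.toFinset s t).length
  next : ∀ u, u ≠ s → m.nat 3 u = nxt L.toFinset u
  out : ∀ v : Fin n, m.nat 4 v = if (s, v) ∈ L.toFinset then 1 else 0
  branch : ∀ v : Fin n, m.nat 5 v = if IsInner L.toFinset s t v then 0 else 1
  list : Pre (m.nat 6) ((branchList L.toFinset s t).map Fin.val)
  top : ∀ v : Fin n, m.nat 7 v = climb L.toFinset s t v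

theorem Prepared.of_eq {L : List (Fin n × Fin n)} {s t : Fin n} {m m' : Mem}
    (h : Prepared L s t m) (hv : ∀ x ∈ [2, 3, 4, 5, 6, 18], m'.var x = m.var x)
    (hn : ∀ a ∈ [0, 3, 4, 5, 6, 7], m'.nat a = m.nat a) : Prepared L s t m' := by
  simp only [List.mem_cons, List.not_mem_nil, or_false, forall_eq_or_imp, forall_eq] at hv hn
  obtain ⟨v₂, v₃, v₄, v₅, v₆, v₁₈⟩ := hv
  obtain ⟨n₀, n₃, n₄, n₅, n₆, n₇⟩ := hn
  refine ⟨h.toHasGraph.of_eq v₂ v₁₈ n₀, ?_, ?_, ?_, ?_, ?_, ?_, ?_, ?_, ?_⟩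
  · rw [v₃, h.source]
  · rw [v₄, h.sink]
  · rw [v₅, h.count]
  · rw [v₆, h.total]
  · rw [n₃]; exact h.next
  · rw [n₄]; exact h.out
  · rw [n₅]; exact h.branch
  · rw [n₆]; exact h.list
  · rw [n₇]; exact h.top

/-- Analyse the graph. -/
def prepare : Prog :=
  block [readGraph, degrees, findEnds, markOut, listBranch, climbTable, power]

theorem countP_head {L : List (Fin n × Fin n)} (hL : L.Nodup) (v : Fin n) :
    (L.countP fun e => e.2 = v) = (Finset.univ.filter fun u => (u, v) ∈ L.toFinset).card := by
  rw [List.countP_eq_length_filter, ← List.toFinset_card_of_nodup (hL.filter _)]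
  refine Finset.card_bij (fun e _ => e.1) ?_ ?_ ?_
  · rintro ⟨a, b⟩ h
    simp only [List.mem_toFinset, List.mem_filter, decide_eq_true_eq] at h
    obtain ⟨h, rfl⟩ := h
    simpa using h
  · rintro ⟨a, b⟩ h ⟨c, d⟩ h' h''
    simp only [List.mem_toFinset, List.mem_filter, decide_eq_true_eq] at h h'
    rw [Prod.mk.injEq, h.2, h'.2]
    exact ⟨h'', rfl⟩
  · intro b hb
    exact ⟨(b, v), by simpa using hb, rfl⟩

theorem length_branchList_le (E : Finset (Fin n × Fin n)) (s t : Fin n) :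
    (branchList E s t).length ≤ n :=
  (List.length_filter_le _ _).trans (by simp)

/-- Variable `14` is going to be the flag of the search for "a schedule has been found"; the
analysis leaves it at zero. -/
theorem wp_prepare {L : List (Fin n × Fin n)} (hL : L.Nodup) {s t : Fin n}
    (hS : InTreeWithSource L.toFinset s t) (rs : List ℝ) :
    Wp prepare (Mem.ofInput (encodeGraph L) rs) fun m' τ => τ ≤ n ^ 2 * 1000 ∧
      Prepared L s t m' ∧ m'.real 0 = (Mem.ofInput (encodeGraph L) rs).real 0 ∧
      m'.var 14 = 0 := by
  set m₀ := Mem.ofInput (encodeGraph L) rs with hm₀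
  have hz : ∀ a, a ≠ 0 → ∀ i, m₀.nat a i = 0 := fun a ha i => by simp [hm₀, Mem.ofInput, ha]
  have hz14 : m₀.var 14 = 0 := by simp [hm₀, Mem.ofInput]
  have hlen : L.length ≤ 2 * n := by
    rw [← List.toFinset_card_of_nodup hL]
    exact hS.card_edges_le_two_mul
  have hmem : ∀ e, e ∈ L ↔ e ∈ L.toFinset := fun e => by simp
  set E := L.toFinset with hE
  unfold prepare
  rw [wp_block_cons]
  refine (wp_readGraph L rs).mono_frame ?_
  rintro m₁ t₁ hF₁ ⟨ht₁, hG₁⟩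
  rw [wp_block_cons]
  refine (wp_degrees hG₁ (fun i => by rw [hF₁.nat 1 (by decide), hz 1 (by decide)])
    (fun i => by rw [hF₁.nat 2 (by decide), hz 2 (by decide)])).mono_frame ?_
  rintro m₂ t₂ hF₂ ⟨ht₂, hin, hout, hnx⟩
  have hG₂ := hG₁.of_eq (hF₂.var 2 (by decide)) (hF₂.var 18 (by decide)) (hF₂.nat 0 (by decide))
  have hin' : ∀ v : Fin n, m₂.nat 1 v = (Finset.univ.filter fun u => (u, v) ∈ E).card := fun v => by
    rw [hin, countP_head hL]
  rw [wp_block_cons]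
  refine (wp_findEnds (s := s) (t := t) hG₂.nodes ?_ ?_).mono_frame ?_
  · intro v
    rw [hin', Finset.card_eq_zero, Finset.filter_eq_empty_iff]
    constructor
    · intro h
      by_contra hv
      obtain ⟨u, hu⟩ := hS.ex_in v hv
      exact h (Finset.mem_univ u) hu
    · rintro rfl u _
      exact hS.no_in u
  · intro v
    rw [hout, List.countP_eq_zero]
    constructor
    · intro h
      by_contra hv
      obtain ⟨u, hu⟩ := hS.ex_out v hv
      exact h _ ((hmem _).2 hu) (by simp)
    · rintro rfl ⟨a, b⟩ he
      simp only [decide_eq_true_eq]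
      rintro rfl
      exact hS.no_out b ((hmem _).1 he)
  rintro m₃ t₃ hF₃ ⟨ht₃, hs₃, hsink₃, hnt₃, hnx₃⟩
  have hG₃ := hG₂.of_eq (hF₃.var 2 (by decide)) (hF₃.var 18 (by decide)) (hF₃.nat 0 (by decide))
  have hnext : ∀ u, u ≠ s → m₃.nat 3 u = nxt E u := by
    intro u hu
    by_cases hut : u = t
    · subst hut
      rw [hnt₃, hS.nxt_sink]
    · rw [hnx₃ _ (by simpa [Fin.ext_iff] using hut)]
      obtain ⟨⟨a, b⟩, he, rfl, h⟩ := hnx u ⟨(u, nxt E u), (hmem _).2 (hS.nxt_mem hut), rfl⟩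
      rw [h, hS.eq_nxt hu ((hmem _).1 he)]
  rw [wp_block_cons]
  refine (wp_markOut hG₃ hs₃ (fun i => by
    rw [hF₃.nat 4 (by decide), hF₂.nat 4 (by decide), hF₁.nat 4 (by decide),
      hz 4 (by decide)])).mono_frame ?_
  rintro m₄ t₄ hF₄ ⟨ht₄, hmark⟩
  have hG₄ := hG₃.of_eq (hF₄.var 2 (by decide)) (hF₄.var 18 (by decide)) (hF₄.nat 0 (by decide))
  simp only [hmem] at hmark
  rw [wp_block_cons]
  refine (wp_listBranch (E := E) (s := s) (t := t) hG₄.nodes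
    (by rw [hF₄.var 4 (by decide), hsink₃])
    (fun v => by rw [hF₄.nat 1 (by decide), hF₃.nat 1 (by decide), hin']) hmark
    (fun i => by
      rw [hF₄.nat 5 (by decide), hF₃.nat 5 (by decide), hF₂.nat 5 (by decide),
        hF₁.nat 5 (by decide), hz 5 (by decide)])).mono_frame ?_
  rintro m₅ t₅ hF₅ ⟨ht₅, hcount, hbr, hlist⟩
  have hG₅ := hG₄.of_eq (hF₅.var 2 (by decide)) (hF₅.var 18 (by decide)) (hF₅.nat 0 (by decide))
  have hn5 : m₅.nat 3 = m₃.nat 3 := by rw [hF₅.nat 3 (by decide), hF₄.nat 3 (by decide)]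
  rw [wp_block_cons]
  refine (wp_climbTable (E := E) (s := s) (t := t) hG₅.nodes
    (fun v hv => by
      rw [hn5, hnext]
      rintro rfl
      exact hS.not_inner_source hv) hbr).mono_frame ?_
  rintro m₆ t₆ hF₆ ⟨ht₆, htop⟩
  have hG₆ := hG₅.of_eq (hF₆.var 2 (by decide)) (hF₆.var 18 (by decide)) (hF₆.nat 0 (by decide))
  rw [wp_block_singleton]
  refine (wp_power (k := (branchList E s t).length)
    (by rw [hF₆.var 5 (by decide), hcount])).mono_frame ?_
  rintro m₇ t₇ hF₇ ⟨ht₇, htot⟩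
  refine ⟨?_, ⟨hG₆.of_eq (hF₇.var 2 (by decide)) (hF₇.var 18 (by decide))
    (hF₇.nat 0 (by decide)), ?_, ?_, ?_, htot, ?_, ?_, ?_, ?_, ?_⟩, ?_, ?_⟩
  · have hk := length_branchList_le E s t
    set k := (branchList E s t).length
    have hn : 1 ≤ n := by have := s.isLt; omega
    have e₁ : k * (k * 20 + 40) ≤ n * (n * 20 + 40) := Nat.mul_le_mul hk (by omega)
    have e₂ : n ≤ n ^ 2 := by nlinarith
    nlinarith
  · rw [hF₇.var 3 (by decide), hF₆.var 3 (by decide), hF₅.var 3 (by decide),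
      hF₄.var 3 (by decide), hs₃]
  · rw [hF₇.var 4 (by decide), hF₆.var 4 (by decide), hF₅.var 4 (by decide),
      hF₄.var 4 (by decide), hsink₃]
  · rw [hF₇.var 5 (by decide), hF₆.var 5 (by decide), hcount]
  · intro u hu
    rw [hF₇.nat 3 (by decide), hF₆.nat 3 (by decide), hn5, hnext u hu]
  · intro v
    rw [hF₇.nat 4 (by decide), hF₆.nat 4 (by decide), hF₅.nat 4 (by decide), hmark v]
  · intro v
    rw [hF₇.nat 5 (by decide), hF₆.nat 5 (by decide), hbr v]
  · rw [hF₇.nat 6 (by decide), hF₆.nat 6 (by decide)]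
    exact hlist
  · intro v
    rw [hF₇.nat 7 (by decide), htop v]
  · rw [hF₇.real 0 (by decide), hF₆.real 0 (by decide), hF₅.real 0 (by decide),
      hF₄.real 0 (by decide), hF₃.real 0 (by decide), hF₂.real 0 (by decide),
      hF₁.real 0 (by decide)]
  · rw [hF₇.var 14 (by decide), hF₆.var 14 (by decide), hF₅.var 14 (by decide),
      hF₄.var 14 (by decide), hF₃.var 14 (by decide), hF₂.var 14 (by decide),
      hF₁.var 14 (by decide), hz14]

end RealRAM

/-! ### Enumerating the orders of the branch nodes -/

namespace RealRAM

open Prog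

variable {n : ℕ}

theorem Pre.map_val {g : ℕ → ℕ} {l : List (Fin n)} (h : Pre g (l.map Fin.val)) (i : ℕ)
    (hi : i < l.length) : g i = (l[i] : ℕ) := by
  have := h i (by simpa using hi)
  simpa using this

/-- The list of length `B.length` of elements of `B` whose positions in `B` are the digits of `c`
in base `B.length`. -/
def digitList (B : List (Fin n)) (s : Fin n) (c : ℕ) : List (Fin n) :=
  (List.range B.length).map fun i => B.getD (c / B.length ^ i % B.length) s

@[simp] theorem length_digitList (B : List (Fin n)) (s : Fin n) (c : ℕ) :
    (digitList B s c).length = B.length := by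
  simp [digitList]

theorem digitList_subset {B : List (Fin n)} {s : Fin n} {c : ℕ} : digitList B s c ⊆ B := by
  intro v hv
  obtain ⟨i, hi, rfl⟩ := List.mem_map.1 hv
  have : c / B.length ^ i % B.length < B.length := Nat.mod_lt _ (by simp at hi; omega)
  rw [List.getD_eq_getElem _ _ this]
  exact List.getElem_mem _

/-- Lists of length `k` over `B` correspond to numbers below `k ^ k` written in base `k`. Running
through all lists instead of permutations is simpler and remains within `2 ^ O(k log k)`. -/
theorem exists_digitList_eq {B l : List (Fin n)} (s : Fin n) (hl : l.length = B.length)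
    (hB : l ⊆ B) : ∃ c < B.length ^ B.length, digitList B s c = l := by
  let f : Fin B.length → Fin B.length := fun i =>
    ⟨B.idxOf (l[i]'(by rw [hl]; exact i.isLt)),
      List.idxOf_lt_length_iff.2 (hB (List.getElem_mem _))⟩
  refine ⟨finFunctionFinEquiv f, (finFunctionFinEquiv f).isLt, ?_⟩
  refine List.ext_getElem (by simp [hl]) fun i h₁ h₂ => ?_
  have hi : i < B.length := hl ▸ h₂
  have := finFunctionFinEquiv_symm_apply_val (finFunctionFinEquiv f) ⟨i, hi⟩
  rw [Equiv.symm_apply_apply] at this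
  simp only [digitList, List.getElem_map, List.getElem_range, ← this]
  simp [f, List.getElem?_idxOf (hB (List.getElem_mem h₂))]

/-- Write the list for the number in variable `7` to array `8`, followed by the number of nodes. -/
def decode : Prog := block [
  .setVar 10 (.var 7),
  for_ 8 (.var 5) (block [
    .setVar 11 (.const 0),
    .loop (.natLe (.var 5) (.var 10)) (block [
      .setVar 10 (.sub (.var 10) (.var 5)),
      .setVar 11 (.add (.var 11) (.const 1))]),
    .setNat 8 (.var 8) (.get 6 (.var 10)),
    .setVar 10 (.var 11)]),
  .setNat 8 (.var 5) (.var 2)]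

/-- Digits are split off by division with repeated subtraction, so the cost is proportional to the
bound `N`; with `N = k ^ k` this brings a second factor `k ^ k` into the running time. The sentinel
`n` behind the list later produces the edge to `pad`. -/
theorem wp_decode {m : Mem} {B : List (Fin n)} {s : Fin n} {c N : ℕ} (hc : c ≤ N)
    (h₂ : m.var 2 = n) (h₅ : m.var 5 = B.length) (h₆ : Pre (m.nat 6) (B.map Fin.val))
    (h₇ : m.var 7 = c) :
    Wp decode m fun m' τ => τ ≤ B.length * (N * 20 + 60) + 20 ∧
      Pre (m'.nat 8) ((digitList B s c).map Fin.val) ∧ m'.nat 8 B.length = n := by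
  set k := B.length with hk
  simp only [decode, wp_block_cons, wp_block_singleton, wp_setVar]
  refine (wp_for k (N * 20 + 40) (fun i m' => m'.var 10 = c / k ^ i ∧
    ∀ j < i, j < k → m'.nat 8 j = (B.getD (c / k ^ j % k) s : Fin n)) (by decide)
    ?_ ?_ ?_).mono_frame ?_
  · intro m' hF
    simp [hF.var 5 (by decide), h₅]
  · simp [h₇]
  · rintro i m' hi hF hx ⟨hI₁, hI₂⟩
    have hv₅ := hF.var 5 (by decide)
    have hn₆ := hF.nat 6 (by decide)
    have hkpos : 0 < k := by omega
    simp only [wp_block_cons, wp_block_singleton, wp_setVar]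
    set q := c / k ^ i with hq
    have hqN : q / k ≤ N := (Nat.div_le_self _ _).trans ((Nat.div_le_self _ _).trans hc)
    -- Subtracting `k` as long as possible leaves the remainder, the current digit, in variable `10`
    -- and the quotient in variable `11`.
    refine (wp_loop (q / k) 12 (fun j m'' => m''.var 11 = j ∧ m''.var 10 = q - j * k)
      ?_ ?_ ?_).mono_frame ?_
    · simp [hI₁]
    · intro j m'' hj hF' hJ
      have hv₅' := hF'.var 5 (by decide)
      simp only [Test.holds, NatExpr.eval, hJ.2, hv₅', Mem.setV_var, hv₅, h₅]
      simp only [Nat.reduceEqDiff, reduceIte]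
      rw [← Nat.succ_le_iff, Nat.le_div_iff_mul_le hkpos, Nat.succ_mul]
      have : j * k ≤ q := (Nat.mul_le_mul_right k hj).trans (Nat.div_mul_le_self q k)
      omega
    · intro j m'' hj hF' hJ
      have hv₅' := hF'.var 5 (by decide)
      simp [hJ.1, hJ.2, hv₅', hv₅, h₅]
      rw [Nat.succ_mul]
      omega
    · rintro m'' τ hF' ⟨hτ, hJ₁, hJ₂⟩
      have hv₈' := hF'.var 8 (by decide)
      have hn₆' := hF'.nat 6 (by decide)
      have hn₈' := hF'.nat 8 (by decide)
      have hmod : q - q / k * k = q % k := by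
        have := Nat.div_add_mod' q k
        omega
      rw [hmod] at hJ₂
      have hlt : q % k < k := Nat.mod_lt _ hkpos
      have hB := h₆ (q % k) (by simpa using hlt)
      simp [hJ₁, hJ₂, hv₈', hx, hn₆', hn₆, hn₈', hB]
      refine ⟨?_, ?_, fun j hj hjk => ?_⟩
      · simp at hτ
        have : q / k * 16 ≤ N * 16 := Nat.mul_le_mul_right _ hqN
        omega
      · rw [pow_succ, ← Nat.div_div_eq_div_mul]
      · by_cases h : j = i
        · subst h
          simp only [Function.update_self, ← hq, List.getElem?_eq_getElem (l := B) hlt,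
            Option.getD_some]
        · rw [Function.update_of_ne h, hI₂ j (by omega) hjk]
          simp [List.getD_eq_getElem?_getD]
  · rintro m' τ hF ⟨hτ, hI₁, hI₂⟩
    have hv₅ := hF.var 5 (by decide)
    have hv₂ := hF.var 2 (by decide)
    simp [hv₅, hv₂, h₅, h₂]
    refine ⟨?_, fun i hi => ?_⟩
    · simp only [NatExpr.cost] at hτ
      have : k * (9 + 1 + (N * 20 + 40)) ≤ k * (N * 20 + 60) := Nat.mul_le_mul_left _ (by omega)
      omega
    · have hi' : i < k := by simpa using hi
      rw [Function.update_of_ne (by omega), hI₂ i hi' hi']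
      simp [digitList, hk]

/-- Check in variable `12` whether the list in array `8` is a valid order. -/
def checkOrder : Prog := block [
  for_ 8 (.var 5) (.setNat 9 (.get 8 (.var 8)) (.var 8)),
  .setVar 12 (.const 1),
  for_ 8 (.var 5) (.ite (.natEq (.get 9 (.get 8 (.var 8))) (.var 8)) skip (.setVar 12 (.const 0))),
  for_ 8 (.var 18) (.ite
    (.and (.natLe (.const 1) (.get 5 (edgeTail 8)))
      (.natLe (.get 9 (.get 7 (edgeHead 8))) (.get 9 (edgeTail 8))))
    (.setVar 12 (.const 0)) skip)]

/-- A list of branch nodes of full length without repetition is already a permutation of them, so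
membership needs no test. -/
theorem validOrder_iff {E : Finset (Fin n × Fin n)} {s t : Fin n} {ord : List (Fin n)}
    (hsub : ord ⊆ branchList E s t) (hlen : ord.length = (branchList E s t).length) :
    ValidOrder E s t ord ↔ ord.Nodup ∧
      ∀ u v, (u, v) ∈ E → ¬ IsInner E s t u → ord.idxOf u < ord.idxOf (climb E s t v) := by
  refine ⟨fun h => ⟨h.nodup, h.lt⟩, fun ⟨h, h'⟩ => ⟨h, fun v => ?_, h'⟩⟩
  rw [← mem_branchList]
  exact ((h.subperm hsub).perm_of_length_le hlen.ge).mem_iff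

/-- Array `9` becomes the table of positions. A repeated node would have its entry overwritten, so
reading the table back detects repetitions. Entries left over from earlier lists are read only if a
repetition has already been detected. -/
theorem wp_checkOrder {L : List (Fin n × Fin n)} {s t : Fin n} {m : Mem}
    (hS : InTreeWithSource L.toFinset s t) (hP : Prepared L s t m) {ord : List (Fin n)}
    (hsub : ord ⊆ branchList L.toFinset s t)
    (hlen : ord.length = (branchList L.toFinset s t).length)
    (h₈ : Pre (m.nat 8) (ord.map Fin.val)) :
    Wp checkOrder m fun m' τ => τ ≤ ord.length * 100 + L.length * 100 + 100 ∧
      (m'.var 12 = 1 ↔ ValidOrder L.toFinset s t ord) := by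
  set E := L.toFinset with hE
  have hmem : ∀ e, e ∈ L ↔ e ∈ E := fun e => by simp [hE]
  have hord : ∀ i (h : i < ord.length), m.nat 8 i = (ord[i] : ℕ) := h₈.map_val
  have h₅ : m.var 5 = ord.length := hP.count.trans hlen.symm
  unfold checkOrder
  rw [wp_block_cons]
  refine (wp_for ord.length 10 (fun i m' => ord.Nodup →
      ∀ j (h : j < ord.length), j < i → m'.nat 9 ord[j] = j) (by decide) ?_ ?_ ?_).mono_frame ?_
  · intro m' hF
    simp [hF.var 5 (by decide), h₅]
  · simp
  · intro i m' hi hF hx hI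
    have hn₈ := hF.nat 8 (by decide)
    simp [hx, hn₈, hord i hi]
    intro hnd j hj hji
    by_cases h : j = i
    · subst h; simp
    · rw [Function.update_of_ne, hI hnd j hj (by omega)]
      rw [ne_eq, Fin.val_inj, hnd.getElem_inj_iff]
      exact h
  rintro m₁ t₁ hF₁ ⟨ht₁, hI₁⟩
  have hn₈ := hF₁.nat 8 (by decide)
  rw [wp_block_cons, wp_setVar, wp_block_cons]
  refine (wp_for ord.length 30 (fun i m' => m'.var 12 = 1 ↔
      ∀ j (h : j < ord.length), j < i → m₁.nat 9 ord[j] = j) (by decide) ?_ ?_ ?_).mono_frame ?_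
  · intro m' hF
    simp [hF.var 5 (by decide), hF₁.var 5 (by decide), h₅]
  · simp
  · intro i m' hi hF hx hI
    have hn₈' := hF.nat 8 (by decide)
    have hn₉' := hF.nat 9 (by decide)
    by_cases h : m₁.nat 9 ord[i] = i
    · simp [hx, hn₈', hn₈, hn₉', hord i hi, h, hI]
      constructor
      · intro h' j hj hji
        by_cases hji' : j = i
        · subst hji'; exact h
        · exact h' j hj (by omega)
      · intro h' j hj hji
        exact h' j hj (by omega)
    · simp [hx, hn₈', hn₈, hn₉', hord i hi, h]
      exact ⟨i, le_rfl, hi, h⟩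
  rintro m₂ t₂ hF₂ ⟨ht₂, hI₂⟩
  have hn₉ := hF₂.nat 9 (by decide)
  have hP₂ : Prepared L s t m₂ := hP.of_eq
    (by
      simp only [List.mem_cons, List.not_mem_nil, or_false, forall_eq_or_imp, forall_eq]
      refine ⟨?_, ?_, ?_, ?_, ?_, ?_⟩ <;> rw [hF₂.var _ (by decide), Mem.setV_var,
        if_neg (by decide), hF₁.var _ (by decide)])
    (by
      simp only [List.mem_cons, List.not_mem_nil, or_false, forall_eq_or_imp, forall_eq]
      refine ⟨?_, ?_, ?_, ?_, ?_, ?_⟩ <;> rw [hF₂.nat _ (by decide), Mem.setV_nat,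
        hF₁.nat _ (by decide)])
  rw [wp_block_singleton]
  refine (wp_for L.length 60 (fun i m' => m'.var 12 = 1 ↔ m₂.var 12 = 1 ∧
      ∀ e ∈ L.take i, ¬ IsInner E s t e.1 → m₂.nat 9 e.1 < m₂.nat 9 (climb E s t e.2))
      (by decide) ?_ ?_ ?_).mono ?_
  · intro m' hF
    simp [hF.var 18 (by decide), hP₂.edges]
  · simp
  · intro i m' hi hF hx hI
    have hG' := hP₂.toHasGraph.of_eq (hF.var 2 (by decide)) (hF.var 18 (by decide))
      (hF.nat 0 (by decide))
    have ht := hG'.tail i hi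
    have hh := hG'.head i hi
    have hn₅' := hF.nat 5 (by decide)
    have hn₇' := hF.nat 7 (by decide)
    have hn₉' := hF.nat 9 (by decide)
    rw [List.take_succ_eq_append_getElem hi]
    simp only [wp_ite, Test.holds, NatExpr.eval, eval_edgeTail, eval_edgeHead, hx, ht, hh, hn₅',
      hn₇', hn₉', hP₂.branch, hP₂.top, ← hE, wp_setVar, wp_skip, Mem.setV_var, Test.cost, NatExpr.cost,
      cost_edgeTail, cost_edgeHead, List.mem_append, List.mem_singleton, or_imp, forall_and,
      forall_eq]
    by_cases h : IsInner E s t L[i].1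
    · simp [h, hI]
    · by_cases h' : m₂.nat 9 (climb E s t L[i].2) ≤ m₂.nat 9 L[i].1
      · have : ¬ m₂.nat 9 L[i].1 < m₂.nat 9 (climb E s t L[i].2) := by omega
        simp [h, h']
      · have : m₂.nat 9 L[i].1 < m₂.nat 9 (climb E s t L[i].2) := by omega
        simp [h, this, hI]
  · rintro m' τ ⟨hτ, hI⟩
    simp only [NatExpr.cost] at hτ ht₁ ht₂ ⊢
    refine ⟨by omega, ?_⟩
    rw [List.take_length] at hI
    rw [hI, hI₂, validOrder_iff hsub hlen]
    -- If the table returns `j` at `ord[j]` for every `j`, equal entries have equal positions.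
    have hnodup : (∀ j (h : j < ord.length), j < ord.length → m₁.nat 9 ord[j] = j) ↔ ord.Nodup := by
      refine ⟨fun h => ?_, hI₁⟩
      rw [List.nodup_iff_injective_getElem]
      intro i j hij
      have h₁ := h i i.isLt i.isLt
      have h₂ := h j j.isLt j.isLt
      simp only at hij
      rw [hij, h₂] at h₁
      exact Fin.ext h₁.symm
    rw [hnodup]
    refine and_congr_right fun hnd => ?_
    have hpos : ∀ v, v ∈ ord → m₂.nat 9 v = ord.idxOf v := by
      intro v hv
      have hlt := List.idxOf_lt_length_iff.2 hv
      have := hI₁ hnd (ord.idxOf v) hlt hlt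
      rw [List.getElem_idxOf] at this
      rw [hn₉]
      exact this
    have hall : ∀ v, ¬ IsInner E s t v → v ∈ ord := fun v hv =>
      ((hnd.subperm hsub).perm_of_length_le hlen.ge).mem_iff.2 (mem_branchList.2 hv)
    constructor
    · intro h u v huv hu
      have := h (u, v) ((hmem _).2 huv) hu
      rwa [hpos _ (hall _ hu), hpos _ (hall _ (hS.not_inner_climb v))] at this
    · rintro h ⟨u, v⟩ huv hu
      have := h u v ((hmem _).1 huv) hu
      rwa [hpos _ (hall _ hu), hpos _ (hall _ (hS.not_inner_climb v))]

/-- Find the last out-neighbour of the source in the order in array `8`. -/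
def findLast : Prog := for_ 8 (.var 5)
  (.ite (.natLe (.const 1) (.get 4 (.get 8 (.var 8)))) (.setVar 17 (.get 8 (.var 8))) skip)

/-- Later hits overwrite earlier ones, and there is a hit because the source has an out-neighbour.
-/
theorem wp_findLast {E : Finset (Fin n × Fin n)} {s t : Fin n} {m : Mem}
    (hS : InTreeWithSource E s t) {ord : List (Fin n)} (ho : ValidOrder E s t ord)
    (h₄ : ∀ v : Fin n, m.nat 4 v = if (s, v) ∈ E then 1 else 0)
    (h₅ : m.var 5 = ord.length) (h₈ : Pre (m.nat 8) (ord.map Fin.val)) :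
    Wp findLast m fun m' τ => τ ≤ ord.length * 40 + 20 ∧
      ∃ x, IsLastOut E s ord x ∧ m'.var 17 = x := by
  have hord : ∀ i (h : i < ord.length), m.nat 8 i = (ord[i] : ℕ) := h₈.map_val
  refine (wp_for ord.length 30 (fun i m' =>
      (∃ y ∈ ord.take i, (s, y) ∈ E) → ∃ x, (s, x) ∈ E ∧ m'.var 17 = x ∧
        ∀ y ∈ ord.take i, (s, y) ∈ E → ord.idxOf y ≤ ord.idxOf x) (by decide) ?_ ?_ ?_).mono ?_
  · intro m' hF
    simp [hF.var 5 (by decide), h₅]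
  · simp
  · intro i m' hi hF hx hI
    have hn₄ := hF.nat 4 (by decide)
    have hn₈ := hF.nat 8 (by decide)
    by_cases h : (s, ord[i]) ∈ E
    · simp only [wp_ite, Test.holds, NatExpr.eval, hx, hn₄, hn₈, hord i hi, h₄, h, reduceIte,
        le_refl, wp_setVar, Test.cost, NatExpr.cost, Mem.setV_var]
      refine ⟨by norm_num, fun _ => ⟨ord[i], h, by simp, fun y hy _ => ?_⟩⟩
      rw [idxOf_getElem_of_nodup ho.nodup]
      have := (List.mem_take_iff_idxOf_lt (List.mem_of_mem_take hy)).1 hy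
      omega
    · simp only [wp_ite, Test.holds, NatExpr.eval, hx, hn₄, hn₈, hord i hi, h₄, h, reduceIte,
        wp_skip, Test.cost, NatExpr.cost, Mem.setV_var]
      rw [List.take_succ_eq_append_getElem hi]
      have hiff : ∀ y, (s, y) ∈ E → (y ∈ ord.take i ++ [ord[i]] ↔ y ∈ ord.take i) := by
        intro y hy
        rw [List.mem_append, List.mem_singleton, or_iff_left]
        rintro rfl
        exact h hy
      refine ⟨by norm_num, ?_⟩
      rintro ⟨y, hy, hsy⟩
      obtain ⟨x, hx₁, hx₂, hx₃⟩ := hI ⟨y, (hiff y hsy).1 hy, hsy⟩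
      exact ⟨x, hx₁, by simpa using hx₂, fun y hy hsy => hx₃ y ((hiff y hsy).1 hy) hsy⟩
  · rintro m' τ ⟨hτ, hI⟩
    simp only [NatExpr.cost] at hτ
    have hin : ∀ y, (s, y) ∈ E → y ∈ ord := fun y hy => (ho.mem_iff y).2 fun h => h.2.1 hy
    rw [List.take_length] at hI
    have hsx := hS.nxt_mem hS.ne
    obtain ⟨x, h₁, h₂, h₃⟩ := hI ⟨_, hin _ hsx, hsx⟩
    exact ⟨by omega, x, ⟨h₁, fun y hy => h₃ y (hin y hy) hy⟩, h₂⟩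

end RealRAM

/-! ### Building the caduceus and evaluating its schedules -/

namespace RealRAM

open Prog

variable {n : ℕ}

/-- Append an edge to the list in array `10`, whose length is in variable `13`. -/
def pushEdge (e₁ e₂ : NatExpr) : Prog := block [
  .setNat 10 (.var 13) e₁,
  .setNat 10 (.add (.var 13) (.const 1)) e₂,
  .setVar 13 (.add (.var 13) (.const 2))]

/-- Array `10` holds a graph with edge list `A`. -/
structure HoldsEdges (A : List (Fin n × Fin n)) (m : Mem) : Prop where
  length : m.var 13 = 2 * A.length + 1
  pre : Pre (m.nat 10) (encodeGraph A)

/-- The head is computed after the tail has been written, hence the modified memory in `he₂`. -/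
theorem wp_pushEdge {A : List (Fin n × Fin n)} {m : Mem} (hA : HoldsEdges A m) {e₁ e₂ : NatExpr}
    {e : Fin n × Fin n} (he₁ : e₁.eval m = e.1)
    (he₂ : e₂.eval (m.setN 10 (m.var 13) (e₁.eval m)) = e.2) :
    Wp (pushEdge e₁ e₂) m fun m' t =>
      t ≤ e₁.cost + e₂.cost + 15 ∧ HoldsEdges (A ++ [e]) m' := by
  simp only [pushEdge, wp_block_cons, wp_block_singleton, wp_setNat, wp_setVar, NatExpr.eval,
    he₂, Mem.setN_var]
  refine ⟨by simp only [NatExpr.cost]; omega, ?_, ?_⟩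
  · simp [hA.length]
    ring
  · rw [encodeGraph_append]
    simp only [Mem.setV_nat, Mem.setN_nat, reduceIte, he₁]
    have h₁ := hA.pre.push (e.1 : ℕ) (p := m.var 13) (by rw [hA.length, encodeGraph_length])
    have h₂ := h₁.push (e.2 : ℕ) (p := m.var 13 + 1) (by
      rw [hA.length, List.length_append, encodeGraph_length]; rfl)
    simpa using h₂

/-- Write the edges of the caduceus to array `10`. -/
def buildEdges : Prog := block [
  .setNat 10 (.const 0) (.add (.add (.var 2) (.var 2)) (.const 1)),
  .setVar 13 (.const 1),
  for_ 8 (.var 18) (.ite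
    (.and (.natLe (.const 1) (.get 5 (edgeTail 8))) (.natLe (.const 1) (.get 5 (edgeHead 8))))
    skip (pushEdge (edgeTail 8) (.add (.var 2) (edgeHead 8)))),
  for_ 8 (.var 2) (pushEdge (.add (.var 2) (.var 8)) (.var 8)),
  for_ 8 (.var 5) (pushEdge (.get 8 (.var 8))
    (.add (.var 2) (.get 8 (.add (.var 8) (.const 1)))))]

theorem length_staffEdges (l : List (Fin n)) : (staffEdges l).length = l.length := by
  simp [staffEdges]
  omega

/-- Thanks to the sentinel `n` after the order, the last edge leads to `n + n`, which is `pad`,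
without a special case. -/
theorem staffEdges_getElem {l : List (Fin n)} {i : ℕ} (hi : i < l.length) {g : ℕ → ℕ}
    (hg : Pre g (l.map Fin.val)) (hn : g l.length = n) :
    g i = ((staffEdges l)[i]'(by rw [length_staffEdges]; exact hi)).1 ∧
      n + g (i + 1) = ((staffEdges l)[i]'(by rw [length_staffEdges]; exact hi)).2 := by
  simp only [staffEdges, List.getElem_zip, List.getElem_map]
  refine ⟨hg.map_val i hi, ?_⟩
  rcases Nat.lt_or_ge (i + 1) l.length with h | h
  · rw [List.getElem_append_left (by simp; omega), hg.map_val _ h]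
    simp [inV]
  · have : i + 1 = l.length := by omega
    have hg' : g (i + 1) = n := by rw [this, hn]
    rw [List.getElem_append_right (by simp; omega), hg']
    simp [pad]
    ring

theorem wp_buildEdges {L : List (Fin n × Fin n)} {s t : Fin n} {m : Mem}
    (hP : Prepared L s t m) {ord : List (Fin n)} (h₅ : m.var 5 = ord.length)
    (h₈ : Pre (m.nat 8) (ord.map Fin.val)) (h₈' : m.nat 8 ord.length = n) :
    Wp buildEdges m fun m' τ => τ ≤ L.length * 100 + n * 100 + ord.length * 100 + 100 ∧
      HoldsEdges (caduceusEdges s t L ord) m' := by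
  simp only [buildEdges, wp_block_cons, wp_setNat, wp_setVar]
  refine (wp_for L.length 60 (fun i m' =>
      HoldsEdges (n := 2 * n + 1) (((L.take i).filter fun e =>
        IsInner L.toFinset s t e.1 ∨ IsInner L.toFinset s t e.2).map
          fun e => (outV e.1, inV e.2)) m') (by decide) ?_ ?_ ?_).mono_frame ?_
  · intro m' hF
    simp [hF.var 18 (by decide), hP.edges]
  · constructor
    · simp
    · intro i hi
      simp [encodeGraph] at hi
      subst hi
      simp [encodeGraph, hP.nodes]
      ring
  · intro i m' hi hF hx hI
    have hG' := hP.toHasGraph.of_eq (m' := m') (by rw [hF.var 2 (by decide)]; simp)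
      (by rw [hF.var 18 (by decide)]; simp) (by rw [hF.nat 0 (by decide)]; simp)
    have ht := hG'.tail i hi
    have hh := hG'.head i hi
    have hn₅' : m'.nat 5 = m.nat 5 := by rw [hF.nat 5 (by decide)]; simp
    rw [List.take_succ_eq_append_getElem hi, List.filter_append, List.map_append]
    have hcost : (NatExpr.add (NatExpr.var 2) (edgeHead 8)).cost = 8 := rfl
    simp only [wp_ite, Test.holds, NatExpr.eval, eval_edgeTail, eval_edgeHead, hx, ht, hh, hn₅',
      hP.branch]
    by_cases h : IsInner L.toFinset s t L[i].1 ∨ IsInner L.toFinset s t L[i].2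
    · rw [if_neg (by rcases h with h | h <;> simp [h])]
      refine (wp_pushEdge hI (e := (outV L[i].1, inV L[i].2)) ?_ ?_).mono ?_
      · simp only [eval_edgeTail, hx, ht]; rfl
      · simp only [NatExpr.eval, eval_edgeHead, Mem.setN_var, Mem.setN_nat, hx, hG'.nodes]
        simp [hh, inV]
      · rintro m'' τ ⟨hτ, hJ⟩
        refine ⟨?_, ?_⟩
        · simp only [hcost, cost_edgeTail] at hτ
          simp only [Test.cost, NatExpr.cost, cost_edgeTail, cost_edgeHead]
          omega
        · rw [List.filter_singleton]
          simp only [h, decide_true, cond_true, List.map_cons, List.map_nil]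
          exact ⟨by simpa using hJ.length, hJ.pre⟩
    · have h' := not_or.1 h
      rw [if_pos (by simp [h'.1, h'.2])]
      rw [wp_skip]
      refine ⟨?_, ?_⟩
      · simp only [Test.cost, NatExpr.cost, cost_edgeTail, cost_edgeHead]
        omega
      · rw [List.filter_singleton]
        simp only [h, decide_false, cond_false, List.map_nil, List.append_nil]
        exact ⟨by simpa using hI.length, hI.pre⟩
  rintro m₁ t₁ hF₁ ⟨ht₁, hI₁⟩
  rw [List.take_length] at hI₁
  have h₁2 : m₁.var 2 = n := by rw [hF₁.var 2 (by decide)]; simp [hP.nodes]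
  refine (wp_for n 40 (fun i m' =>
      HoldsEdges (bendEdges s t L ++ ((List.finRange n).take i).map fun v => (inV v, outV v)) m')
      (by decide) ?_ ?_ ?_).mono_frame ?_
  · intro m' hF
    simp [hF.var 2 (by decide), h₁2]
  · simp only [List.take_zero, List.map_nil, List.append_nil]
    exact ⟨by simpa [bendEdges] using hI₁.length, hI₁.pre⟩
  · intro i m' hi hF hx hI
    have hv₂ := hF.var 2 (by decide)
    rw [take_finRange_succ hi, List.map_append, ← List.append_assoc]
    refine (wp_pushEdge hI (e := (inV ⟨i, hi⟩, outV ⟨i, hi⟩)) ?_ ?_).mono ?_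
    · simp [hx, hv₂, h₁2, inV]
    · simp [hx, outV]
    · rintro m'' τ ⟨hτ, hJ⟩
      simp only [NatExpr.cost] at hτ
      exact ⟨by omega, by simpa using hJ.length, hJ.pre⟩
  rintro m₂ t₂ hF₂ ⟨ht₂, hI₂⟩
  rw [List.take_of_length_le (by simp)] at hI₂
  have h₂2 : m₂.var 2 = n := by rw [hF₂.var 2 (by decide), h₁2]
  have h₂5 : m₂.var 5 = ord.length := by
    rw [hF₂.var 5 (by decide), hF₁.var 5 (by decide)]; simp [h₅]
  have h₂8 : m₂.nat 8 = m.nat 8 := by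
    rw [hF₂.nat 8 (by decide), hF₁.nat 8 (by decide)]; simp
  rw [wp_block_singleton]
  refine (wp_for ord.length 40 (fun i m' =>
      HoldsEdges (bendEdges s t L ++ nodeEdges n ++ (staffEdges ord).take i) m')
      (by decide) ?_ ?_ ?_).mono ?_
  · intro m' hF
    simp [hF.var 5 (by decide), h₂5]
  · simp only [List.take_zero, List.append_nil]
    exact ⟨by simpa [nodeEdges] using hI₂.length, hI₂.pre⟩
  · intro i m' hi hF hx hI
    have hv₂ := hF.var 2 (by decide)
    have hn₈ := hF.nat 8 (by decide)
    have hst := staffEdges_getElem hi h₈ h₈'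
    have hi' : i < (staffEdges ord).length := by rw [length_staffEdges]; exact hi
    rw [List.take_succ_eq_append_getElem hi', ← List.append_assoc]
    refine (wp_pushEdge hI (e := (staffEdges ord)[i]) ?_ ?_).mono ?_
    · simp [hx, hn₈, h₂8, hst.1]
    · simp [hx, hn₈, h₂8, hv₂, h₂2, hst.2]
    · rintro m'' τ ⟨hτ, hJ⟩
      simp only [NatExpr.cost] at hτ
      exact ⟨by omega, by simpa using hJ.length, hJ.pre⟩
  · rintro m₃ t₃ ⟨ht₃, hI₃⟩
    rw [List.take_of_length_le (by rw [length_staffEdges])] at hI₃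
    simp only [NatExpr.cost] at ht₁ ht₂ ht₃ ⊢
    exact ⟨by omega, hI₃⟩

/-- The sizes are in the real array `0`. -/
structure HasSizes (G : ComputationGraph (Fin n)) (m : Mem) : Prop where
  size : ∀ v : Fin n, m.real 0 v = G.size v
  scratch : ∀ v : Fin n, m.real 0 (n + v) = G.scratch v

/-- Write the weights of the caduceus to the real array `1`. -/
def buildWeights : Prog := block [
  for_ 8 (.var 2) (block [
    .setReal 1 (.var 8) (.sub (.const 0) (.get 0 (.add (.var 2) (.var 8)))),
    .setReal 1 (.add (.var 2) (.var 8))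
      (.add (.get 0 (.var 8)) (.get 0 (.add (.var 2) (.var 8))))]),
  .setReal 1 (.add (.var 2) (.var 2)) (.const 0),
  for_ 8 (.var 2) (block [
    .ite (.natEq (.var 8) (.var 3)) (.setVar 10 (.var 17)) (.setVar 10 (.get 3 (.var 8))),
    .setReal 1 (.var 10) (.sub (.get 1 (.var 10)) (.get 0 (.var 8)))])]

theorem wp_buildWeights {L : List (Fin n × Fin n)} {s t x : Fin n} {m : Mem}
    (hP : Prepared L s t m) {G : ComputationGraph (Fin n)} (hL : L.toFinset = G.edges)
    (hG : HasSizes G m) (hx : m.var 17 = x) :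
    Wp buildWeights m fun m' τ => τ ≤ n * 100 + 100 ∧
      IsWeight G s x fun y => m'.real 1 y := by
  simp only [buildWeights, wp_block_cons]
  refine (wp_for n 40 (fun i m' => ∀ v : Fin n, (v : ℕ) < i →
      m'.real 1 v = -G.scratch v ∧ m'.real 1 (n + v) = G.size v + G.scratch v)
      (by decide) ?_ ?_ ?_).mono_frame ?_
  · intro m' hF
    simp [hF.var 2 (by decide), hP.nodes]
  · simp
  · intro i m' hi hF hx' hI
    have hv₂ := hF.var 2 (by decide)
    have hr₀ := hF.real 0 (by decide)
    have hs := hG.size ⟨i, hi⟩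
    have hsc := hG.scratch ⟨i, hi⟩
    simp only at hs hsc
    simp [hx', hv₂, hP.nodes, hr₀, hs, hsc]
    intro v hv
    by_cases h : (v : ℕ) = i
    · have hv' : v = ⟨i, hi⟩ := Fin.ext h
      subst hv'
      rw [Function.update_of_ne (by simp; omega)]
      simp
    · have hlt := v.isLt
      rw [Function.update_of_ne (by omega), Function.update_of_ne h,
        Function.update_of_ne (by omega), Function.update_of_ne (by omega)]
      exact hI v (by omega)
  rintro m₁ t₁ hF₁ ⟨ht₁, hI₁⟩
  have h₁2 : m₁.var 2 = n := by rw [hF₁.var 2 (by decide), hP.nodes]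
  rw [wp_setReal, wp_block_singleton]
  -- After `i` rounds, the outputs of the nodes below `i` have been subtracted at their releasers.
  refine (wp_for n 40 (fun i m' =>
      (∀ v : Fin n, m'.real 1 v = -G.scratch v -
        ∑ u : Fin n, if (u : ℕ) < i ∧ releaser G.edges s x u = v then G.size u else 0) ∧
      (∀ v : Fin n, m'.real 1 (n + v) = G.size v + G.scratch v) ∧ m'.real 1 (n + n) = 0)
      (by decide) ?_ ?_ ?_).mono ?_
  · intro m' hF
    simp [hF.var 2 (by decide), h₁2]
  · simp [h₁2]
    refine ⟨fun v => ?_, fun v => ?_⟩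
    · rw [Function.update_of_ne (by omega), (hI₁ v v.isLt).1]
    · rw [Function.update_of_ne (by omega), (hI₁ v v.isLt).2]
  · rintro i m' hi hF hx' ⟨hI, hI', hI''⟩
    have hr₀ : m'.real 0 = m.real 0 := by
      rw [hF.real 0 (by decide)]
      simp [hF₁.real 0 (by decide)]
    have hv₃ : m'.var 3 = s := by
      rw [hF.var 3 (by decide)]
      simp [hF₁.var 3 (by decide), hP.source]
    have hv₁₇ : m'.var 17 = x := by
      rw [hF.var 17 (by decide)]
      simp [hF₁.var 17 (by decide), hx]
    have hn₃ : m'.nat 3 = m.nat 3 := by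
      rw [hF.nat 3 (by decide)]
      simp [hF₁.nat 3 (by decide)]
    have hs := hG.size ⟨i, hi⟩
    simp only at hs
    -- The effect of one round, for any value `y` of the releaser; the source and the other nodes
    -- differ only in how `y` is found.
    have hupd : ∀ y : Fin n, releaser G.edges s x ⟨i, hi⟩ = y →
        (∀ v : Fin n, Function.update (m'.real 1) y (m'.real 1 y - G.size ⟨i, hi⟩) v =
          -G.scratch v - ∑ u : Fin n,
            if (u : ℕ) ≤ i ∧ releaser G.edges s x u = v then G.size u else 0) ∧
        (∀ v : Fin n, Function.update (m'.real 1) y (m'.real 1 y - G.size ⟨i, hi⟩) (n + v) =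
          G.size v + G.scratch v) ∧
        Function.update (m'.real 1) y (m'.real 1 y - G.size ⟨i, hi⟩) (n + n) = 0 := by
      intro y hy
      refine ⟨fun v => ?_, fun v => ?_, ?_⟩
      · have hsum : (∑ u : Fin n, if (u : ℕ) ≤ i ∧ releaser G.edges s x u = v
            then G.size u else 0) = (∑ u : Fin n, if (u : ℕ) < i ∧ releaser G.edges s x u = v
            then G.size u else 0) + if y = v then G.size ⟨i, hi⟩ else 0 := by
          have : (if y = v then G.size ⟨i, hi⟩ else 0) = ∑ u : Fin n, if u = ⟨i, hi⟩ then
              (if y = v then G.size ⟨i, hi⟩ else 0) else 0 := by simp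
          rw [this, ← Finset.sum_add_distrib]
          refine Finset.sum_congr rfl fun u _ => ?_
          by_cases hu : u = ⟨i, hi⟩
          · subst hu; simp [hy]
          · have hu' : (u : ℕ) ≠ i := by simpa [Fin.ext_iff] using hu
            have hu'' : (u : ℕ) < i ↔ (u : ℕ) ≤ i := by omega
            simp only [hu, hu'', if_false, add_zero]
        rw [hsum]
        by_cases hv : v = y
        · subst hv
          rw [Function.update_self, hI]
          simp
          ring
        · rw [Function.update_of_ne (by simpa [Fin.ext_iff] using hv), hI, if_neg (Ne.symm hv)]
          ring
      · rw [Function.update_of_ne (by omega), hI']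
      · rw [Function.update_of_ne (by omega), hI'']
    by_cases h : i = s
    · have hrel : releaser G.edges s x ⟨i, hi⟩ = x := by
        rw [releaser, if_pos (Fin.ext h)]
      simp only [wp_block_cons, wp_block_singleton, wp_ite, Test.holds_natEq, NatExpr.eval, hx', hv₃,
        h, reduceIte, wp_setVar, wp_setReal, Mem.setV_var]
      subst h
      simp [hx', hv₁₇, hr₀, hs]
      exact hupd x hrel
    · have hne : (⟨i, hi⟩ : Fin n) ≠ s := fun h' => h (congrArg Fin.val h')
      have hrel : releaser G.edges s x ⟨i, hi⟩ = nxt G.edges ⟨i, hi⟩ := by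
        rw [releaser, if_neg hne]
      have hnx := hP.next ⟨i, hi⟩ hne
      rw [hL] at hnx
      simp only at hnx
      simp only [wp_block_cons, wp_block_singleton, wp_ite, Test.holds_natEq, NatExpr.eval, hx', hv₃,
        h, reduceIte, wp_setVar, wp_setReal, Mem.setV_var]
      simp [hx', hn₃, hr₀, hs, hnx]
      exact hupd _ hrel
  · rintro m₂ t₂ ⟨ht₂, hI₂, hI₂', hI₂''⟩
    simp only [NatExpr.cost, RealExpr.cost] at ht₁ ht₂ ⊢
    refine ⟨by omega, ?_, ?_, ?_⟩
    · exact fun v => hI₂' v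
    · intro v
      have := hI₂ v
      simp only [Fin.is_lt, true_and] at this
      exact this
    · have : ((pad : Fin (2 * n + 1)) : ℕ) = n + n := two_mul n
      rw [this]
      exact hI₂''

/-- The number of nodes of the caduceus. -/
def caduceusSize : NatExpr := .add (.add (.var 2) (.var 2)) (.const 1)

theorem eval_caduceusSize (m : Mem) : caduceusSize.eval m = m.var 2 + m.var 2 + 1 := rfl

@[simp] theorem cost_caduceusSize : caduceusSize.cost = 5 := rfl

/-- Compute the peak of the schedule in array `11`. -/
def evaluate : Prog := block [
  .setReal 2 (.const 0) (.const 0),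
  .setReal 2 (.const 1) (.const 0),
  for_ 8 caduceusSize (block [
    .setReal 2 (.const 0) (.add (.get 2 (.const 0)) (.get 1 (.get 11 (.var 8)))),
    .ite (.realLe (.get 2 (.const 1)) (.get 2 (.const 0)))
      (.setReal 2 (.const 1) (.get 2 (.const 0))) skip])]

/-- A running sum and its maximum. Entry `2` of the same array holds the best peak of the search, so
the frame rule does not cover it and its preservation is stated separately. -/
theorem wp_evaluate {m : Mem} (h₂ : m.var 2 = n) {τ : List (Fin (2 * n + 1))} (hτ : τ.Nodup)
    (hlen : τ.length = 2 * n + 1) (h₁₁ : Pre (m.nat 11) (τ.map Fin.val)) :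
    Wp evaluate m fun m' t => t ≤ (2 * n + 1) * 50 + 50 ∧
      m'.real 2 1 ∈ nodeSumProfile (fun y : Fin (2 * n + 1) => m.real 1 y) τ ∧
      (∀ y ∈ nodeSumProfile (fun y : Fin (2 * n + 1) => m.real 1 y) τ, y ≤ m'.real 2 1) ∧
      m'.real 2 2 = m.real 2 2 := by
  set S : ℕ → ℝ := fun q => ∑ y ∈ (τ.take q).toFinset, m.real 1 y with hS
  have hS0 : S 0 = 0 := by simp [hS]
  have hSs : ∀ i (hi : i < τ.length), S (i + 1) = S i + m.real 1 τ[i] := by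
    intro i hi
    have hni : τ[i] ∉ (τ.take i).toFinset := by
      rw [List.mem_toFinset, List.mem_take_iff_idxOf_lt (List.getElem_mem _),
        idxOf_getElem_of_nodup hτ]
      omega
    simp only [hS]
    rw [List.take_succ_eq_append_getElem hi, List.toFinset_append, Finset.union_comm]
    simp only [List.toFinset_cons, List.toFinset_nil, insert_empty_eq, Finset.singleton_union]
    rw [Finset.sum_insert hni]
    ring
  simp only [evaluate, wp_block_cons, wp_setReal]
  rw [wp_block_singleton]
  refine (wp_for (2 * n + 1) 30 (fun i m' => m'.real 2 0 = S i ∧ (∀ q ≤ i, S q ≤ m'.real 2 1) ∧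
      m'.real 2 2 = m.real 2 2 ∧ ∃ q ≤ i, m'.real 2 1 = S q) (by decide) ?_ ?_ ?_).mono ?_
  · intro m' hF
    simp [eval_caduceusSize, hF.var 2 (by decide), h₂]
    ring
  -- The maximum may start at `0`, since the profile begins with the empty sum.
  · simp [hS0]
  · rintro i m' hi hF hx ⟨hI, hI', hr, q, hq, hI''⟩
    have hr₁ : m'.real 1 = m.real 1 := by rw [hF.real 1 (by decide)]; simp
    have hn₁₁ : m'.nat 11 = m.nat 11 := by rw [hF.nat 11 (by decide)]; simp
    have hv : m.nat 11 i = (τ[i] : ℕ) := h₁₁.map_val i (by omega)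
    have hs := hSs i (by omega)
    by_cases h : m'.real 2 1 ≤ S (i + 1)
    · simp [hx, hI, hr₁, hn₁₁, hv, ← hs, h]
      refine ⟨fun q hq => ?_, hr, i + 1, le_rfl, rfl⟩
      rcases Nat.lt_or_ge q (i + 1) with h' | h'
      · exact (hI' q (by omega)).trans h
      · rw [show q = i + 1 by omega]
    · simp [hx, hI, hr₁, hn₁₁, hv, ← hs, h]
      refine ⟨fun q hq => ?_, hr, q, by omega, hI''⟩
      rcases Nat.lt_or_ge q (i + 1) with h' | h'
      · exact hI' q (by omega)
      · rw [show q = i + 1 by omega]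
        exact (not_le.1 h).le
  · rintro m' t ⟨ht, -, hI', hr, q, hq, hI''⟩
    simp only [NatExpr.cost, RealExpr.cost, cost_caduceusSize] at ht ⊢
    refine ⟨by omega, ?_, fun y hy => ?_, hr⟩
    · exact mem_nodeSumProfile.2 ⟨q, by omega, hI''⟩
    · obtain ⟨q, hq, rfl⟩ := mem_nodeSumProfile.1 hy
      exact hI' q (by omega)

/-- Keep the schedule in array `11` if it is the first or its peak is at most the best so far. -/
def keepBest : Prog :=
  .ite (.and (.natLe (.const 1) (.var 14)) (.not (.realLe (.get 2 (.const 1)) (.get 2 (.const 2)))))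
    skip
    (block [
      .setReal 2 (.const 2) (.get 2 (.const 1)),
      .setVar 14 (.const 1),
      for_ 8 caduceusSize (.setNat 12 (.var 8) (.get 11 (.var 8)))])

theorem wp_keepBest {m : Mem} (h₂ : m.var 2 = n) {τ : List (Fin (2 * n + 1))}
    (hlen : τ.length = 2 * n + 1) (h₁₁ : Pre (m.nat 11) (τ.map Fin.val)) :
    Wp keepBest m fun m' t => t ≤ (2 * n + 1) * 30 + 50 ∧
      ((m.var 14 ≠ 0 ∧ m.real 2 2 < m.real 2 1 ∧ m' = m) ∨
        ((m.var 14 ≠ 0 → m.real 2 1 ≤ m.real 2 2) ∧ m'.var 14 = 1 ∧ m'.real 2 2 = m.real 2 1 ∧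
          Pre (m'.nat 12) (τ.map Fin.val))) := by
  simp only [keepBest, wp_ite, Test.holds, NatExpr.eval, RealExpr.eval, wp_skip]
  by_cases h : 1 ≤ m.var 14 ∧ ¬ m.real 2 1 ≤ m.real 2 2
  · rw [if_pos h]
    exact ⟨by simp, Or.inl ⟨by omega, not_le.1 h.2, trivial⟩⟩
  · rw [if_neg h]
    simp only [wp_block_cons, wp_block_singleton, wp_setReal, wp_setVar]
    refine (wp_for (2 * n + 1) 10 (fun i m' => ∀ j < i, m'.nat 12 j = m.nat 11 j)
      (by decide) ?_ ?_ ?_).mono_frame ?_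
    · intro m' hF
      simp [eval_caduceusSize, hF.var 2 (by decide), h₂]
      ring
    · simp
    · intro i m' hi hF hx hI
      have hn₁₁ := hF.nat 11 (by decide)
      simp [hx, hn₁₁]
      intro j hj
      by_cases h' : j = i
      · subst h'; simp
      · rw [Function.update_of_ne h', hI j (by omega)]
    · rintro m' t hF ⟨ht, hI⟩
      simp only [NatExpr.cost, RealExpr.cost, Test.cost, cost_caduceusSize] at ht ⊢
      refine ⟨by omega, Or.inr ⟨fun h' => ?_, ?_, ?_, fun i hi => ?_⟩⟩
      · by_contra h''
        exact h ⟨by omega, h''⟩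
      · rw [hF.var 14 (by decide)]; simp
      · rw [hF.real 2 (by decide)]; simp
      · rw [hI i (by simpa [hlen] using hi), h₁₁ i hi]

end RealRAM

/-! ### The search over all orders of the branch nodes -/

namespace RealRAM

open Prog

variable {n : ℕ}

/-- Find a schedule for the order of the branch nodes in array `8`, by a call of the program `P` for
caduceus graphs, and keep it if it is the best so far. -/
def tryOrder (P : Prog) : Prog :=
  block [findLast, buildEdges, buildWeights, .call P 10 (.var 13) 1 caduceusSize 11, evaluate,
    keepBest]

/-- The schedule `τ` of a caduceus gives a schedule of the computation graph with peak at most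
`b`. -/
structure Achieves (G : ComputationGraph (Fin n)) (τ : List (Fin (2 * n + 1))) (b : ℝ) : Prop where
  length : τ.length = 2 * n + 1
  isSchedule : IsSchedule G.edges (contract τ)
  le : ∀ z ∈ G.profile (contract τ), z ≤ b

/-- All schedules with the given order of the branch nodes have peak at least `b`. -/
def IsLowerBound (G : ComputationGraph (Fin n)) (s t : Fin n) (ord : List (Fin n)) (b : ℝ) : Prop :=
  ∀ σ, IsSchedule G.edges σ → branchOrder G.edges s t σ = ord → ∃ z ∈ G.profile σ, b ≤ z

theorem IsLowerBound.anti {G : ComputationGraph (Fin n)} {s t : Fin n} {ord : List (Fin n)}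
    {b b' : ℝ} (h : IsLowerBound G s t ord b) (hb : b' ≤ b) : IsLowerBound G s t ord b' :=
  fun σ hσ ho => let ⟨z, hz, hbz⟩ := h σ hσ ho; ⟨z, hz, hb.trans hbz⟩

theorem Prepared.frame {L : List (Fin n × Fin n)} {s t : Fin n} {m m' : Mem} {p : Prog}
    (h : Prepared L s t m) (hF : Frame p m m') (hv : ∀ x ∈ [2, 3, 4, 5, 6, 18], x ∉ p.wv)
    (hn : ∀ a ∈ [0, 3, 4, 5, 6, 7], a ∉ p.wn) : Prepared L s t m' :=
  h.of_eq (fun x hx => hF.var x (hv x hx)) fun a ha => hF.nat a (hn a ha)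

theorem HasSizes.of_eq {G : ComputationGraph (Fin n)} {m m' : Mem} (h : HasSizes G m)
    (hr : m'.real 0 = m.real 0) : HasSizes G m' :=
  ⟨by rw [hr]; exact h.size, by rw [hr]; exact h.scratch⟩

/-- Here `b` is the peak of the schedule returned by `P`. By `dominant_caduceus` it bounds the
contracted schedule from above and all schedules with this branch order from below, so comparing the
values `b` replaces evaluating schedules of the computation graph. -/
theorem wp_tryOrder {P : Prog} {f : ℕ → ℕ} (hP : SolvesCaduceus P f)
    {G : ComputationGraph (Fin n)} {L : List (Fin n × Fin n)} (hL : L.toFinset = G.edges)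
    (hnd : L.Nodup) {s t : Fin n} (hS : InTreeWithSource G.edges s t) {ord : List (Fin n)}
    (ho : ValidOrder G.edges s t ord) {m : Mem} (hm : Prepared L s t m) (hG : HasSizes G m)
    (h₅ : m.var 5 = ord.length) (h₈ : Pre (m.nat 8) (ord.map Fin.val))
    (h₈' : m.nat 8 ord.length = n) :
    Wp (tryOrder P) m fun m' τ =>
      τ ≤ L.length * 200 + n * 700 + ord.length * 200 + 1000 + f (2 * n + 1) ∧
      ∃ σ b, Achieves G σ b ∧ IsLowerBound G s t ord b ∧
        ((m.var 14 ≠ 0 ∧ m.real 2 2 < b ∧ m'.var 14 = m.var 14 ∧ m'.real 2 2 = m.real 2 2 ∧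
            m'.nat 12 = m.nat 12) ∨
          ((m.var 14 ≠ 0 → b ≤ m.real 2 2) ∧ m'.var 14 = 1 ∧ m'.real 2 2 = b ∧
            Pre (m'.nat 12) (σ.map Fin.val))) := by
  have hlen : (caduceusEdges s t L ord).length ≤ L.length + n + ord.length := by
    simp only [caduceusEdges, List.length_append, length_staffEdges]
    have : (bendEdges s t L).length ≤ L.length := by
      simpa [bendEdges] using List.length_filter_le _ _
    simp [nodeEdges]
    exact this
  rw [← hL] at hS ho
  rw [tryOrder, wp_block_cons]
  refine (wp_findLast hS ho hm.out h₅ h₈).mono_frame ?_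
  rintro m₁ t₁ hF₁ ⟨ht₁, x, hx, h₁₇⟩
  have hm₁ := hm.frame hF₁ (by decide) (by decide)
  have hG₁ := hG.of_eq (hF₁.real 0 (by decide))
  have e₅ := (hF₁.var 5 (by decide)).trans h₅
  have e₈ := hF₁.nat 8 (by decide)
  rw [wp_block_cons]
  refine (wp_buildEdges hm₁ e₅ (by rw [e₈]; exact h₈) (by rw [e₈]; exact h₈')).mono_frame ?_
  rintro m₂ t₂ hF₂ ⟨ht₂, hE⟩
  have hm₂ := hm₁.frame hF₂ (by decide) (by decide)
  have hG₂ := hG₁.of_eq (hF₂.real 0 (by decide))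
  rw [wp_block_cons]
  refine (wp_buildWeights hm₂ hL hG₂ ((hF₂.var 17 (by decide)).trans h₁₇)).mono_frame ?_
  rintro m₃ t₃ hF₃ ⟨ht₃, hw⟩
  have h₂ : m₃.var 2 = n := (hF₃.var 2 (by decide)).trans hm₂.nodes
  have h₁₃ : m₃.var 13 = (encodeGraph (caduceusEdges s t L ord)).length := by
    rw [hF₃.var 13 (by decide), hE.length, encodeGraph_length]
  have h₁₀ : Pre (m₃.nat 10) (encodeGraph (caduceusEdges s t L ord)) := by
    rw [hF₃.nat 10 (by decide)]; exact hE.pre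
  have hsz : caduceusSize.eval m₃ = 2 * n + 1 := by rw [eval_caduceusSize, h₂]; ring
  -- The assumption on `P`, applied to the caduceus of this order with the weights in memory.
  obtain ⟨σ, t₄, hcomp, hdom, ht₄⟩ := hP (2 * n + 1) _ (fun y => m₃.real 1 y)
    (isCaduceus_caduceusEdges hS ho) _ (nodup_caduceusEdges hnd ho) rfl
  have hσ : σ.length = 2 * n + 1 := by
    have := List.toFinset_card_of_nodup hdom.1.1
    rw [← this, Finset.eq_univ_of_forall fun v => List.mem_toFinset.2 (hdom.1.2.1 v)]
    simp
  rw [wp_block_cons]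
  refine Wp.call (out := σ.map Fin.val) (t := t₄) ?_ ?_
  · have hr : (List.range (2 * n + 1)).map (m₃.real 1) =
        List.ofFn fun y : Fin (2 * n + 1) => m₃.real 1 y :=
      List.ext_getElem (by simp) fun i h₁ h₂ => by rw [List.getElem_ofFn]; simp
    rw [hsz, hr, NatExpr.eval, h₁₀.map_range h₁₃]
    exact hcomp
  have hpre : Pre ((m₃.write 11 (σ.map Fin.val)).nat 11) (σ.map Fin.val) := by
    intro i hi
    simp only [Mem.write, Function.update_self, if_pos hi]
    rw [List.getD_eq_getElem _ _ hi]
  rw [wp_block_cons]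
  refine (wp_evaluate (m := m₃.write 11 (σ.map Fin.val)) h₂ hdom.1.1 hσ hpre).mono_frame ?_
  rintro m₅ t₅ hF₅ ⟨ht₅, hb, hub, hr₂⟩
  rw [wp_block_singleton]
  refine (wp_keepBest ((hF₅.var 2 (by decide)).trans h₂) hσ
    (by rw [hF₅.nat 11 (by decide)]; exact hpre)).mono ?_
  rintro m₆ t₆ ⟨ht₆, hk⟩
  have hd := dominant_caduceus hL (hL ▸ hS) (hL ▸ ho) (hL ▸ hx) hw hdom
  have e₁₄ : m₅.var 14 = m.var 14 := by
    rw [hF₅.var 14 (by decide)]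
    exact (hF₃.var 14 (by decide)).trans
      ((hF₂.var 14 (by decide)).trans (hF₁.var 14 (by decide)))
  have e₁₂ : m₅.nat 12 = m.nat 12 := by
    rw [hF₅.nat 12 (by decide)]
    exact (hF₃.nat 12 (by decide)).trans
      ((hF₂.nat 12 (by decide)).trans (hF₁.nat 12 (by decide)))
  have e₂₂ : m₅.real 2 2 = m.real 2 2 := by
    rw [hr₂]
    show m₃.real 2 2 = _
    rw [hF₃.real 2 (by decide), hF₂.real 2 (by decide), hF₁.real 2 (by decide)]
  refine ⟨?_, σ, m₅.real 2 1, ⟨hσ, hd.1.1, fun z hz => ?_⟩, fun ρ hρ hρo => hd.2 ρ hρ hρo _ hb, ?_⟩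
  · simp only [hsz, NatExpr.eval, NatExpr.cost, cost_caduceusSize, List.length_map, hσ, h₁₃,
      encodeGraph_length]
    omega
  · obtain ⟨y, hy, hzy⟩ := hd.1.2 z hz
    exact hzy.trans (hub y hy)
  · rw [e₁₄, e₂₂] at hk
    rcases hk with ⟨k₁, k₂, rfl⟩ | ⟨k₁, k₂, k₃, k₄⟩
    · exact Or.inl ⟨k₁, k₂, e₁₄, e₂₂, e₁₂⟩
    · exact Or.inr ⟨k₁, k₂, k₃, k₄⟩

/-- Try all lists of branch nodes. -/
def search (P : Prog) : Prog := for_ 7 (.var 6) (block [decode, checkOrder,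
  .ite (.natEq (.var 12) (.const 1)) (tryOrder P) skip])

/-- A call assigns only its output array, so the names assigned by `search P` do not depend on `P`.
With `skip` in place of `P`, they can be computed by `decide`. -/
theorem Frame.of_search {P : Prog} {m m' : Mem} (h : Frame (search P) m m') :
    Frame (search skip) m m' := ⟨h.var, h.nat, h.real⟩

/-- The best schedule so far is in array `12` and its peak in entry `2` of the real array `2`,
where the numbers below `c` have been tried. -/
structure Searched (G : ComputationGraph (Fin n)) (s t : Fin n) (B : List (Fin n)) (c : ℕ)
    (m : Mem) : Prop where
  found : ∀ c' < c, ValidOrder G.edges s t (digitList B s c') →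
    m.var 14 ≠ 0 ∧ IsLowerBound G s t (digitList B s c') (m.real 2 2)
  achieves : m.var 14 ≠ 0 → ∃ τ, Achieves G τ (m.real 2 2) ∧ Pre (m.nat 12) (τ.map Fin.val)

theorem Searched.of_eq {G : ComputationGraph (Fin n)} {s t : Fin n} {B : List (Fin n)} {c : ℕ}
    {m m' : Mem} (h : Searched G s t B c m) (hv : m'.var 14 = m.var 14)
    (hn : m'.nat 12 = m.nat 12) (hr : m'.real 2 2 = m.real 2 2) : Searched G s t B c m' :=
  ⟨by rw [hv, hr]; exact h.found, by rw [hv, hr, hn]; exact h.achieves⟩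

theorem Searched.succ {G : ComputationGraph (Fin n)} {s t : Fin n} {B : List (Fin n)} {c : ℕ}
    {m : Mem} (h : Searched G s t B c m) (hc : ¬ ValidOrder G.edges s t (digitList B s c)) :
    Searched G s t B (c + 1) m := by
  refine ⟨fun c' hc' ho => ?_, h.achieves⟩
  rcases Nat.lt_succ_iff_lt_or_eq.1 hc' with h' | rfl
  · exact h.found c' h' ho
  · exact absurd ho hc

/-- The stored peak is attained by the stored schedule and is a lower bound for all schedules whose
branch order has been tried; it can only decrease. -/
theorem wp_search {P : Prog} {f : ℕ → ℕ} (hP : SolvesCaduceus P f)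
    {G : ComputationGraph (Fin n)} {L : List (Fin n × Fin n)} (hL : L.toFinset = G.edges)
    (hnd : L.Nodup) {s t : Fin n} (hS : InTreeWithSource G.edges s t) {m : Mem}
    (hm : Prepared L s t m) (hG : HasSizes G m) (h₁₄ : m.var 14 = 0) {k : ℕ}
    (hk : (branchList G.edges s t).length = k) :
    Wp (search P) m fun m' τ =>
      τ ≤ k ^ k * (k * (k ^ k * 20 + 600) + L.length * 300 + n * 700 + 1500 + f (2 * n + 1)) + 10 ∧
      Searched G s t (branchList G.edges s t) (k ^ k) m' := by
  have hbr : branchList L.toFinset s t = branchList G.edges s t := by rw [hL]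
  refine (wp_for (k ^ k) (k * (k ^ k * 20 + 600) + L.length * 300 + n * 700 + 1400 + f (2 * n + 1))
    (Searched G s t (branchList G.edges s t)) ?_ ?_ ?_ ?_).mono ?_
  · show 7 ∉ (block [decode, checkOrder,
      .ite (.natEq (.var 12) (.const 1)) (tryOrder skip) skip]).wv
    decide
  · intro m' hF
    have := (Frame.of_search hF).var 6 (by decide)
    simp [NatExpr.eval, this, hm.total, hbr, hk]
  · exact ⟨by simp, by simp [h₁₄]⟩
  · intro c m₀ hc hF hx hI
    have hF₀ := Frame.of_search hF
    have hm₀ := hm.frame hF₀ (by decide) (by decide)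
    have hG₀ := hG.of_eq (hF₀.real 0 (by decide))
    have h₆ := hm₀.list
    have h₅ := hm₀.count
    rw [hbr] at h₆ h₅
    set B := branchList G.edges s t with hB
    rw [wp_block_cons]
    refine (wp_decode (s := s) hc.le hm₀.nodes h₅ h₆ hx).mono_frame ?_
    rintro m₁ t₁ hF₁ ⟨ht₁, h₈, h₈'⟩
    have hm₁ := hm₀.frame hF₁ (by decide) (by decide)
    have hG₁ := hG₀.of_eq (hF₁.real 0 (by decide))
    rw [wp_block_cons]
    refine (wp_checkOrder (hL ▸ hS) hm₁ (by rw [hbr]; exact digitList_subset)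
      (by rw [hbr, length_digitList]) h₈).mono_frame ?_
    rintro m₂ t₂ hF₂ ⟨ht₂, h₁₂⟩
    have hm₂ := hm₁.frame hF₂ (by decide) (by decide)
    have hG₂ := hG₁.of_eq (hF₂.real 0 (by decide))
    have hI₂ : Searched G s t B c m₂ := hI.of_eq
      ((hF₂.var 14 (by decide)).trans (hF₁.var 14 (by decide)))
      ((hF₂.nat 12 (by decide)).trans (hF₁.nat 12 (by decide)))
      (by rw [hF₂.real 2 (by decide), hF₁.real 2 (by decide)])
    rw [hL] at h₁₂
    rw [length_digitList, hk] at ht₂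
    rw [hk] at ht₁
    rw [wp_block_singleton, wp_ite, Test.holds_natEq]
    simp only [NatExpr.eval, Test.cost_natEq, NatExpr.cost]
    split_ifs with h
    · have ho := h₁₂.1 h
      refine (wp_tryOrder hP hL hnd hS ho hm₂ hG₂ ?_ ?_ ?_).mono ?_
      · rw [hm₂.count, hbr, length_digitList]
      · rw [hF₂.nat 8 (by decide)]; exact h₈
      · rw [hF₂.nat 8 (by decide), length_digitList]; exact h₈'
      · rintro m₃ t₃ ⟨ht₃, τ, b, hτ, hlb, hor⟩
        rw [length_digitList, hk] at ht₃
        refine ⟨by rw [Nat.mul_add] at *; omega, Searched.of_eq (m := m₃) ?_ (by simp) rfl rfl⟩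
        rcases hor with ⟨o₁, o₂, o₃, o₄, o₅⟩ | ⟨o₁, o₂, o₃, o₄⟩
        · refine Searched.of_eq ⟨fun c' hc' ho' => ?_, hI₂.achieves⟩ o₃ o₅ o₄
          rcases Nat.lt_succ_iff_lt_or_eq.1 hc' with h' | rfl
          · exact hI₂.found c' h' ho'
          · exact ⟨o₁, hlb.anti o₂.le⟩
        · refine ⟨fun c' hc' ho' => ⟨by simp [o₂], ?_⟩, fun _ => ⟨τ, o₃ ▸ hτ, o₄⟩⟩
          rw [o₃]
          rcases Nat.lt_succ_iff_lt_or_eq.1 hc' with h' | rfl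
          -- Lower bounds for earlier orders survive, as the new peak is at most the stored one.
          · exact (hI₂.found c' h' ho').2.anti (o₁ (hI₂.found c' h' ho').1)
          · exact hlb
    · rw [wp_skip]
      refine ⟨by rw [Nat.mul_add] at *; omega, ?_⟩
      exact (hI₂.succ fun ho => h (h₁₂.2 ho)).of_eq (by simp) rfl rfl
  · rintro m' τ ⟨hτ, hI⟩
    refine ⟨hτ.trans ?_, hI⟩
    simp only [NatExpr.cost]
    have : k ^ k * (9 + 1 + (k * (k ^ k * 20 + 600) + L.length * 300 + n * 700 + 1400 +
        f (2 * n + 1))) ≤ k ^ k * (k * (k ^ k * 20 + 600) + L.length * 300 + n * 700 + 1500 +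
        f (2 * n + 1)) := Nat.mul_le_mul_left _ (by omega)
    omega

/-- Output the schedule in array `12`, contracted. -/
def finish : Prog := block [
  .setVar 0 (.const 0),
  for_ 8 caduceusSize (.ite (.natLe (.add (.get 12 (.var 8)) (.const 1)) (.var 2))
    (block [.setNat 0 (.var 0) (.get 12 (.var 8)), .setVar 0 (.add (.var 0) (.const 1))]) skip)]

theorem wp_finish {m : Mem} (h₂ : m.var 2 = n) {τ : List (Fin (2 * n + 1))}
    (hlen : τ.length = 2 * n + 1) (h : Pre (m.nat 12) (τ.map Fin.val)) :
    Wp finish m fun m' t => t ≤ (2 * n + 1) * 50 + 20 ∧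
      m'.output = (contract τ).map Fin.val := by
  simp only [finish, wp_block_cons, wp_block_singleton, wp_setVar]
  refine (wp_for (2 * n + 1) 30 (fun i m' =>
      m'.var 0 = (((τ.map Fin.val).take i).filter (· < n)).length ∧
      Pre (m'.nat 0) (((τ.map Fin.val).take i).filter (· < n))) (by decide) ?_ ?_ ?_).mono ?_
  · intro m' hF
    simp [eval_caduceusSize, hF.var 2 (by decide), h₂]
    ring
  · simp [NatExpr.eval, Pre]
  · rintro i m' hi hF hx ⟨hI, hI'⟩
    have hn₁₂ : m'.nat 12 = m.nat 12 := by rw [hF.nat 12 (by decide)]; simp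
    have hv₂ : m'.var 2 = n := by rw [hF.var 2 (by decide)]; simpa using h₂
    have hi' : i < (τ.map Fin.val).length := by simp [hlen, hi]
    have hv := h i hi'
    rw [List.take_succ_eq_append_getElem hi', List.filter_append]
    have hz : (Test.natLe (.add (.get 12 (.var 8)) (.const 1)) (.var 2)).holds m' ↔
        (τ.map Fin.val)[i] < n := by
      simp only [Test.holds, NatExpr.eval, hx, hn₁₂, hv, hv₂]
      omega
    rw [wp_ite]
    by_cases hn : (τ.map Fin.val)[i] < n
    · have := hI'.push (τ.map Fin.val)[i] hI
      rw [if_pos (hz.2 hn), wp_block_cons, wp_setNat, wp_block_singleton, wp_setVar,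
        List.filter_cons_of_pos (by simpa using hn), List.filter_nil]
      refine ⟨by simp [Test.cost, NatExpr.cost], ?_, ?_⟩
      · simp [NatExpr.eval, hI]
      · simpa [NatExpr.eval, hx, hn₁₂, hv] using this
    · rw [if_neg (mt hz.1 hn), wp_skip, List.filter_cons_of_neg (by simpa using hn), List.filter_nil,
        List.append_nil]
      exact ⟨by simp [Test.cost, NatExpr.cost], by simpa using hI, by simpa using hI'⟩
  · rintro m' t ⟨ht, hI, hI'⟩
    simp only [NatExpr.cost, cost_caduceusSize] at ht ⊢
    refine ⟨by omega, ?_⟩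
    rw [map_val_contract, Mem.output]
    rw [List.take_of_length_le (by simp [hlen])] at hI hI'
    exact hI'.map_range hI

end RealRAM

/-! ### The algorithm for starborescences -/

/-- The number of orders that are tried, in terms of the maximum out-degree. -/
theorem pow_le_two_rpow {k d : ℕ} (hd : 1 ≤ d) (hk : k ≤ 4 * d) :
    (k : ℝ) ^ (2 * k + 1) ≤ 4 ^ 9 * (2 : ℝ) ^ (27 * ((d : ℝ) * Real.logb 2 d)) := by
  -- The exponent: `2 * k + 1 ≤ 8 * d + 1 ≤ 9 * d`.
  have h₁ : k ^ (2 * k + 1) ≤ (4 * d) ^ (9 * d) :=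
    (Nat.pow_le_pow_left hk _).trans (Nat.pow_le_pow_right (by omega) (by omega))
  have h₂ : (k : ℝ) ^ (2 * k + 1) ≤ (4 * d : ℝ) ^ (9 * d) := by exact_mod_cast h₁
  refine h₂.trans ?_
  have hd₀ : (0 : ℝ) < d := by exact_mod_cast hd
  have h₃ : (2 : ℝ) ^ (27 * ((d : ℝ) * Real.logb 2 d)) = (d : ℝ) ^ (27 * d) := by
    rw [← mul_assoc, mul_comm (27 * (d : ℝ)), Real.rpow_mul (by norm_num),
      Real.rpow_logb (by norm_num) (by norm_num) hd₀]
    exact_mod_cast Real.rpow_natCast (d : ℝ) (27 * d)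
  rw [h₃]
  -- For `d = 1` the power of two is `1`, which is why the factor `4 ^ 9` is needed; for `d ≥ 2`, `4
  -- * d ≤ d ^ 3`.
  rcases hd.eq_or_lt with rfl | hd₂
  · norm_num
  · have h₄ : (4 * d : ℝ) ≤ (d : ℝ) ^ 3 := by
      have : (2 : ℝ) ≤ d := by exact_mod_cast hd₂
      have h : (4 : ℝ) ≤ (d : ℝ) ^ 2 := by nlinarith
      calc (4 * d : ℝ) ≤ (d : ℝ) ^ 2 * d := mul_le_mul_of_nonneg_right h hd₀.le
        _ = (d : ℝ) ^ 3 := by ring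
    calc (4 * d : ℝ) ^ (9 * d) ≤ ((d : ℝ) ^ 3) ^ (9 * d) := by gcongr
      _ = (d : ℝ) ^ (27 * d) := by rw [← pow_mul]; congr 1; ring
      _ ≤ 4 ^ 9 * (d : ℝ) ^ (27 * d) := le_mul_of_one_le_left (by positivity) (by norm_num)

/-! ### Correctness and running time of the whole algorithm -/

namespace RealRAM

open Prog

variable {n : ℕ}

theorem hasSizes_ofInput (G : ComputationGraph (Fin n)) (ns : List ℕ) :
    HasSizes G (Mem.ofInput ns (List.ofFn G.size ++ List.ofFn G.scratch)) := by
  constructor <;> intro v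
  · simp [Mem.ofInput, List.getD_eq_getElem?_getD, List.getElem?_append_left]
  · simp [Mem.ofInput, List.getD_eq_getElem?_getD]

/-- Find a dominant schedule of a starborescence, with calls of a program for caduceus graphs. -/
def starborescence (P : Prog) : Prog := block [prepare, search P, finish]

/-- The branch order of any schedule is valid and a permutation of the branch nodes, so it is among
the lists tried. Hence the final peak is below the peak of every schedule. -/
theorem computes_starborescence {P : Prog} {f : ℕ → ℕ} (hP : SolvesCaduceus P f)
    {G : ComputationGraph (Fin n)} {L : List (Fin n × Fin n)} (hL : L.toFinset = G.edges)
    (hnd : L.Nodup) {s t : Fin n} (hS : InTreeWithSource G.edges s t) {k : ℕ}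
    (hk : (branchList G.edges s t).length = k) :
    ∃ (σ : List (Fin n)) (τ : ℕ), Computes (starborescence P) (encodeGraph L)
        (List.ofFn G.size ++ List.ofFn G.scratch) (σ.map Fin.val) τ ∧
      IsDominant G.edges G.profile σ ∧ τ ≤ n ^ 2 * 1000 +
        (k ^ k * (k * (k ^ k * 20 + 600) + L.length * 300 + n * 700 + 1500 + f (2 * n + 1)) + 10) +
        ((2 * n + 1) * 50 + 20) := by
  have key : Wp (starborescence P)
      (Mem.ofInput (encodeGraph L) (List.ofFn G.size ++ List.ofFn G.scratch)) fun m τ =>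
      ∃ σ : List (Fin n), m.output = σ.map Fin.val ∧ IsDominant G.edges G.profile σ ∧
        τ ≤ n ^ 2 * 1000 + (k ^ k * (k * (k ^ k * 20 + 600) + L.length * 300 + n * 700 + 1500 +
          f (2 * n + 1)) + 10) + ((2 * n + 1) * 50 + 20) := by
    rw [starborescence, wp_block_cons]
    refine (wp_prepare hnd (hL ▸ hS) _).mono ?_
    rintro m₁ t₁ ⟨ht₁, hm₁, hr, h₁₄⟩
    rw [wp_block_cons]
    refine (wp_search hP hL hnd hS hm₁ ((hasSizes_ofInput G _).of_eq hr) h₁₄ hk).mono_frame ?_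
    rintro m₂ t₂ hF₂ ⟨ht₂, hI⟩
    have hfound : ∀ σ, IsSchedule G.edges σ →
        m₂.var 14 ≠ 0 ∧ ∃ z ∈ G.profile σ, m₂.real 2 2 ≤ z := by
      intro σ hσ
      have ho := hσ.validOrder hS
      have hperm : (branchOrder G.edges s t σ).Perm (branchList G.edges s t) :=
        (List.perm_ext_iff_of_nodup ho.nodup (nodup_branchList _ _ _)).2 fun v => by
          rw [hσ.mem_branchOrder, mem_branchList]
      obtain ⟨c, hc, hcd⟩ := exists_digitList_eq s hperm.length_eq hperm.subset
      rw [hk] at hc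
      obtain ⟨h₁, h₂⟩ := hI.found c hc (hcd ▸ ho)
      exact ⟨h₁, h₂ σ hσ hcd.symm⟩
    -- A DAG has some schedule, so at least one order was valid and a schedule has been stored.
    obtain ⟨σ₀, hσ₀⟩ := G.acyclic.exists_isSchedule
    obtain ⟨τ, hτ, hpre⟩ := hI.achieves (hfound σ₀ hσ₀).1
    rw [wp_block_singleton]
    refine (wp_finish (((Frame.of_search hF₂).var 2 (by decide)).trans hm₁.nodes)
      hτ.length hpre).mono ?_
    rintro m₃ t₃ ⟨ht₃, hout⟩
    refine ⟨contract τ, hout, ⟨hτ.isSchedule, fun σ hσ => ?_⟩, by omega⟩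
    obtain ⟨-, z, hz, hle⟩ := hfound σ hσ
    exact G.dominates_profile hz fun x hx => (hτ.le x hx).trans hle
  obtain ⟨m, τ, he, σ, hout, hdom, hτ⟩ := key
  exact ⟨σ, τ, ⟨m, he, hout⟩, hdom, hτ⟩

end RealRAM

/-- The dominant term is `k ^ k` lists times `k * k ^ k` for decoding each; everything else is
absorbed by `1 ≤ k` and `n ≤ n ^ 2`. -/
theorem cost_starborescence_le {n k l F : ℕ} (hn : 1 ≤ n) (hk : 1 ≤ k) (hl : l ≤ 2 * n) :
    n ^ 2 * 1000 + (k ^ k * (k * (k ^ k * 20 + 600) + l * 300 + n * 700 + 1500 + F) + 10) +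
      ((2 * n + 1) * 50 + 20) ≤ k ^ (2 * k + 1) * (5000 * (n ^ 2 + F)) := by
  have hK : 1 ≤ k ^ k := Nat.one_le_pow _ _ hk
  have e : k ^ (2 * k + 1) = k ^ k * (k ^ k * k) := by rw [pow_succ, two_mul, pow_add]; ring
  rw [e]
  clear e
  generalize k ^ k = K at *
  have hKk : 1 ≤ K * k := Nat.mul_pos hK hk
  have hnn : n ≤ n ^ 2 := by nlinarith
  generalize n ^ 2 = N at *
  have h₁ : k * (K * 20 + 600) + l * 300 + n * 700 + 1500 + F ≤ K * k * (3500 * N + F) := by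
    have a₁ : k * (K * 20 + 600) ≤ K * k * 620 := by nlinarith
    -- With `l ≤ 2 * n`, the constant is `600 + 700 + 1500 = 2800`.
    have a₂ : l * 300 + n * 700 + 1500 + F ≤ K * k * (2800 * N + F) :=
      calc _ ≤ 2800 * N + F := by linarith
        _ ≤ _ := le_mul_of_one_le_left (Nat.zero_le _) hKk
    have a₃ : K * k * 620 ≤ K * k * (620 * N) := Nat.mul_le_mul_left _ (by omega)
    calc _ ≤ K * k * (620 * N) + K * k * (2800 * N + F) := by linarith
      _ = K * k * (620 * N + (2800 * N + F)) := by ring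
      _ ≤ _ := Nat.mul_le_mul_left _ (by omega)
  have h₂ : N * 1000 + 10 + ((2 * n + 1) * 50 + 20) ≤ K * (K * k) * (1200 * N) :=
    calc _ ≤ 1200 * N := by linarith
      _ ≤ _ := le_mul_of_one_le_left (Nat.zero_le _) (Nat.mul_pos hK hKk)
  calc _ ≤ K * (K * k * (3500 * N + F)) + K * (K * k) * (1200 * N) := by
        have := Nat.mul_le_mul_left K h₁
        linarith
    _ = K * (K * k) * (3500 * N + F + 1200 * N) := by ring
    _ ≤ _ := by rw [← mul_assoc K K k]; exact Nat.mul_le_mul_left _ (by omega)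

/-- The running time, in terms of the numbers of nodes and the maximum out-degree. -/
theorem solvesStarborescence_starborescence {P : RealRAM.Prog} {f : ℕ → ℕ}
    (hP : SolvesCaduceus P f) : SolvesStarborescence (RealRAM.starborescence P) fun n d =>
      (2 : ℝ) ^ (27 * ((d : ℝ) * Real.logb 2 d)) *
        (4 ^ 9 * 5000 * ((n : ℝ) ^ 2 + (f (2 * n + 1) : ℝ))) := by
  intro n G hG L hnd hL
  obtain ⟨s, t, hS⟩ := hG.exists_inTreeWithSource G.acyclic
  obtain ⟨σ, τ, hc, hd, hτ⟩ := RealRAM.computes_starborescence hP hL hnd hS rfl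
  refine ⟨σ, τ, hc, hd, ?_⟩
  set k := (RealRAM.branchList G.edges s t).length with hk
  have hkc : k = (Finset.univ.filter fun v => ¬ IsInner G.edges s t v).card := by
    rw [hk, ← List.toFinset_card_of_nodup (RealRAM.nodup_branchList _ _ _)]
    congr 1
    ext v
    simp [RealRAM.mem_branchList]
  have hd₁ : (outNbrs G.edges s).card ≤ maxOutDegree G.edges :=
    Finset.le_sup (f := fun v => (outNbrs G.edges v).card) (Finset.mem_univ s)
  have hd₂ := hS.card_outNbrs_pos
  have hk₁ := hS.card_branch_le
  have hk₂ : 1 ≤ k := by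
    rw [hkc]
    exact Finset.card_pos.2 ⟨_, by simpa using hS.not_inner_source⟩
  have hn : 1 ≤ n := by have := s.isLt; omega
  have hl : L.length ≤ 2 * n := by
    rw [← List.toFinset_card_of_nodup hnd, hL]
    exact hS.card_edges_le_two_mul
  have h₁ : (τ : ℝ) ≤ (k : ℝ) ^ (2 * k + 1) * (5000 * ((n : ℝ) ^ 2 + f (2 * n + 1))) := by
    exact_mod_cast hτ.trans (cost_starborescence_le hn hk₂ hl)
  -- The source has positive out-degree, so `k ≤ 2 * d + 2 ≤ 4 * d`.
  refine h₁.trans ((mul_le_mul_of_nonneg_right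
    (pow_le_two_rpow (d := maxOutDegree G.edges) (by omega) (by omega)) (by positivity)).trans_eq ?_)
  ring

theorem mainTheorem12 :
    ∃ c C : ℝ, ∀ (f : ℕ → ℕ) (P : RealRAM.Prog), SolvesCaduceus P f →
      ∃ Q : RealRAM.Prog,
        SolvesStarborescence Q (fun n d =>
          (2 : ℝ) ^ (c * ((d : ℝ) * Real.logb 2 d)) *
            (C * ((n : ℝ) ^ 2 + (f (2 * n + 1) : ℝ)))) ∧
        ∀ K : ℝ, 1 ≤ K → (∀ n, 1 ≤ n → (f (2 * n + 1) : ℝ) ≤ K * (f n : ℝ)) →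
          SolvesStarborescence Q (fun n d =>
            (2 : ℝ) ^ (c * ((d : ℝ) * Real.logb 2 d)) *
              (C * K * ((n : ℝ) ^ 2 + (f n : ℝ)))) := by
  -- `27` and `4 ^ 9` come from `pow_le_two_rpow`, `5000` from `cost_starborescence_le`.
  refine ⟨27, 4 ^ 9 * 5000, fun f P hP => ⟨RealRAM.starborescence P,
    solvesStarborescence_starborescence hP, fun K hK hf n G hG L hnd hL => ?_⟩⟩
  obtain ⟨σ, t, hc, hd, ht⟩ := solvesStarborescence_starborescence hP n G hG L hnd hL
  refine ⟨σ, t, hc, hd, ht.trans (mul_le_mul_of_nonneg_left ?_ (by positivity))⟩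
  have hn : 1 ≤ n := by
    obtain ⟨s, -⟩ := hG
    have := s.isLt
    omega
  have h₁ := hf n hn
  have h₂ : (n : ℝ) ^ 2 ≤ K * (n : ℝ) ^ 2 := le_mul_of_one_le_left (by positivity) hK
  calc (4 ^ 9 * 5000 * ((n : ℝ) ^ 2 + f (2 * n + 1)) : ℝ)
      ≤ 4 ^ 9 * 5000 * (K * (n : ℝ) ^ 2 + K * f n) :=
        mul_le_mul_of_nonneg_left (add_le_add h₂ h₁) (by norm_num)
    _ = 4 ^ 9 * 5000 * K * ((n : ℝ) ^ 2 + f n) := by ring
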